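/- **Theorem 4.3.** Let $S$ be a set of natural numbers with $|S|=2k$, $k\ge 1$, and let $\mathcal B$ be a building set on $S$, that is, a collection of nonempty subsets of $S$ which contains $\{i\}$ for all $i\in S$, and contains $I\cup J$ whenever $I,J\in\mathcal B$ and $I\cap J\neq\emptyset$. For $I\subseteq S$ put $\mathcal B|_I=\{J\in\mathcal B : J\subseteq I\}$; the connected components of a building set are its inclusion-maximal elements. Assume that $\mathcal B$ is chordal, i.e. $\{i_1<\dots<i_r\}\in\mathcal B$ implies $\{i_s,\dots,i_r\}\in\mathcal B$ for all $1\le s\le r$, and that no connected component of $\mathcal B$ has odd cardinality. Let $$\widehat{\mathcal P}_{\mathcal B}=\{I\subseteq S : \mathcal B|_I\text{ has no connected component of odd cardinality}\},\qquad \mathcal P_{\mathcal B}=\widehat{\mathcal P}_{\mathcal B}\setminus\{\emptyset,S\},$$ ordered by inclusion, and let $\Delta(\mathcal P_{\mathcal B})$ be the order complex, whose simplices are the nonempty finite chains of $\mathcal P_{\mathcal B}$. A permutation $x=(x_1x_2\cdots x_{2k})$ of $S$ is a $\mathcal B$-permutation if for every $i$ the numbers $x_i$ and $\max\{x_1,\dots,x_i\}$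 lie in the same connected component of $\mathcal B|_{\{x_1,\dots,x_i\}}$; it is alternating if $x_1>x_2<x_3>\cdots$. Then the geometric realization of $\Delta(\mathcal P_{\mathcal B})$ is homotopy equivalent to a wedge of spheres $\bigvee^{\mathrm{alt}(\mathcal B)}S^{k-2}$ for exactly one number $\mathrm{alt}(\mathcal B)\ge 0$ of spheres, and $\mathrm{alt}(\mathcal B)$ equals the number of alternating $\mathcal B$-permutations. (The wedge of no spheres is a point. If $k=1$, the complex is empty; it is regarded as one copy of $S^{-1}=\emptyset$, so that $\mathrm{alt}(\mathcal B)=1$.) -/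

import Mathlib

/-! Finite posets: order complexes, geometric realizations, bouquets of spheres. -/

/-- The order complex of a poset: its simplices are the nonempty finite chains. -/
def orderComplex (α : Type*) [PartialOrder α] : AbstractSimplicialComplex α where
  faces := {s | s.Nonempty ∧ IsChain (· ≤ ·) (s : Set α)}
  isRelLowerSet_faces := fun _ hs =>
    ⟨hs.1, fun _ hts ht => ⟨ht, hs.2.mono (Finset.coe_subset.mpr hts)⟩⟩
  singleton_mem := fun v => ⟨Finset.singleton_nonempty v, by simp⟩

/-- The geometric realization of a simplicial complex on a finite vertex set: barycentric
coordinates whose support is a simplex, with the topology induced from the finite-dimensional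
real vector space of all coordinate vectors. -/
abbrev AbstractSimplicialComplex.Realization {α : Type*} [Fintype α]
    (K : AbstractSimplicialComplex α) : Type _ :=
  {w : α → ℝ // w ∈ stdSimplex ℝ α ∧ Finset.univ.filter (fun a => w a ≠ 0) ∈ K.faces}

/-- The unit sphere of dimension `d`, in Euclidean space of dimension `d + 1`. -/
abbrev UnitSphere (d : ℕ) : Type :=
  Metric.sphere (0 : EuclideanSpace ℝ (Fin (d + 1))) 1

/-- The base point `(1, 0, …, 0)` of the unit sphere. -/
noncomputable def UnitSphere.base (d : ℕ) : UnitSphere d :=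
  ⟨EuclideanSpace.single 0 1, by simp⟩

/-- The gluing relation: the base points of all spheres are identified with one common point. -/
inductive WedgeRel (m d : ℕ) :
    Unit ⊕ (Fin m × UnitSphere d) → Unit ⊕ (Fin m × UnitSphere d) → Prop
  | glue (i : Fin m) : WedgeRel m d (Sum.inr (i, UnitSphere.base d)) (Sum.inl ())

/-- The wedge of `m` copies of the `d`-sphere (a point if `m = 0`), with the quotient topology. -/
def SphereWedge (m d : ℕ) : Type := Quot (WedgeRel m d)

instance (m d : ℕ) : TopologicalSpace (SphereWedge m d) :=
  inferInstanceAs (TopologicalSpace (Quot (WedgeRel m d)))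

/-- `IsSphereBouquet X n m`: the space `X` has the homotopy type of a wedge of `m` spheres of
dimension `n - 1`. The sphere of dimension `-1` is the empty space; it has no base point, so in
that dimension only the bouquet that consists of one sphere is considered. -/
def IsSphereBouquet (X : Type*) [TopologicalSpace X] : ℕ → ℕ → Prop
  | 0, m => m = 1 ∧ IsEmpty X
  | d + 1, m => Nonempty (ContinuousMap.HomotopyEquiv X (SphereWedge m d))

/-! Building sets on finite sets of natural numbers. -/

/-- `B` is a building set on `S`. -/
structure IsBuildingSet (S : Finset ℕ) (B : Finset (Finset ℕ)) : Prop where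
  subset : ∀ I ∈ B, I ⊆ S
  nonempty : ∀ I ∈ B, I.Nonempty
  singleton : ∀ i ∈ S, {i} ∈ B
  union : ∀ I ∈ B, ∀ J ∈ B, (I ∩ J).Nonempty → I ∪ J ∈ B

/-- Chordality: with `I`, every upper segment `{i ∈ I : a ≤ i}`, `a ∈ I`, lies in `B`. -/
def IsChordal (B : Finset (Finset ℕ)) : Prop :=
  ∀ I ∈ B, ∀ a ∈ I, I.filter (fun i => a ≤ i) ∈ B

/-- The restriction of `B` to `I`. -/
def restrictTo (B : Finset (Finset ℕ)) (I : Finset ℕ) : Finset (Finset ℕ) :=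
  B.filter (fun J => J ⊆ I)

/-- `C` is a connected component of `B`, that is, an inclusion-maximal element. -/
def IsComponent (B : Finset (Finset ℕ)) (C : Finset ℕ) : Prop :=
  Maximal (fun J => J ∈ B) C

/-- No connected component of `B` has odd cardinality. -/
def NoOddComponent (B : Finset (Finset ℕ)) : Prop :=
  ∀ C, IsComponent B C → ¬ Odd C.card

open Classical in
/-- The poset of all subsets `I` of `S` such that the restriction of `B` to `I` has no connected
component of odd order. -/
noncomputable def evenPosetHat (S : Finset ℕ) (B : Finset (Finset ℕ)) : Finset (Finset ℕ) :=
  S.powerset.filter (fun I => NoOddComponent (restrictTo B I))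

/-- The proper part of `evenPosetHat S B`: the sets `∅` and `S` are removed. It is used as a type,
ordered by inclusion. -/
noncomputable def evenPoset (S : Finset ℕ) (B : Finset (Finset ℕ)) : Finset (Finset ℕ) :=
  evenPosetHat S B \ {∅, S}

/-- The set `{x₁, …, xᵢ}` of the entries of `x` up to and including position `i`. -/
def initialEntries {S : Finset ℕ} (x : Fin S.card ≃ S) (i : Fin S.card) : Finset ℕ :=
  (Finset.Iic i).image (fun j => (x j : ℕ))

/-- A permutation `x` of `S` in one-line notation is a `B`-permutation if every entry `xᵢ` lies in
the same connected component of the restriction of `B` to `{x₁, …, xᵢ}` as the maximum of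
`{x₁, …, xᵢ}`. -/
def IsBPermutation {S : Finset ℕ} (B : Finset (Finset ℕ)) (x : Fin S.card ≃ S) : Prop :=
  ∀ i, ∃ C, IsComponent (restrictTo B (initialEntries x i)) C ∧
    (x i : ℕ) ∈ C ∧ (initialEntries x i).sup id ∈ C

/-- `x₁ > x₂ < x₃ > ⋯`; positions are counted from `0` here, so descents are at even positions. -/
def IsAlternating {S : Finset ℕ} (x : Fin S.card ≃ S) : Prop :=
  ∀ i j : Fin S.card, (j : ℕ) = i + 1 →
    (Even (i : ℕ) → (x j : ℕ) < x i) ∧ (Odd (i : ℕ) → (x i : ℕ) < x j)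

/-- The number of alternating `B`-permutations on `S`. -/
noncomputable def numAlternatingBPermutations (S : Finset ℕ) (B : Finset (Finset ℕ)) : ℕ :=
  {x : Fin S.card ≃ S | IsBPermutation B x ∧ IsAlternating x}.ncard

/-! Call a set even if its restricted building set has no odd component. The proof shells the order
complex, so that the homotopy type can be read off the shelling, and then counts the facets that
contribute spheres.

Between even sets J ⊂ I there is a distinguished even set A with two more elements than J, the first
atom (`IsFirst`): among the components of I not contained in J, take the one with the largest
maximum and add its two largest new elements. By chordality both are joined to that maximum inside
A, so A is even (`IsFirst.evenSet`), and A has a strictly larger label than every competing atom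
(`IsFirst.label_lt`). In particular all maximal chains are flags with k steps of size two. Being
first passes to smaller upper ends (`IsFirst.mono`) and can be tested on consecutive pairs of steps
(`IsFirst.trans`). Hence every chain T lies in exactly one flag that is first between the members of
T. A flag F plays this role for T exactly if T lies between R F and F, where R F consists of the
members at which F is not locally first. The intervals [R F, F] therefore partition the faces, and
the flag assigned to a face has the lexicographically largest labels among all flags through that
face. This is a shelling (`shelling_facets`).

For any pure shelling, the facets with R F ≠ F generate a complex that collapses facet by facet to a
simplex (`Shelling.contractibleSpace`), while each facet with R F = F is glued to it along its whole
boundary. Shrinking the contractible part to a point leaves one sphere for each of these facets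
(`Shelling.nonempty_homotopyEquiv`).

A facet with R F = F is a flag that is nowhere locally first. Writing the two new elements of each
step with the larger one in front turns such flags into alternating `B`-permutations, bijectively
(`numAlternatingBPermutations_eq`).

The number of spheres is a homotopy invariant because the total Alexander–Spanier cohomology modulo
two is one for compact sets. An iterated suspension of m + 1 points is a shellable model of the
wedge of m spheres, and has 2 ^ m classes by Mayer–Vietoris (`exists_shelling_cohomologyCard`). -/

/-! Shellings of pure simplicial complexes and their collapsible part. -/

/-- The geometric realization, inside the standard simplex, of the simplicial complex generated
by a finite family of facets. -/
def polyhedron {α : Type*} [Fintype α] (𝓕 : Finset (Finset α)) : Set (α → ℝ) :=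
  {w | w ∈ stdSimplex ℝ α ∧ ∃ F ∈ 𝓕, ∀ a, a ∉ F → w a = 0}

/-- The faces of the complex generated by `𝓕` (including the empty face) are partitioned into the
intervals `[R F, F]`, and the interval of a face of `F` comes no later than `F` in the order
given by `ρ`. -/
structure Shelling {α : Type*} (𝓕 : Finset (Finset α)) (R : Finset α → Finset α)
    (ρ : Finset α → ℕ) : Prop where
  restrict_subset : ∀ F ∈ 𝓕, R F ⊆ F
  unique : ∀ F ∈ 𝓕, ∀ G ∈ 𝓕, ∀ τ, R F ⊆ τ → τ ⊆ F → R G ⊆ τ → τ ⊆ G → F = G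
  exists_le : ∀ F ∈ 𝓕, ∀ τ ⊆ F, ∃ G ∈ 𝓕, R G ⊆ τ ∧ τ ⊆ G ∧ (G = F ∨ ρ G < ρ F)

/-! ### Elementary collapses by pushing away from a face. -/

section Push

variable {α : Type*} [DecidableEq α]

/-- A deformation pushing the simplices that contain `R` away from the barycenter of `R` in the
direction of the vertex `v`. -/
noncomputable def push (R : Finset α) (hR : R.Nonempty) (v : α) (t : ℝ)
    (w : α → ℝ) : α → ℝ := fun a =>
  w a - (if a ∈ R then t * R.inf' hR w else 0) + if a = v then t * (R.card * R.inf' hR w) else 0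

theorem continuous_push (R : Finset α) (hR : R.Nonempty) (v : α) :
    Continuous fun p : ℝ × (α → ℝ) => push R hR v p.1 p.2 := by
  have h : Continuous fun p : ℝ × (α → ℝ) => R.inf' hR p.2 := by
    have : (fun p : ℝ × (α → ℝ) => R.inf' hR p.2) = fun p => R.inf' hR fun a => p.2 a := rfl
    rw [this]
    exact Continuous.finset_inf'_apply hR fun i _ => by fun_prop
  refine continuous_pi fun a => ?_
  unfold push
  split_ifs <;> fun_prop

theorem push_eq_self {R : Finset α} (hR : R.Nonempty) {v : α} {t : ℝ} {w : α → ℝ}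
    (hw : R.inf' hR w = 0) : push R hR v t w = w := by
  ext a
  simp [push, hw]

end Push

section Polyhedron

variable {α : Type*} [Fintype α]

theorem polyhedron_mono {𝓕 𝓖 : Finset (Finset α)} (h : 𝓕 ⊆ 𝓖) :
    polyhedron 𝓕 ⊆ polyhedron 𝓖 :=
  fun _ ⟨hw, F, hF, hwF⟩ => ⟨hw, F, h hF, hwF⟩

theorem isCompact_polyhedron (𝓕 : Finset (Finset α)) : IsCompact (polyhedron 𝓕) := by
  have h : polyhedron 𝓕 = stdSimplex ℝ α ∩
      ⋃ F ∈ (𝓕 : Set (Finset α)), ⋂ a ∈ {a | a ∉ F}, {w : α → ℝ | w a = 0} := by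
    ext w
    simp [polyhedron]
  rw [h]
  refine (isCompact_stdSimplex ℝ α).inter_right ?_
  refine 𝓕.finite_toSet.isClosed_biUnion fun F _ => ?_
  exact isClosed_biInter fun a _ => isClosed_eq (continuous_apply a) continuous_const

theorem single_mem_polyhedron [DecidableEq α] {𝓕 : Finset (Finset α)} {F : Finset α} (hF : F ∈ 𝓕)
    {v : α} (hv : v ∈ F) : (Pi.single v 1 : α → ℝ) ∈ polyhedron 𝓕 :=
  ⟨single_mem_stdSimplex ℝ v, F, hF, fun a ha => by
    rw [Pi.single_eq_of_ne]; rintro rfl; exact ha hv⟩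

theorem convex_polyhedron_singleton (F : Finset α) : Convex ℝ (polyhedron {F}) := by
  have h : polyhedron {F} = stdSimplex ℝ α ∩ ⋂ a ∈ {a | a ∉ F}, {w : α → ℝ | w a = 0} := by
    ext w
    simp [polyhedron]
  rw [h]
  refine (convex_stdSimplex ℝ α).inter (convex_iInter₂ fun a _ => ?_)
  intro x hx y hy s t _ _ _
  simp only [Set.mem_ofPred_eq] at hx hy ⊢
  simp [hx, hy]

/-- A vertex of R outside the support forces the minimum over R to be 0. Thus `push` fixes all
points of faces that do not contain R. -/
theorem inf'_eq_zero {R : Finset α} (hR : R.Nonempty) {G : Finset α} {w : α → ℝ}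
    (hw : w ∈ stdSimplex ℝ α)
    (hwG : ∀ a, a ∉ G → w a = 0) (hRG : ¬ R ⊆ G) : R.inf' hR w = 0 := by
  obtain ⟨r, hr, hrG⟩ := Finset.not_subset.mp hRG
  refine le_antisymm ?_ (Finset.le_inf' hR w fun a _ => hw.1 a)
  exact (Finset.inf'_le w hr).trans (hwG r hrG).le

variable [DecidableEq α] {s : Finset (Finset α)} {F R : Finset α} {v : α}

/-- The mass t * min taken from each vertex of R is handed to v, so the total stays 1; since t ≤ 1,
no coordinate becomes negative. -/
theorem push_mem (hR : R.Nonempty) (hRF : R ⊆ F) (hvF : v ∈ F) (h1 : ∀ G ∈ s, ¬ R ⊆ G) {t : ℝ}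
    (ht : t ∈ Set.Icc (0 : ℝ) 1) {w : α → ℝ} (hw : w ∈ polyhedron (insert F s)) :
    push R hR v t w ∈ polyhedron (insert F s) := by
  obtain ⟨hw, G, hG, hwG⟩ := hw
  rcases Finset.mem_insert.mp hG with rfl | hGs
  · have h0 : 0 ≤ R.inf' hR w := Finset.le_inf' hR w fun a _ => hw.1 a
    refine ⟨⟨fun a => ?_, ?_⟩, G, Finset.mem_insert_self _ _, fun a ha => ?_⟩
    · have h2 : (0 : ℝ) ≤ if a = v then t * (R.card * R.inf' hR w) else 0 := by
        split_ifs
        · exact mul_nonneg ht.1 (by positivity)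
        · exact le_rfl
      have h3 : (if a ∈ R then t * R.inf' hR w else 0) ≤ w a := by
        split_ifs with har
        · exact (mul_le_of_le_one_left h0 ht.2).trans (Finset.inf'_le w har)
        · exact hw.1 a
      unfold push
      linarith
    · simp only [push, Finset.sum_add_distrib, Finset.sum_sub_distrib, hw.2, Finset.sum_ite_mem,
        Finset.univ_inter, Finset.sum_const, nsmul_eq_mul, Finset.sum_ite_eq', Finset.mem_univ,
        if_true]
      ring
    · have h4 : a ∉ R := fun h => ha (hRF h)
      have h5 : a ≠ v := fun h => ha (h ▸ hvF)
      simp [push, h4, h5, hwG a ha]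
  · rw [push_eq_self hR (inf'_eq_zero hR hw hwG (h1 G hGs))]
    exact ⟨hw, G, hG, hwG⟩

theorem push_one_mem (hR : R.Nonempty) (hRF : R ⊆ F) (hvF : v ∈ F) (hvR : v ∉ R)
    (h1 : ∀ G ∈ s, ¬ R ⊆ G)
    (h2 : ∀ τ ⊆ F, ¬ R ⊆ τ → ∃ G ∈ s, τ ⊆ G) {w : α → ℝ} (hw : w ∈ polyhedron (insert F s)) :
    push R hR v 1 w ∈ polyhedron s := by
  have h3 := push_mem hR hRF hvF h1 (t := 1) (by simp) hw
  obtain ⟨hw, G, hG, hwG⟩ := hw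
  rcases Finset.mem_insert.mp hG with rfl | hGs
  -- At time 1 a vertex r of R where the minimum is attained has lost all its mass, because v is not
  -- in R. The image lies in the face opposite to r, which is covered by an older facet.
  · obtain ⟨r, hr, hrw⟩ := Finset.exists_mem_eq_inf' hR w
    obtain ⟨G', hG', hτ⟩ := h2 (G.erase r) (Finset.erase_subset _ _)
      fun h => Finset.notMem_erase r G (h hr)
    refine ⟨h3.1, G', hG', fun a ha => ?_⟩
    by_cases har : a = r
    · subst har
      have : a ≠ v := fun h => hvR (h ▸ hr)
      simp [push, hr, this, hrw]
    · have haG : a ∉ G := fun h => ha (hτ (Finset.mem_erase.mpr ⟨har, h⟩))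
      have h4 : a ∉ R := fun h => haG (hRF h)
      have h5 : a ≠ v := fun h => haG (h ▸ hvF)
      simp [push, h4, h5, hwG a haG]
  · rw [push_eq_self hR (inf'_eq_zero hR hw hwG (h1 G hGs))]
    exact ⟨hw, G, hGs, hwG⟩

/-- Removing all faces between `R` and `F` does not change the homotopy type. -/
theorem nonempty_homotopyEquiv_of_collapse (hR : R.Nonempty) (hRF : R ⊆ F) (hvF : v ∈ F)
    (hvR : v ∉ R)
    (h1 : ∀ G ∈ s, ¬ R ⊆ G) (h2 : ∀ τ ⊆ F, ¬ R ⊆ τ → ∃ G ∈ s, τ ⊆ G) :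
    Nonempty (ContinuousMap.HomotopyEquiv (polyhedron (insert F s)) (polyhedron s)) := by
  have hc := continuous_push R hR v
  let r : C(polyhedron (insert F s), polyhedron s) :=
    ⟨fun w => ⟨push R hR v 1 w, push_one_mem hR hRF hvF hvR h1 h2 w.2⟩,
      Continuous.subtype_mk (hc.comp (by fun_prop : Continuous fun w : polyhedron (insert F s) =>
        ((1 : ℝ), (w : α → ℝ)))) _⟩
  let i : C(polyhedron s, polyhedron (insert F s)) :=
    ⟨fun w => ⟨w, polyhedron_mono (Finset.subset_insert _ _) w.2⟩,
      Continuous.subtype_mk continuous_subtype_val _⟩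
  refine ⟨⟨r, i, ContinuousMap.Homotopic.symm ⟨⟨⟨fun p => ⟨push R hR v p.1 p.2, push_mem hR hRF hvF h1
    p.1.2 p.2.2⟩, Continuous.subtype_mk (hc.comp
      (by fun_prop : Continuous fun p : unitInterval × polyhedron (insert F s) =>
        ((p.1 : ℝ), (p.2 : α → ℝ)))) _⟩, fun w => ?_, fun w => rfl⟩⟩, ?_⟩⟩
  · apply Subtype.ext
    ext a
    simp [push]
  · have : r.comp i = ContinuousMap.id _ := by
      ext1 w
      apply Subtype.ext
      obtain ⟨hw, G, hG, hwG⟩ := w.2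
      exact push_eq_self hR (inf'_eq_zero hR hw hwG (h1 G hG))
    rw [this]

end Polyhedron

/-- Induction on the facets, removing one with the largest ρ. Since R F is a proper face of F,
removing the interval [R F, F] is a collapse, with any vertex of F outside R F as the direction of
the push; the last remaining facet is convex. -/
theorem Shelling.contractibleSpace {α : Type*} [Fintype α] {𝓕 : Finset (Finset α)}
    {R : Finset α → Finset α}
    {ρ : Finset α → ℕ} (h : Shelling 𝓕 R ρ) (hne : 𝓕.Nonempty) (hR : ∀ F ∈ 𝓕, R F ≠ F) :
    ContractibleSpace (polyhedron 𝓕) := by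
  classical
  induction 𝓕 using Finset.induction_on_max_value ρ with
  | empty => simp at hne
  | insert F s hFs hmax ih =>
    have hF : F ∈ insert F s := Finset.mem_insert_self _ _
    rcases s.eq_empty_or_nonempty with rfl | hs
    · have hFne : F.Nonempty := by
        rw [Finset.nonempty_iff_ne_empty]
        rintro rfl
        exact hR _ hF (Finset.subset_empty.mp (h.restrict_subset _ hF))
      obtain ⟨v, hv⟩ := hFne
      exact (convex_polyhedron_singleton F).contractibleSpace
        ⟨_, single_mem_polyhedron (Finset.mem_singleton_self F) hv⟩
    · have hs' : Shelling s R ρ := by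
        refine ⟨fun G hG => h.restrict_subset G (Finset.mem_insert_of_mem hG), fun G hG G' hG' =>
          h.unique G (Finset.mem_insert_of_mem hG) G' (Finset.mem_insert_of_mem hG'),
          fun G hG τ hτ => ?_⟩
        obtain ⟨G', hG', h1, h2, h3⟩ := h.exists_le G (Finset.mem_insert_of_mem hG) τ hτ
        refine ⟨G', ?_, h1, h2, h3⟩
        rcases h3 with rfl | h3
        · exact hG
        · refine (Finset.mem_insert.mp hG').resolve_left ?_
          rintro rfl
          exact absurd (hmax G hG) (not_le.mpr h3)
      have := ih hs' hs fun G hG => hR G (Finset.mem_insert_of_mem hG)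
      -- If an older facet contained R F, the face R F would also lie in the interval of an older
      -- facet, against the disjointness of the intervals.
      have h1 : ∀ G ∈ s, ¬ R F ⊆ G := by
        intro G hG hRG
        obtain ⟨G', hG', h2, h3, -⟩ := hs'.exists_le G hG (R F) hRG
        exact hFs (h.unique F hF G' (Finset.mem_insert_of_mem hG') (R F) le_rfl
          (h.restrict_subset F hF) h2 h3 ▸ hG')
      have h2 : ∀ τ ⊆ F, ¬ R F ⊆ τ → ∃ G ∈ s, τ ⊆ G := by
        intro τ hτ hRτ
        obtain ⟨G', hG', h2, h3, -⟩ := h.exists_le F hF τ hτ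
        refine ⟨G', (Finset.mem_insert.mp hG').resolve_left ?_, h3⟩
        rintro rfl
        exact hRτ h2
      have hRne : (R F).Nonempty := by
        rw [Finset.nonempty_iff_ne_empty]
        intro h0
        obtain ⟨G, hG⟩ := hs
        exact h1 G hG (by simp [h0])
      obtain ⟨v, hvF, hvR⟩ := Finset.exists_of_ssubset
        ((h.restrict_subset F hF).ssubset_of_ne (hR F hF))
      obtain ⟨e⟩ := nonempty_homotopyEquiv_of_collapse hRne (h.restrict_subset F hF) hvF hvR h1 h2
      exact e.contractibleSpace

/-! Wedges of spheres as quotients of unions of simplices. -/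

section CollapseSimplex

variable {d : ℕ}

/-- The smallest coordinate. -/
noncomputable def minCoord (v : Fin (d + 1) → ℝ) : ℝ := Finset.univ.inf' Finset.univ_nonempty v

theorem minCoord_le (v : Fin (d + 1) → ℝ) (i : Fin (d + 1)) : minCoord v ≤ v i :=
  Finset.inf'_le v (Finset.mem_univ i)

theorem le_minCoord {v : Fin (d + 1) → ℝ} {c : ℝ} (h : ∀ i, c ≤ v i) : c ≤ minCoord v :=
  Finset.le_inf' _ _ fun i _ => h i

theorem exists_eq_minCoord (v : Fin (d + 1) → ℝ) : ∃ i, minCoord v = v i := by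
  obtain ⟨i, -, hi⟩ := Finset.exists_mem_eq_inf' Finset.univ_nonempty v
  exact ⟨i, hi⟩

theorem minCoord_eq_zero {v : Fin (d + 1) → ℝ} (hv : ∀ i, 0 ≤ v i) {i : Fin (d + 1)}
    (hi : v i = 0) : minCoord v = 0 :=
  le_antisymm ((minCoord_le v i).trans hi.le) (le_minCoord hv)

theorem continuous_minCoord : Continuous (minCoord : (Fin (d + 1) → ℝ) → ℝ) :=
  Continuous.finset_inf'_apply Finset.univ_nonempty fun i _ => continuous_apply i

/-- The squared length of the vector of differences to the coordinate `0`. -/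
noncomputable def sqDiff (v : Fin (d + 1) → ℝ) : ℝ := ∑ i, (v i - v 0) ^ 2

theorem continuous_sqDiff : Continuous (sqDiff : (Fin (d + 1) → ℝ) → ℝ) := by
  unfold sqDiff; fun_prop

theorem sqDiff_nonneg (v : Fin (d + 1) → ℝ) : 0 ≤ sqDiff v :=
  Finset.sum_nonneg fun _ _ => sq_nonneg _

/-- The map of the standard simplex to the sphere that collapses the boundary, given by inverse
stereographic projection of the point with coordinates `(v i - v 0) / minCoord v`. -/
noncomputable def collapseVec (v : Fin (d + 1) → ℝ) : EuclideanSpace ℝ (Fin (d + 1)) :=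
  WithLp.toLp 2 fun i => if i = 0 then
    (sqDiff v - minCoord v ^ 2) / (sqDiff v + minCoord v ^ 2) else
    2 * minCoord v * (v i - v 0) / (sqDiff v + minCoord v ^ 2)

/-- The denominator could vanish only if all coordinates were equal with minimum 0, which
contradicts the coordinate sum 1. -/
theorem denom_pos {v : Fin (d + 1) → ℝ} (hv : v ∈ stdSimplex ℝ (Fin (d + 1))) :
    0 < sqDiff v + minCoord v ^ 2 := by
  rcases (sqDiff_nonneg v).lt_or_eq with h | h
  · positivity
  · have h1 : ∀ i, v i = v 0 := by
      intro i
      have := (Finset.sum_eq_zero_iff_of_nonneg (fun i _ => sq_nonneg (v i - v 0))).mp h.symm i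
        (Finset.mem_univ i)
      exact sub_eq_zero.mp (pow_eq_zero_iff two_ne_zero |>.mp this)
    obtain ⟨i, hi⟩ := exists_eq_minCoord v
    rw [h1 i] at hi
    have h0 : v 0 ≠ 0 := by
      intro h0
      have := hv.2
      simp [h1, h0] at this
    rw [← h, hi]
    positivity

theorem continuousOn_collapseVec :
    ContinuousOn (collapseVec (d := d)) (stdSimplex ℝ (Fin (d + 1))) := by
  refine (PiLp.continuous_toLp 2 _).comp_continuousOn (continuousOn_pi.mpr fun i => ?_)
  have h1 := continuous_sqDiff (d := d)
  have h2 := continuous_minCoord (d := d)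
  split_ifs
  · exact ContinuousOn.div (by fun_prop) (by fun_prop) fun v hv => (denom_pos hv).ne'
  · exact ContinuousOn.div (by fun_prop) (by fun_prop) fun v hv => (denom_pos hv).ne'

theorem sum_sq_eq (x : Fin (d + 1) → ℝ) (c : ℝ) :
    ∑ i, (if i = 0 then c else x i) ^ 2 = c ^ 2 + (∑ i, x i ^ 2 - x 0 ^ 2) := by
  rw [Fin.sum_univ_succ, Fin.sum_univ_succ (fun i => x i ^ 2)]
  simp

theorem norm_collapseVec {v : Fin (d + 1) → ℝ} (hv : v ∈ stdSimplex ℝ (Fin (d + 1))) :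
    ‖collapseVec v‖ = 1 := by
  have hD := denom_pos hv
  rw [EuclideanSpace.norm_eq, Real.sqrt_eq_one]
  simp only [Real.norm_eq_abs, sq_abs, collapseVec]
  rw [sum_sq_eq (fun i => 2 * minCoord v * (v i - v 0) / (sqDiff v + minCoord v ^ 2))]
  have : ∑ i, (2 * minCoord v * (v i - v 0) / (sqDiff v + minCoord v ^ 2)) ^ 2
      = (2 * minCoord v / (sqDiff v + minCoord v ^ 2)) ^ 2 * sqDiff v := by
    rw [sqDiff, Finset.mul_sum]
    exact Finset.sum_congr rfl fun i _ => by ring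
  rw [this]
  field_simp
  ring

theorem collapseVec_of_minCoord_eq_zero {v : Fin (d + 1) → ℝ}
    (hv : v ∈ stdSimplex ℝ (Fin (d + 1))) (h : minCoord v = 0) :
    collapseVec v = EuclideanSpace.single 0 1 := by
  have hD := denom_pos hv
  rw [h] at hD
  ext i
  by_cases hi : i = 0
  · subst hi
    simp only [collapseVec, h, if_true, PiLp.single_apply]
    field_simp
    ring
  · simp [collapseVec, h, hi]

theorem collapseVec_ne {v : Fin (d + 1) → ℝ} (hv : v ∈ stdSimplex ℝ (Fin (d + 1)))
    (h : 0 < minCoord v) : collapseVec v ≠ EuclideanSpace.single 0 1 := by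
  have hD := denom_pos hv
  intro he
  have := congrArg (fun x : EuclideanSpace ℝ (Fin (d + 1)) => x 0) he
  simp only [collapseVec, if_true, PiLp.single_apply] at this
  rw [div_eq_one_iff_eq hD.ne'] at this
  nlinarith

/-- Stereographic projection recovers the ratios (v i - v 0) / minCoord v. The least of them
determines v 0 / minCoord v, and the coordinate sum 1 then determines the scale. -/
theorem collapseVec_injOn {v w : Fin (d + 1) → ℝ} (hv : v ∈ stdSimplex ℝ (Fin (d + 1)))
    (hw : w ∈ stdSimplex ℝ (Fin (d + 1))) (hv0 : 0 < minCoord v) (hw0 : 0 < minCoord w)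
    (h : collapseVec v = collapseVec w) : v = w := by
  have hDv := denom_pos hv
  have hDw := denom_pos hw
  set μ := minCoord v with hμ
  set ν := minCoord w with hν
  have hx : ∀ i, collapseVec v i = collapseVec w i := fun i => by rw [h]
  have h0 := hx 0
  simp only [collapseVec, if_true, ← hμ, ← hν] at h0
  rw [div_eq_div_iff hDv.ne' hDw.ne'] at h0
  have hQ : sqDiff v * ν ^ 2 = sqDiff w * μ ^ 2 := by linarith
  have hi : ∀ i, (v i - v 0) * ν = (w i - w 0) * μ := by
    intro i
    by_cases hi : i = 0
    · simp [hi]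
    have := hx i
    simp only [collapseVec, hi, if_false, ← hμ, ← hν] at this
    rw [div_eq_div_iff hDv.ne' hDw.ne'] at this
    have h3 : (v i - v 0) * ν * (2 * μ * (sqDiff w + ν ^ 2) * μ)
        = (w i - w 0) * μ * (2 * μ * (sqDiff w + ν ^ 2) * μ) := by
      linear_combination (μ * ν) * this + 2 * μ * (w i - w 0) * hQ
    exact mul_right_cancel₀ (by positivity) h3
  obtain ⟨a, ha⟩ := exists_eq_minCoord v
  obtain ⟨b, hb⟩ := exists_eq_minCoord w
  rw [← hμ] at ha
  rw [← hν] at hb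
  have hle1 : (v 0 - μ) * ν ≤ (w 0 - ν) * μ := by
    have := minCoord_le w a
    have h2 := hi a
    rw [← ha] at h2
    nlinarith
  have hle2 : (w 0 - ν) * μ ≤ (v 0 - μ) * ν := by
    have := minCoord_le v b
    have h2 := hi b
    rw [← hb] at h2
    nlinarith
  have hall : ∀ i, v i * ν = w i * μ := fun i => by linarith [hi i]
  have hs : ν = μ := by
    have : ∑ i, v i * ν = ∑ i, w i * μ := Finset.sum_congr rfl fun i _ => hall i
    rwa [← Finset.sum_mul, ← Finset.sum_mul, hv.2, hw.2, one_mul, one_mul] at this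
  ext i
  have := hall i
  rw [hs] at this
  exact mul_right_cancel₀ hv0.ne' this

theorem exists_collapseVec_eq {x : EuclideanSpace ℝ (Fin (d + 1))} (hx : ‖x‖ = 1)
    (hx1 : x ≠ EuclideanSpace.single 0 1) :
    ∃ v ∈ stdSimplex ℝ (Fin (d + 1)), 0 < minCoord v ∧ collapseVec v = x := by
  have hsum : ∑ i, x i ^ 2 = 1 := by
    rw [EuclideanSpace.norm_eq, Real.sqrt_eq_one] at hx
    simpa using hx
  have hlt : x 0 < 1 := by
    have hle : x 0 ^ 2 ≤ 1 := hsum ▸ Finset.single_le_sum (f := fun i => x i ^ 2)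
      (fun i _ => sq_nonneg (x i)) (Finset.mem_univ 0)
    refine lt_of_le_of_ne (by nlinarith) fun h => hx1 ?_
    rw [Fin.sum_univ_succ, h] at hsum
    have hz : ∑ i : Fin d, x i.succ ^ 2 = 0 := by linarith
    rw [Finset.sum_eq_zero_iff_of_nonneg fun i _ => sq_nonneg _] at hz
    ext i
    refine Fin.cases ?_ (fun j => ?_) i
    · simp [h]
    · have := pow_eq_zero_iff two_ne_zero |>.mp (hz j (Finset.mem_univ _))
      simp [this]
  -- y is the stereographic projection of x from the base point, with coordinate 0 filled by 0. The
  -- vector u has the same differences as y and least coordinate 1, so u / T is a point of the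
  -- simplex whose differences divided by its least coordinate give back y.
  set y : Fin (d + 1) → ℝ := fun i => if i = 0 then 0 else x i / (1 - x 0) with hy
  set u : Fin (d + 1) → ℝ := fun i => 1 - minCoord y + y i with hu
  have hu1 : ∀ i, 1 ≤ u i := fun i => by have := minCoord_le y i; simp only [hu]; linarith
  set T : ℝ := ∑ i, u i with hT
  have hTpos : 0 < T := Finset.sum_pos (fun i _ => by linarith [hu1 i]) Finset.univ_nonempty
  have hmin : minCoord (fun i => u i / T) = 1 / T := by
    refine le_antisymm ?_ (le_minCoord fun i => by gcongr; exact hu1 i)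
    obtain ⟨i, hi⟩ := exists_eq_minCoord y
    refine (minCoord_le _ i).trans_eq ?_
    simp [hu, hi]
  have hdiff : ∀ i, u i / T - u 0 / T = y i / T := fun i => by
    simp only [hu, hy, if_true]; ring
  have hysq : ∑ i, y i ^ 2 = (1 + x 0) / (1 - x 0) := by
    have h1 : 0 < 1 - x 0 := by linarith
    simp only [hy]
    rw [sum_sq_eq (fun i => x i / (1 - x 0)) 0]
    simp only [div_pow, ← Finset.sum_div, hsum]
    field_simp
    ring
  have hsq : sqDiff (fun i => u i / T) = (1 + x 0) / (1 - x 0) / T ^ 2 := by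
    rw [sqDiff, ← hysq, Finset.sum_div]
    exact Finset.sum_congr rfl fun i _ => by rw [hdiff, div_pow]
  refine ⟨fun i => u i / T, ⟨fun i => div_nonneg (by linarith [hu1 i]) hTpos.le, ?_⟩, ?_, ?_⟩
  · rw [← Finset.sum_div, div_self hTpos.ne']
  · rw [hmin]; positivity
  · have h1 : 0 < 1 - x 0 := by linarith
    have hD : (1 + x 0) / (1 - x 0) / T ^ 2 + (1 / T) ^ 2 = 2 / ((1 - x 0) * T ^ 2) := by
      field_simp
      ring
    ext i
    simp only [collapseVec, hmin, hsq, hdiff, hD]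
    by_cases hi : i = 0
    · subst hi
      simp only [if_true]
      field_simp
      ring
    · simp only [hi, if_false, hy]
      field_simp

/-- `collapseVec` as a map to the unit sphere. -/
noncomputable def collapseSphere (v : stdSimplex ℝ (Fin (d + 1))) : UnitSphere d :=
  ⟨collapseVec v.1, by simpa using norm_collapseVec v.2⟩

theorem continuous_collapseSphere : Continuous (collapseSphere (d := d)) :=
  Continuous.subtype_mk (continuousOn_iff_continuous_domRestrict.mp continuousOn_collapseVec) _

theorem collapseSphere_eq_base_iff (v : stdSimplex ℝ (Fin (d + 1))) :
    collapseSphere v = UnitSphere.base d ↔ minCoord v.1 = 0 := by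
  constructor
  · intro h
    by_contra h0
    exact collapseVec_ne v.2 (lt_of_le_of_ne (le_minCoord v.2.1) (Ne.symm h0))
      (congrArg Subtype.val h)
  · exact fun h => Subtype.ext (collapseVec_of_minCoord_eq_zero v.2 h)

theorem exists_collapseSphere_eq {x : UnitSphere d} (hx : x ≠ UnitSphere.base d) :
    ∃ v, collapseSphere v = x := by
  obtain ⟨v, hv, -, h⟩ := exists_collapseVec_eq (by simp) fun h => hx (Subtype.ext h)
  exact ⟨⟨v, hv⟩, Subtype.ext h⟩

theorem collapseSphere_inj {v w : stdSimplex ℝ (Fin (d + 1))} (hv : 0 < minCoord v.1)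
    (h : collapseSphere v = collapseSphere w) : v = w := by
  have hw : 0 < minCoord w.1 := by
    refine lt_of_le_of_ne (le_minCoord w.2.1) fun h0 => hv.ne' ?_
    rw [← collapseSphere_eq_base_iff, h, collapseSphere_eq_base_iff, h0]
  exact Subtype.ext (collapseVec_injOn v.2 w.2 hv hw (congrArg Subtype.val h))

end CollapseSimplex

/-- The retraction of a wedge onto one of its spheres, as vectors starting at the base point. -/
noncomputable def SphereWedge.coord (m d : ℕ) :
    SphereWedge m d → Fin m → EuclideanSpace ℝ (Fin (d + 1)) :=
  Quot.lift (Sum.elim (fun _ => 0) fun p =>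
    Pi.single p.1 ((p.2 : EuclideanSpace ℝ (Fin (d + 1))) - EuclideanSpace.single 0 1)) (by
      rintro _ _ ⟨i⟩
      simp [UnitSphere.base])

theorem SphereWedge.continuous_coord (m d : ℕ) : Continuous (SphereWedge.coord m d) := by
  refine continuous_quot_lift _ (Continuous.sumElim continuous_const ?_)
  rw [continuous_prod_of_discrete_left]
  intro i
  exact (continuous_single i).comp (by fun_prop)

/-- Two points with equal coordinates lie on the same sphere, or both have coordinate vector 0 and
are the common point. The resulting Hausdorff property of the wedge makes surjections from compact
spaces quotient maps. -/
theorem SphereWedge.coord_injective (m d : ℕ) : Function.Injective (SphereWedge.coord m d) := by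
  have key : ∀ (i : Fin m) (x : UnitSphere d) (z : Fin m → EuclideanSpace ℝ (Fin (d + 1))),
      z i = 0 → SphereWedge.coord m d (Quot.mk _ (Sum.inr (i, x))) = z →
      (Quot.mk _ (Sum.inr (i, x)) : SphereWedge m d) = Quot.mk _ (Sum.inl ()) := by
    intro i x z hz h
    have h1 := congrFun h i
    rw [hz] at h1
    simp only [SphereWedge.coord, Sum.elim_inr, Pi.single_eq_same] at h1
    have : x = UnitSphere.base d := Subtype.ext (sub_eq_zero.mp h1)
    rw [this]
    exact Quot.sound (WedgeRel.glue i)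
  rintro ⟨(⟨⟩ | ⟨i, x⟩)⟩ ⟨(⟨⟩ | ⟨j, y⟩)⟩ h
  · rfl
  · exact (key j y 0 rfl h.symm).symm
  · exact key i x 0 rfl h
  · by_cases hij : i = j
    · subst hij
      have h1 := congrFun h i
      simp only [SphereWedge.coord, Sum.elim_inr, Pi.single_eq_same, sub_left_inj] at h1
      rw [Subtype.ext h1]
    · rw [key i x _ _ h, key j y _ _ h.symm]
      · simp [SphereWedge.coord, Ne.symm hij]
      · simp [SphereWedge.coord, hij]

instance (m d : ℕ) : T2Space (SphereWedge m d) :=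
  T2Space.of_injective_continuous (SphereWedge.coord_injective m d)
    (SphereWedge.continuous_coord m d)

/-- Collapsing a closed subspace `A` is a homotopy equivalence if a contraction of `A` extends to
a homotopy of the whole space. -/
theorem nonempty_homotopyEquiv_of_contract {X W : Type*} [TopologicalSpace X] [TopologicalSpace W]
    [CompactSpace X] [T2Space W] (A : Set X) (π : C(X, W)) (hπ : Function.Surjective π)
    (hfib : ∀ x y, π x = π y → x = y ∨ (x ∈ A ∧ y ∈ A)) (hA : ∀ x ∈ A, ∀ y ∈ A, π x = π y)
    (G : C(unitInterval × X, X)) (hG0 : ∀ x, G (0, x) = x) (hGA : ∀ t, ∀ x ∈ A, G (t, x) ∈ A)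
    (hG1 : ∀ x ∈ A, ∀ y ∈ A, G (1, x) = G (1, y)) :
    Nonempty (ContinuousMap.HomotopyEquiv X W) := by
  have hq : Topology.IsQuotientMap π := .of_surjective_continuous hπ π.continuous
  -- The end of the homotopy is constant on A, so it factors through π; the factor f is the homotopy
  -- inverse.
  let g : C(X, X) := G.comp ⟨fun x => (1, x), by fun_prop⟩
  have hg : Function.FactorsThrough g π := by
    intro x y h
    rcases hfib x y h with rfl | ⟨hx, hy⟩
    · rfl
    · exact hG1 x hx y hy
  let f : C(W, X) := hq.lift g hg
  have hf : ∀ x, f (π x) = G (1, x) := fun x => by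
    have := congrArg (fun h : C(X, X) => h x) (hq.lift_comp g hg)
    exact this
  let P : C(unitInterval × X, unitInterval × W) :=
    ⟨fun p => (p.1, π p.2), by fun_prop⟩
  -- The product of π with the interval is again a continuous surjection from a compact to a
  -- Hausdorff space. Hence π ∘ G, for which A stays in A at all times, descends to a homotopy on W.
  have hP : Topology.IsQuotientMap P := by
    refine .of_surjective_continuous (fun ⟨t, w⟩ => ?_) P.continuous
    obtain ⟨x, rfl⟩ := hπ w
    exact ⟨(t, x), rfl⟩
  have hPf : Function.FactorsThrough (π.comp G) P := by
    rintro ⟨t, x⟩ ⟨t', y⟩ h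
    obtain ⟨rfl, h⟩ := Prod.mk.inj h
    rcases hfib x y h with rfl | ⟨hx, hy⟩
    · rfl
    · exact hA _ (hGA t x hx) _ (hGA t y hy)
  let K : C(unitInterval × W, W) := hP.lift (π.comp G) hPf
  have hK : ∀ t x, K (t, π x) = π (G (t, x)) := fun t x => by
    have := congrArg (fun h : C(unitInterval × X, W) => h (t, x)) (hP.lift_comp _ hPf)
    exact this
  refine ⟨⟨π, f, ContinuousMap.Homotopic.symm ⟨⟨G, hG0, fun x => (hf x).symm⟩⟩,
    ContinuousMap.Homotopic.symm ⟨⟨K, fun w => ?_, fun w => ?_⟩⟩⟩⟩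
  · obtain ⟨x, rfl⟩ := hπ w
    exact (hK 0 x).trans (by rw [hG0]; rfl)
  · obtain ⟨x, rfl⟩ := hπ w
    exact (hK 1 x).trans (by simp [hf])

/-! ### Attaching simplices along their boundaries and extending homotopies. -/

/-- `polyhedron 𝓕` is obtained from `polyhedron 𝓝` by attaching the simplices `F j` along their
whole boundaries; `o j` enumerates the vertices of `F j`. -/
structure CellAttachment {α : Type*} [Fintype α] {m d : ℕ} (𝓕 𝓝 : Finset (Finset α))
    (F : Fin m → Finset α) (o : ∀ j, Fin (d + 1) ≃ F j) : Prop where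
  subset : 𝓝 ⊆ 𝓕
  mem : ∀ j, F j ∈ 𝓕
  cases : ∀ w ∈ polyhedron 𝓕, w ∈ polyhedron 𝓝 ∨ ∃ j, ∀ i, 0 < w (o j i)
  support : ∀ w ∈ polyhedron 𝓕, ∀ j, (∀ i, 0 < w (o j i)) → ∀ a, a ∉ F j → w a = 0
  exists_zero : ∀ w ∈ polyhedron 𝓝, ∀ j, ∃ i, w (o j i) = 0
  boundary : ∀ w ∈ stdSimplex ℝ α, ∀ j, (∀ a, a ∉ F j → w a = 0) → (∃ i, w (o j i) = 0) →
    w ∈ polyhedron 𝓝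
  unique : ∀ w ∈ polyhedron 𝓕, ∀ j j', (∀ i, 0 < w (o j i)) → (∀ i, 0 < w (o j' i)) → j = j'

namespace CellAttachment

variable {α : Type*} {m d : ℕ} {F : Fin m → Finset α}

/-- The smallest barycentric coordinate with respect to the `j`-th cell. -/
noncomputable def cellMin (o : ∀ j, Fin (d + 1) ≃ F j) (j : Fin m) (w : α → ℝ) : ℝ :=
  minCoord fun i => w (o j i)

@[fun_prop]
theorem continuous_cellMin (o : ∀ j, Fin (d + 1) ≃ F j) (j : Fin m) :
    Continuous (cellMin o j) :=
  continuous_minCoord.comp (by fun_prop)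

theorem cellMin_le {o : ∀ j, Fin (d + 1) ≃ F j} {w : α → ℝ} (j : Fin m) {a : α} (ha : a ∈ F j) :
    cellMin o j w ≤ w a := by
  have := minCoord_le (fun i => w (o j i)) ((o j).symm ⟨a, ha⟩)
  simpa [cellMin] using this

theorem cellMin_pos_iff {o : ∀ j, Fin (d + 1) ≃ F j} {w : α → ℝ} {j : Fin m} :
    0 < cellMin o j w ↔ ∀ i, 0 < w (o j i) := by
  constructor
  · exact fun h i => h.trans_le (minCoord_le (fun i => w (o j i)) i)
  · intro h
    obtain ⟨i, hi⟩ := exists_eq_minCoord fun i => w (o j i)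
    rw [cellMin, hi]
    exact h i

/-- Expansion of the cells: the part of a cell at depth at least `θ` is rescaled to the whole cell,
the rest is projected to the boundary. -/
noncomputable def expand [DecidableEq α] (o : ∀ j, Fin (d + 1) ≃ F j) (θ : ℝ) (w : α → ℝ) :
    α → ℝ := fun a =>
  (w a - ∑ j, if a ∈ F j then min (cellMin o j w) θ else 0) /
    (1 - (d + 1) * ∑ j, min (cellMin o j w) θ)

variable [Fintype α] {𝓕 𝓝 : Finset (Finset α)} {o : ∀ j, Fin (d + 1) ≃ F j}

theorem cellMin_nonneg {w : α → ℝ} (hw : w ∈ stdSimplex ℝ α) (j : Fin m) : 0 ≤ cellMin o j w :=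
  le_minCoord fun _ => hw.1 _

theorem polyhedron_subset (h : CellAttachment 𝓕 𝓝 F o) :
    polyhedron 𝓝 ⊆ polyhedron 𝓕 := polyhedron_mono h.subset

theorem cellMin_eq_zero_of_mem (h : CellAttachment 𝓕 𝓝 F o) {w : α → ℝ} (hw : w ∈ polyhedron 𝓝)
    (j : Fin m) :
    cellMin o j w = 0 := by
  obtain ⟨i, hi⟩ := h.exists_zero w hw j
  exact minCoord_eq_zero (fun i => hw.1.1 _) hi

theorem cellMin_eq_zero_of_ne (h : CellAttachment 𝓕 𝓝 F o) {w : α → ℝ} (hw : w ∈ polyhedron 𝓕)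
    {j j' : Fin m}
    (hj : 0 < cellMin o j w) (hne : j' ≠ j) : cellMin o j' w = 0 := by
  by_contra h0
  have := lt_of_le_of_ne (cellMin_nonneg hw.1 j') (Ne.symm h0)
  exact hne (h.unique w hw j' j (cellMin_pos_iff.mp this) (cellMin_pos_iff.mp hj))

theorem mem_or_exists_pos (h : CellAttachment 𝓕 𝓝 F o) {w : α → ℝ} (hw : w ∈ polyhedron 𝓕) :
    w ∈ polyhedron 𝓝 ∨ ∃ j, 0 < cellMin o j w :=
  (h.cases w hw).imp_right fun ⟨j, hj⟩ => ⟨j, cellMin_pos_iff.mpr hj⟩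

theorem sum_cellMin (h : CellAttachment 𝓕 𝓝 F o) {w : α → ℝ} (hw : w ∈ polyhedron 𝓕) {j : Fin m}
    (hj : 0 < cellMin o j w) :
    ∑ j, cellMin o j w = cellMin o j w :=
  Finset.sum_eq_single j (fun j' _ hne => h.cellMin_eq_zero_of_ne hw hj hne) (by simp)

theorem sum_min (h : CellAttachment 𝓕 𝓝 F o) {w : α → ℝ} (hw : w ∈ polyhedron 𝓕) {j : Fin m}
    (hj : 0 < cellMin o j w) {θ : ℝ}
    (hθ : 0 ≤ θ) : ∑ j, min (cellMin o j w) θ = min (cellMin o j w) θ :=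
  Finset.sum_eq_single j (fun j' _ hne => by
    rw [h.cellMin_eq_zero_of_ne hw hj hne, min_eq_left hθ]) (by simp)

/-- At most one cell has positive depth at a given point, so the truncated depths sum to at most θ.
The bound on θ keeps the denominator of `expand` away from 0. -/
theorem denom_ge (h : CellAttachment 𝓕 𝓝 F o) {w : α → ℝ} (hw : w ∈ polyhedron 𝓕) {θ : ℝ}
    (hθ : 0 ≤ θ)
    (hθ' : (d + 1) * θ ≤ 1 / 2) : 1 / 2 ≤ 1 - (d + 1) * ∑ j, min (cellMin o j w) θ := by
  have hle : ∑ j, min (cellMin o j w) θ ≤ θ := by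
    rcases h.mem_or_exists_pos hw with hA | ⟨j, hj⟩
    · simpa [h.cellMin_eq_zero_of_mem hA, min_eq_left hθ] using hθ
    · rw [h.sum_min hw hj hθ]
      exact min_le_right _ _
  have : ((d : ℝ) + 1) * ∑ j, min (cellMin o j w) θ ≤ (d + 1) * θ := by gcongr
  linarith

variable [DecidableEq α]

theorem expand_of_mem (h : CellAttachment 𝓕 𝓝 F o) {w : α → ℝ} (hw : w ∈ polyhedron 𝓝) {θ : ℝ}
    (hθ : 0 ≤ θ) :
    expand o θ w = w := by
  ext a
  simp [expand, h.cellMin_eq_zero_of_mem hw, min_eq_left hθ]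

theorem expand_of_pos (h : CellAttachment 𝓕 𝓝 F o) {w : α → ℝ} (hw : w ∈ polyhedron 𝓕) {j : Fin m}
    (hj : 0 < cellMin o j w)
    {θ : ℝ} (hθ : 0 ≤ θ) (a : α) : expand o θ w a =
      (w a - if a ∈ F j then min (cellMin o j w) θ else 0) /
        (1 - (d + 1) * min (cellMin o j w) θ) := by
  rw [expand, h.sum_min hw hj hθ]
  congr 2
  refine Finset.sum_eq_single j (fun j' _ hne => ?_) (by simp)
  rw [h.cellMin_eq_zero_of_ne hw hj hne, min_eq_left hθ, ite_self]

theorem expand_zero {w : α → ℝ} (hw : w ∈ polyhedron 𝓕) : expand o 0 w = w := by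
  ext a
  have : ∀ j, min (cellMin o j w) 0 = 0 := fun j => min_eq_right (cellMin_nonneg hw.1 j)
  simp [expand, this]

/-- The same amount is subtracted at each of the d + 1 vertices of the cell, and the denominator is
the mass that remains. -/
theorem expand_mem_stdSimplex (h : CellAttachment 𝓕 𝓝 F o) {w : α → ℝ} (hw : w ∈ polyhedron 𝓕)
    {j : Fin m}
    (hj : 0 < cellMin o j w) {θ : ℝ} (hθ : 0 ≤ θ) (hθ' : (d + 1) * θ ≤ 1 / 2) :
    expand o θ w ∈ stdSimplex ℝ α ∧ ∀ a, a ∉ F j → expand o θ w a = 0 := by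
  have hden := h.denom_ge hw hθ hθ'
  rw [h.sum_min hw hj hθ] at hden
  have hsupp := h.support w hw j (cellMin_pos_iff.mp hj)
  refine ⟨⟨fun a => ?_, ?_⟩, fun a ha => ?_⟩
  · rw [h.expand_of_pos hw hj hθ]
    refine div_nonneg ?_ (by linarith)
    split_ifs with ha
    · exact sub_nonneg.mpr ((min_le_left _ _).trans (cellMin_le j ha))
    · simpa using hw.1.1 a
  · simp only [h.expand_of_pos hw hj hθ]
    rw [← Finset.sum_div, div_eq_one_iff_eq (by linarith), Finset.sum_sub_distrib, hw.1.2,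
      Finset.sum_ite_mem, Finset.univ_inter, Finset.sum_const, nsmul_eq_mul]
    have : (F j).card = d + 1 := by simpa using (Fintype.card_congr (o j)).symm
    rw [this]
    push_cast
    ring
  · rw [h.expand_of_pos hw hj hθ]
    simp [ha, hsupp a ha]

theorem expand_mem (h : CellAttachment 𝓕 𝓝 F o) {w : α → ℝ} (hw : w ∈ polyhedron 𝓕) {θ : ℝ}
    (hθ : 0 ≤ θ)
    (hθ' : (d + 1) * θ ≤ 1 / 2) : expand o θ w ∈ polyhedron 𝓕 := by
  rcases h.mem_or_exists_pos hw with hA | ⟨j, hj⟩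
  · rwa [h.expand_of_mem hA hθ]
  · obtain ⟨h1, h2⟩ := h.expand_mem_stdSimplex hw hj hθ hθ'
    exact ⟨h1, F j, h.mem j, h2⟩

/-- At depth at most θ the whole least coordinate is subtracted, so some coordinate of the cell
becomes 0 and the point lands on its boundary. -/
theorem expand_mem_of_le (h : CellAttachment 𝓕 𝓝 F o) {w : α → ℝ} (hw : w ∈ polyhedron 𝓕) {θ : ℝ}
    (hθ : 0 ≤ θ)
    (hθ' : (d + 1) * θ ≤ 1 / 2) (hle : ∑ j, cellMin o j w ≤ θ) :
    expand o θ w ∈ polyhedron 𝓝 := by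
  rcases h.mem_or_exists_pos hw with hA | ⟨j, hj⟩
  · rwa [h.expand_of_mem hA hθ]
  · obtain ⟨h1, h2⟩ := h.expand_mem_stdSimplex hw hj hθ hθ'
    refine h.boundary _ h1 j h2 ?_
    rw [h.sum_cellMin hw hj] at hle
    obtain ⟨i, hi⟩ := exists_eq_minCoord fun i => w (o j i)
    refine ⟨i, ?_⟩
    rw [h.expand_of_pos hw hj hθ, min_eq_left hle]
    simp [cellMin, hi]

theorem continuousOn_expand (h : CellAttachment 𝓕 𝓝 F o) :
    ContinuousOn (fun p : ℝ × (α → ℝ) => expand o (p.1 / (2 * (d + 1))) p.2)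
      (Set.Icc 0 1 ×ˢ polyhedron 𝓕) := by
  have hc := fun j => continuous_cellMin o j
  refine continuousOn_pi.mpr fun a => ContinuousOn.div ?_ ?_ ?_
  · refine Continuous.continuousOn (Continuous.sub (by fun_prop) (continuous_finsetSum _ fun j _ => ?_))
    split_ifs <;> fun_prop
  · fun_prop
  · rintro ⟨t, w⟩ ⟨ht, hw⟩
    have hd : (0 : ℝ) < d + 1 := by positivity
    have := h.denom_ge hw (θ := t / (2 * (d + 1))) (div_nonneg ht.1 (by positivity)) (by
      have := ht.2
      field_simp
      simpa using this)
    exact (by linarith : (0 : ℝ) < _).ne'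

/-- A contraction of the subcomplex extends to a homotopy of the whole complex. -/
theorem exists_homotopy (h : CellAttachment 𝓕 𝓝 F o) [ContractibleSpace (polyhedron 𝓝)] :
    ∃ G : C(unitInterval × polyhedron 𝓕, polyhedron 𝓕), (∀ w, G (0, w) = w) ∧
      (∀ t w, w.1 ∈ polyhedron 𝓝 → (G (t, w)).1 ∈ polyhedron 𝓝) ∧
      ∀ w w', w.1 ∈ polyhedron 𝓝 → w'.1 ∈ polyhedron 𝓝 → G (1, w) = G (1, w') := by
  classical
  obtain ⟨p, ⟨H⟩⟩ := id_nullhomotopic (polyhedron 𝓝)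
  -- The contraction of the subcomplex as a function on the ambient space, with 0 as a dummy value
  -- elsewhere.
  let c : ℝ × (α → ℝ) → (α → ℝ) := fun q =>
    if hq : q.1 ∈ Set.Icc (0 : ℝ) 1 ∧ q.2 ∈ polyhedron 𝓝 then H (⟨q.1, hq.1⟩, ⟨q.2, hq.2⟩) else 0
  have hc_eq : ∀ (t : unitInterval) (w : polyhedron 𝓝), c (t, w) = H (t, w) := fun t w => by
    have : (t : ℝ) ∈ Set.Icc (0 : ℝ) 1 ∧ (w : α → ℝ) ∈ polyhedron 𝓝 := ⟨t.2, w.2⟩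
    simp only [c]
    rw [dif_pos this]
  have hc0 : ∀ w ∈ polyhedron 𝓝, c (0, w) = w := fun w hw => by
    have := hc_eq 0 ⟨w, hw⟩
    simpa using this
  have hc1 : ∀ w ∈ polyhedron 𝓝, c (1, w) = p := fun w hw => by
    have := hc_eq 1 ⟨w, hw⟩
    simpa using this
  have hcm : ∀ t ∈ Set.Icc (0 : ℝ) 1, ∀ w ∈ polyhedron 𝓝, c (t, w) ∈ polyhedron 𝓝 :=
    fun t ht w hw => by
      have := hc_eq ⟨t, ht⟩ ⟨w, hw⟩
      simp only at this
      rw [this]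
      exact (H _).2
  have hcc : ContinuousOn c (Set.Icc 0 1 ×ˢ polyhedron 𝓝) := by
    rw [continuousOn_iff_continuous_domRestrict]
    have : (Set.Icc (0 : ℝ) 1 ×ˢ polyhedron 𝓝).domRestrict c = fun q =>
        ((H (⟨q.1.1, q.2.1⟩, ⟨q.1.2, q.2.2⟩) : polyhedron 𝓝) : α → ℝ) := by
      ext1 q
      exact hc_eq ⟨q.1.1, q.2.1⟩ ⟨q.1.2, q.2.2⟩
    rw [this]
    fun_prop
  have hd : (0 : ℝ) < d + 1 := by positivity
  have hcm' : Continuous fun w : α → ℝ => ∑ j, cellMin o j w :=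
    continuous_finsetSum _ fun j _ => continuous_cellMin o j
  -- At time t the part of a cell at depth at least θ = t / (2 (d + 1)) is stretched over the cell.
  -- Shallower points are projected to the boundary and follow the contraction there for the time
  -- elapsed since θ passed their depth, namely t - 2 (d + 1) * depth. On the subcomplex the depth
  -- is 0 and g is the contraction itself.
  set g : ℝ × (α → ℝ) → (α → ℝ) := fun q =>
    if q.1 / (2 * (d + 1)) ≤ ∑ j, cellMin o j q.2 then expand o (q.1 / (2 * (d + 1))) q.2
    else c (q.1 - 2 * (d + 1) * ∑ j, cellMin o j q.2, expand o (q.1 / (2 * (d + 1))) q.2) with hg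
  have hθ : ∀ t ∈ Set.Icc (0 : ℝ) 1, 0 ≤ t / (2 * (d + 1)) ∧
      ((d : ℝ) + 1) * (t / (2 * (d + 1))) ≤ 1 / 2 := fun t ht => by
    refine ⟨div_nonneg ht.1 (by positivity), ?_⟩
    have := ht.2
    field_simp
    simpa using this
  have hsum0 : ∀ w ∈ polyhedron 𝓕, 0 ≤ ∑ j, cellMin o j w := fun w hw =>
    Finset.sum_nonneg fun j _ => cellMin_nonneg hw.1 j
  have hpar : ∀ t ∈ Set.Icc (0 : ℝ) 1, ∀ w ∈ polyhedron 𝓕,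
      ∑ j, cellMin o j w ≤ t / (2 * (d + 1)) →
      t - 2 * (d + 1) * ∑ j, cellMin o j w ∈ Set.Icc (0 : ℝ) 1 := fun t ht w hw hle => by
    rw [le_div_iff₀ (by positivity)] at hle
    have h1 := hsum0 w hw
    constructor
    · linarith
    · have := ht.2
      have : 0 ≤ 2 * ((d : ℝ) + 1) * ∑ j, cellMin o j w := by positivity
      linarith
  have hgm : ∀ t ∈ Set.Icc (0 : ℝ) 1, ∀ w ∈ polyhedron 𝓕, g (t, w) ∈ polyhedron 𝓕 := by
    intro t ht w hw
    simp only [hg]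
    split_ifs with hle
    · exact h.expand_mem hw (hθ t ht).1 (hθ t ht).2
    · exact h.polyhedron_subset (hcm _ (hpar t ht w hw (not_le.mp hle).le) _
        (h.expand_mem_of_le hw (hθ t ht).1 (hθ t ht).2 (not_le.mp hle).le))
  have hgc : ContinuousOn g (Set.Icc 0 1 ×ˢ polyhedron 𝓕) := by
    have hE := h.continuousOn_expand
    have hC : IsClosed (Set.Icc (0 : ℝ) 1 ×ˢ polyhedron 𝓕) :=
      isClosed_Icc.prod (isCompact_polyhedron 𝓕).isClosed
    have hu : Set.Icc (0 : ℝ) 1 ×ˢ polyhedron 𝓕 =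
        (Set.Icc (0 : ℝ) 1 ×ˢ polyhedron 𝓕 ∩
          {q | q.1 / (2 * (d + 1)) ≤ ∑ j, cellMin o j q.2}) ∪
        (Set.Icc (0 : ℝ) 1 ×ˢ polyhedron 𝓕 ∩
          {q | ∑ j, cellMin o j q.2 ≤ q.1 / (2 * (d + 1))}) := by
      rw [← Set.inter_union_distrib_left, eq_comm, Set.inter_eq_left]
      exact fun q _ => (le_total _ _ : q.1 / (2 * ((d : ℝ) + 1)) ≤ ∑ j, cellMin o j q.2 ∨ _)
    rw [hu]
    refine ContinuousOn.union_of_isClosed ?_ ?_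
      (hC.inter (isClosed_le (by fun_prop) (by fun_prop)))
      (hC.inter (isClosed_le (by fun_prop) (by fun_prop)))
    · refine (hE.mono Set.inter_subset_left).congr fun q hq => ?_
      simp only [hg]
      rw [if_pos (by simpa using hq.2)]
    · have : ContinuousOn (fun q : ℝ × (α → ℝ) => c (q.1 - 2 * (d + 1) * ∑ j, cellMin o j q.2,
          expand o (q.1 / (2 * (d + 1))) q.2)) (Set.Icc (0 : ℝ) 1 ×ˢ polyhedron 𝓕 ∩
          {q | ∑ j, cellMin o j q.2 ≤ q.1 / (2 * (d + 1))}) := by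
        refine hcc.comp (ContinuousOn.prodMk (by fun_prop) (hE.mono Set.inter_subset_left)) ?_
        rintro ⟨t, w⟩ ⟨⟨ht, hw⟩, hle⟩
        exact ⟨hpar t ht w hw hle, h.expand_mem_of_le hw (hθ t ht).1 (hθ t ht).2 hle⟩
      refine this.congr ?_
      rintro ⟨t, w⟩ ⟨⟨ht, hw⟩, hle⟩
      simp only [hg]
      split_ifs with hle'
      -- On the overlap of the two closed regions the depth equals θ, so the contraction is
      -- evaluated at time 0 and the two formulas agree.
      · have heq : t - 2 * (d + 1) * ∑ j, cellMin o j w = 0 := by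
          rw [le_antisymm hle hle']
          field_simp
          ring
        rw [heq, hc0 _ (h.expand_mem_of_le hw (hθ t ht).1 (hθ t ht).2 hle)]
      · rfl
  have hgA : ∀ t ∈ Set.Icc (0 : ℝ) 1, ∀ w ∈ polyhedron 𝓝,
      g (t, w) = if t = 0 then w else c (t, w) := by
    intro t ht w hw
    have h0 : ∑ j, cellMin o j w = 0 :=
      Finset.sum_eq_zero fun j _ => h.cellMin_eq_zero_of_mem hw j
    have h1 : t / (2 * ((d : ℝ) + 1)) ≤ 0 ↔ t = 0 := by
      constructor
      · intro hle
        refine le_antisymm ?_ ht.1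
        by_contra hlt
        have : 0 < t / (2 * ((d : ℝ) + 1)) := div_pos (not_le.mp hlt) (by positivity)
        linarith
      · rintro rfl
        simp
    simp only [hg, h0, h1, h.expand_of_mem hw (hθ t ht).1, mul_zero, sub_zero]
  refine ⟨⟨fun q => ⟨g (q.1, q.2), hgm _ q.1.2 _ q.2.2⟩, Continuous.subtype_mk ?_ _⟩,
    fun w => Subtype.ext ?_, fun t w hw => ?_, fun w w' hw hw' => Subtype.ext ?_⟩
  · exact hgc.comp_continuous (by fun_prop : Continuous fun q : unitInterval × polyhedron 𝓕 =>
      ((q.1 : ℝ), (q.2 : α → ℝ))) fun q => ⟨q.1.2, q.2.2⟩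
  · change g (0, w) = w
    have := hsum0 w w.2
    simp only [hg]
    rw [if_pos (by simpa using this), zero_div, expand_zero w.2]
  · change g (t, w) ∈ polyhedron 𝓝
    rw [hgA t t.2 w hw]
    split_ifs
    · exact hw
    · exact hcm t t.2 w hw
  · change g (1, w) = g (1, w')
    rw [hgA 1 (by simp) w hw, hgA 1 (by simp) w' hw']
    simp [hc1 _ hw, hc1 _ hw']

end CellAttachment

/-- The common point of the spheres of a wedge. -/
def SphereWedge.base (m d : ℕ) : SphereWedge m d := Quot.mk _ (Sum.inl ())

/-- The inclusion of the `j`-th sphere into the wedge. -/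
def SphereWedge.incl {m d : ℕ} (j : Fin m) (u : UnitSphere d) : SphereWedge m d :=
  Quot.mk _ (Sum.inr (j, u))

theorem SphereWedge.continuous_incl {m d : ℕ} (j : Fin m) :
    Continuous (SphereWedge.incl (d := d) j) :=
  continuous_quot_mk.comp (continuous_inr.comp (Continuous.prodMk_right j))

theorem SphereWedge.coord_incl {m d : ℕ} (j : Fin m) (u : UnitSphere d) :
    SphereWedge.coord m d (SphereWedge.incl j u) =
      Pi.single j ((u : EuclideanSpace ℝ (Fin (d + 1))) - EuclideanSpace.single 0 1) := rfl

theorem SphereWedge.coord_base (m d : ℕ) : SphereWedge.coord m d (SphereWedge.base m d) = 0 := rfl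

theorem SphereWedge.incl_eq_base_iff {m d : ℕ} {j : Fin m} {u : UnitSphere d} :
    SphereWedge.incl j u = SphereWedge.base m d ↔
      u = UnitSphere.base d := by
  constructor
  · intro h
    have := congrFun (congrArg (SphereWedge.coord m d) h) j
    simp only [SphereWedge.coord_incl, SphereWedge.coord_base, Pi.zero_apply, Pi.single_eq_same] at this
    exact Subtype.ext (sub_eq_zero.mp this)
  · rintro rfl
    exact Quot.sound (WedgeRel.glue j)

theorem SphereWedge.incl_inj {m d : ℕ} {j j' : Fin m} {u u' : UnitSphere d}
    (hu : u ≠ UnitSphere.base d)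
    (h : SphereWedge.incl j u = SphereWedge.incl j' u') :
    j = j' ∧ u = u' := by
  have h1 := congrFun (congrArg (SphereWedge.coord m d) h) j
  simp only [SphereWedge.coord_incl, Pi.single_eq_same] at h1
  by_cases hj : j = j'
  · subst hj
    simp only [Pi.single_eq_same, sub_left_inj] at h1
    exact ⟨rfl, Subtype.ext h1⟩
  · rw [Pi.single_eq_of_ne hj] at h1
    exact absurd (Subtype.ext (sub_eq_zero.mp h1)) hu

namespace CellAttachment

variable {α : Type*} [Fintype α] {m d : ℕ} {F : Fin m → Finset α} {𝓕 𝓝 : Finset (Finset α)}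
  {o : ∀ j, Fin (d + 1) ≃ F j}

theorem cellCoord_mem (o : ∀ j, Fin (d + 1) ≃ F j) {w : α → ℝ} (hw : w ∈ stdSimplex ℝ α)
    {j : Fin m} (hj : ∀ a, a ∉ F j → w a = 0) :
    (fun i => w (o j i)) ∈ stdSimplex ℝ (Fin (d + 1)) := by
  refine ⟨fun i => hw.1 _, ?_⟩
  rw [(o j).sum_comp fun a : F j => w a, Finset.sum_coe_sort (F j) w, ← hw.2]
  exact Finset.sum_subset (Finset.subset_univ _) fun a _ ha => hj a ha

open Classical in
/-- The map to the wedge that collapses the subcomplex and the boundaries of the cells. -/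
noncomputable def toWedge (h : CellAttachment 𝓕 𝓝 F o) (w : polyhedron 𝓕) : SphereWedge m d :=
  if hw : ∃ j, ∀ i, 0 < w.1 (o j i) then
    SphereWedge.incl hw.choose (collapseSphere ⟨fun i => w.1 (o hw.choose i),
      cellCoord_mem o w.2.1 (h.support w.1 w.2 _ hw.choose_spec)⟩)
  else SphereWedge.base m d

theorem toWedge_of_mem (h : CellAttachment 𝓕 𝓝 F o) {w : polyhedron 𝓕}
    (hw : w.1 ∈ polyhedron 𝓝) : h.toWedge w = SphereWedge.base m d := by
  rw [toWedge, dif_neg]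
  rintro ⟨j, hj⟩
  obtain ⟨i, hi⟩ := h.exists_zero _ hw j
  exact (hj i).ne' hi

/-- The formula for an open cell stays valid on its boundary, where both sides are the common point.
Continuity can then be checked on the finite closed cover by the subcomplex and the closed cells. -/
theorem toWedge_of_support (h : CellAttachment 𝓕 𝓝 F o) {w : polyhedron 𝓕} {j : Fin m}
    (hj : ∀ a, a ∉ F j → w.1 a = 0) : h.toWedge w =
      SphereWedge.incl j (collapseSphere ⟨_, cellCoord_mem o w.2.1 hj⟩) := by
  by_cases hpos : ∀ i, 0 < w.1 (o j i)
  · have hw : ∃ j, ∀ i, 0 < w.1 (o j i) := ⟨j, hpos⟩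
    obtain rfl := h.unique w.1 w.2 _ _ hpos hw.choose_spec
    rw [toWedge, dif_pos hw]
  · push Not at hpos
    obtain ⟨i, hi⟩ := hpos
    have hi : w.1 (o j i) = 0 := le_antisymm hi (w.2.1.1 _)
    rw [h.toWedge_of_mem (h.boundary _ w.2.1 j hj ⟨i, hi⟩), eq_comm,
      SphereWedge.incl_eq_base_iff, collapseSphere_eq_base_iff]
    exact minCoord_eq_zero (fun i => w.2.1.1 _) hi

theorem mem_or_exists_support (h : CellAttachment 𝓕 𝓝 F o) (w : polyhedron 𝓕) :
    w.1 ∈ polyhedron 𝓝 ∨ ∃ j, (∀ i, 0 < w.1 (o j i)) ∧ ∀ a, a ∉ F j → w.1 a = 0 :=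
  (h.cases w.1 w.2).imp_right fun ⟨j, hj⟩ => ⟨j, hj, h.support w.1 w.2 j hj⟩

theorem continuous_toWedge (h : CellAttachment 𝓕 𝓝 F o) : Continuous h.toWedge := by
  let C : Option (Fin m) → Set (polyhedron 𝓕) := fun x => match x with
    | none => {w | w.1 ∈ polyhedron 𝓝}
    | some j => {w | ∀ a, a ∉ F j → w.1 a = 0}
  refine (locallyFinite_of_finite C).continuous ?_ ?_ ?_
  · refine Set.eq_univ_of_forall fun w => Set.mem_iUnion.mpr ?_
    rcases h.mem_or_exists_support w with hw | ⟨j, -, hj⟩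
    · exact ⟨none, hw⟩
    · exact ⟨some j, hj⟩
  · rintro (_ | j)
    · exact (isCompact_polyhedron 𝓝).isClosed.preimage continuous_subtype_val
    · have : C (some j) = ⋂ a ∈ {a | a ∉ F j}, {w : polyhedron 𝓕 | w.1 a = 0} := by
        ext w; simp [C]
      rw [this]
      exact isClosed_biInter fun a _ => isClosed_eq
        ((continuous_apply a).comp continuous_subtype_val) continuous_const
  · rintro (_ | j)
    · exact continuousOn_const.congr fun w hw => h.toWedge_of_mem hw
    · rw [continuousOn_iff_continuous_domRestrict]
      have : (C (some j)).domRestrict h.toWedge = fun w => SphereWedge.incl j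
          (collapseSphere ⟨_, cellCoord_mem o w.1.2.1 w.2⟩) :=
        funext fun w => h.toWedge_of_support w.2
      rw [this]
      have hs := continuous_collapseSphere (d := d)
      refine (SphereWedge.continuous_incl j).comp (hs.comp (Continuous.subtype_mk ?_ _))
      exact continuous_pi fun i => (continuous_apply _).comp
        (continuous_subtype_val.comp continuous_subtype_val)

theorem toWedge_surjective (h : CellAttachment 𝓕 𝓝 F o) (hne : (polyhedron 𝓝).Nonempty) :
    Function.Surjective h.toWedge := by
  classical
  obtain ⟨w₀, hw₀⟩ := hne
  have hbase : ∃ w, h.toWedge w = SphereWedge.base m d :=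
    ⟨⟨w₀, h.polyhedron_subset hw₀⟩, h.toWedge_of_mem hw₀⟩
  rintro ⟨(⟨⟩ | ⟨j, x⟩)⟩
  · exact hbase
  · change ∃ w, h.toWedge w = SphereWedge.incl j x
    by_cases hx : x = UnitSphere.base d
    · obtain ⟨w, hw⟩ := hbase
      exact ⟨w, hw.trans (SphereWedge.incl_eq_base_iff.mpr hx).symm⟩
    · obtain ⟨v, rfl⟩ := exists_collapseSphere_eq hx
      let w : α → ℝ := fun a => if ha : a ∈ F j then v.1 ((o j).symm ⟨a, ha⟩) else 0
      have hw0 : ∀ a, a ∉ F j → w a = 0 := fun a ha => dif_neg ha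
      have hwo : ∀ i, w (o j i) = v.1 i := fun i => by
        simp only [w]
        rw [dif_pos (o j i).2]
        simp
      have hw : w ∈ stdSimplex ℝ α := by
        constructor
        · intro a
          simp only [w]
          split_ifs
          · exact v.2.1 _
          · exact le_rfl
        · rw [← Finset.sum_subset (Finset.subset_univ (F j)) fun a _ ha => hw0 a ha,
            ← Finset.sum_coe_sort (F j) w, ← (o j).sum_comp fun a : F j => w a]
          simp only [hwo]
          exact v.2.2
      refine ⟨⟨w, hw, F j, h.mem j, hw0⟩, ?_⟩
      rw [h.toWedge_of_support (j := j) hw0]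
      congr 2
      exact Subtype.ext (funext hwo)

theorem eq_or_mem_of_toWedge_eq (h : CellAttachment 𝓕 𝓝 F o) {x y : polyhedron 𝓕}
    (hxy : h.toWedge x = h.toWedge y) :
    x = y ∨ (x.1 ∈ polyhedron 𝓝 ∧ y.1 ∈ polyhedron 𝓝) := by
  have hpos : ∀ {w : polyhedron 𝓕} {j : Fin m} (_ : ∀ i, 0 < w.1 (o j i))
      (hj : ∀ a, a ∉ F j → w.1 a = 0),
      collapseSphere ⟨_, cellCoord_mem o w.2.1 hj⟩ ≠ UnitSphere.base d := by
    intro w j hw hj he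
    rw [collapseSphere_eq_base_iff] at he
    exact (cellMin_pos_iff.mpr hw).ne' he
  rcases h.mem_or_exists_support x with hx | ⟨j, hj, hxj⟩ <;>
    rcases h.mem_or_exists_support y with hy | ⟨j', hj', hyj⟩
  · exact Or.inr ⟨hx, hy⟩
  · rw [h.toWedge_of_mem hx, h.toWedge_of_support hyj, eq_comm,
      SphereWedge.incl_eq_base_iff] at hxy
    exact absurd hxy (hpos hj' hyj)
  · rw [h.toWedge_of_mem hy, h.toWedge_of_support hxj,
      SphereWedge.incl_eq_base_iff] at hxy
    exact absurd hxy (hpos hj hxj)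
  · left
    rw [h.toWedge_of_support hxj, h.toWedge_of_support hyj] at hxy
    obtain ⟨rfl, he⟩ := SphereWedge.incl_inj (hpos hj hxj) hxy
    have he := congrArg Subtype.val (collapseSphere_inj
      (v := ⟨_, cellCoord_mem o x.2.1 hxj⟩) (cellMin_pos_iff.mpr hj) he)
    refine Subtype.ext (funext fun a => ?_)
    by_cases ha : a ∈ F j
    · have := congrFun he ((o j).symm ⟨a, ha⟩)
      simpa using this
    · rw [hxj a ha, hyj a ha]

theorem nonempty_homotopyEquiv (h : CellAttachment 𝓕 𝓝 F o)
    [ContractibleSpace (polyhedron 𝓝)] :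
    Nonempty (ContinuousMap.HomotopyEquiv (polyhedron 𝓕) (SphereWedge m d)) := by
  classical
  have := isCompact_iff_compactSpace.mp (isCompact_polyhedron 𝓕)
  obtain ⟨G, h0, h1, h2⟩ := h.exists_homotopy
  obtain ⟨w⟩ : Nonempty (polyhedron 𝓝) := inferInstance
  refine nonempty_homotopyEquiv_of_contract {w | w.1 ∈ polyhedron 𝓝} ⟨_, h.continuous_toWedge⟩
    (h.toWedge_surjective ⟨w, w.2⟩) (fun x y => h.eq_or_mem_of_toWedge_eq) (fun x hx y hy => ?_)
    G h0 (fun t x hx => h1 t x hx) (fun x hx y hy => h2 x y hx hy)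
  exact (h.toWedge_of_mem hx).trans (h.toWedge_of_mem hy).symm

end CellAttachment

/-- A shellable complex is homotopy equivalent to a wedge of spheres, one for each facet whose
restriction is the whole facet. -/
theorem Shelling.nonempty_homotopyEquiv {α : Type*} [Fintype α] [DecidableEq α]
    {𝓕 : Finset (Finset α)} {R : Finset α → Finset α} {ρ : Finset α → ℕ} {d : ℕ}
    (h : Shelling 𝓕 R ρ) (hcard : ∀ F ∈ 𝓕, F.card = d + 1) (hne : 𝓕.Nonempty) :
    Nonempty (ContinuousMap.HomotopyEquiv (polyhedron 𝓕)
      (SphereWedge (𝓕.filter fun F => R F = F).card d)) := by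
  set 𝓝 := 𝓕.filter fun F => R F ≠ F with h𝓝
  have hsub : 𝓝 ⊆ 𝓕 := Finset.filter_subset _ _
  -- If the interval containing τ belongs to a facet G with R G = G, then τ = G, and equal
  -- cardinalities give τ = F. So the only faces not covered by 𝓝 are the facets equal to their
  -- restrictions.
  have hcover : ∀ F ∈ 𝓕, ∀ τ ⊆ F, (τ = F ∧ R F = F) ∨ ∃ G ∈ 𝓝, R G ⊆ τ ∧ τ ⊆ G ∧
      (G = F ∨ ρ G < ρ F) := by
    intro F hF τ hτ
    obtain ⟨G, hG, h1, h2, h3⟩ := h.exists_le F hF τ hτ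
    by_cases hRG : R G = G
    · rw [hRG] at h1
      obtain rfl : τ = G := h2.antisymm h1
      have : τ = F := Finset.eq_of_subset_of_card_le hτ (by rw [hcard _ hF, hcard _ hG])
      subst this
      exact Or.inl ⟨rfl, hRG⟩
    · exact Or.inr ⟨G, Finset.mem_filter.mpr ⟨hG, hRG⟩, h1, h2, h3⟩
  have hmax : ∀ F ∈ 𝓕, R F = F → ∀ G ∈ 𝓕, F ⊆ G → F = G := fun F hF _ G hG hFG =>
    Finset.eq_of_subset_of_card_le hFG (by rw [hcard _ hF, hcard _ hG])
  have hS : Shelling 𝓝 R ρ := by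
    refine ⟨fun F hF => h.restrict_subset F (hsub hF), fun F hF G hG => h.unique F (hsub hF) G
      (hsub hG), fun F hF τ hτ => ?_⟩
    rcases hcover F (hsub hF) τ hτ with ⟨-, h2⟩ | h2
    · exact absurd h2 (Finset.mem_filter.mp hF).2
    · exact h2
  -- The empty face is not a facet since facets have d + 1 vertices, so it is covered by 𝓝.
  have hNne : 𝓝.Nonempty := by
    obtain ⟨F, hF⟩ := hne
    rcases hcover F hF ∅ (Finset.empty_subset _) with ⟨h1, -⟩ | ⟨G, hG, -⟩
    · have := hcard F hF
      rw [← h1] at this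
      simp at this
    · exact ⟨G, hG⟩
  have := hS.contractibleSpace hNne fun F hF => (Finset.mem_filter.mp hF).2
  set 𝓗 := 𝓕.filter fun F => R F = F with h𝓗
  let F : Fin 𝓗.card → Finset α := fun j => 𝓗.equivFin.symm j
  have hFH : ∀ j, F j ∈ 𝓕 ∧ R (F j) = F j := fun j =>
    (Finset.mem_filter (p := fun F => R F = F)).mp (𝓗.equivFin.symm j).2
  have hFinj : Function.Injective F := Subtype.val_injective.comp 𝓗.equivFin.symm.injective
  let o : ∀ j, Fin (d + 1) ≃ F j := fun j =>
    ((F j).equivFinOfCardEq (hcard _ (hFH j).1)).symm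
  have hpos : ∀ (w : α → ℝ) (j : Fin 𝓗.card) (G : Finset α), (∀ a, a ∉ G → w a = 0) →
      (∀ i, 0 < w (o j i)) → F j ⊆ G := by
    intro w j G hG hw a ha
    by_contra haG
    have := hw ((o j).symm ⟨a, ha⟩)
    rw [Equiv.apply_symm_apply, hG a haG] at this
    exact lt_irrefl _ this
  have hcell : CellAttachment 𝓕 𝓝 F o := by
    refine ⟨hsub, fun j => (hFH j).1, ?_, ?_, ?_, ?_, ?_⟩
    · rintro w ⟨hw, G, hG, hwG⟩
      by_cases hz : ∃ a ∈ G, w a = 0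
      · obtain ⟨a, ha, hwa⟩ := hz
        rcases hcover G hG (G.erase a) (Finset.erase_subset _ _) with ⟨h1, -⟩ | ⟨G', hG', -, h1, -⟩
        · exact absurd h1 (Finset.erase_ne_self.mpr ha)
        · refine Or.inl ⟨hw, G', hG', fun b hb => ?_⟩
          by_cases hba : b = a
          · rwa [hba]
          · exact hwG b fun h => hb (h1 (Finset.mem_erase.mpr ⟨hba, h⟩))
      · push Not at hz
        rcases hcover G hG G le_rfl with ⟨-, hRG⟩ | ⟨G', hG', -, h1, -⟩
        · right
          refine ⟨𝓗.equivFin ⟨G, Finset.mem_filter.mpr ⟨hG, hRG⟩⟩, fun i => ?_⟩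
          have hFG : F (𝓗.equivFin ⟨G, Finset.mem_filter.mpr ⟨hG, hRG⟩⟩) ⊆ G := by simp [F]
          exact lt_of_le_of_ne (hw.1 _) (Ne.symm (hz _ (hFG (o _ i).2)))
        · exact Or.inl ⟨hw, G', hG', fun b hb => hwG b fun h => hb (h1 h)⟩
    · rintro w ⟨hw, G, hG, hwG⟩ j hj a ha
      rw [hmax _ (hFH j).1 (hFH j).2 G hG (hpos w j G hwG hj)] at ha
      exact hwG a ha
    · rintro w ⟨hw, G, hG, hwG⟩ j
      by_contra hz
      push Not at hz
      have := hmax _ (hFH j).1 (hFH j).2 G (hsub hG) (hpos w j G hwG fun i =>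
        lt_of_le_of_ne (hw.1 _) (Ne.symm (hz i)))
      exact (Finset.mem_filter.mp hG).2 (this ▸ (hFH j).2)
    · rintro w hw j hj ⟨i, hi⟩
      rcases hcover (F j) (hFH j).1 ((F j).erase (o j i)) (Finset.erase_subset _ _) with
        ⟨h1, -⟩ | ⟨G', hG', -, h1, -⟩
      · exact absurd h1 (Finset.erase_ne_self.mpr (o j i).2)
      · refine ⟨hw, G', hG', fun b hb => ?_⟩
        by_cases hba : b = o j i
        · rwa [hba]
        · exact hj b fun h => hb (h1 (Finset.mem_erase.mpr ⟨hba, h⟩))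
    · rintro w ⟨hw, G, hG, hwG⟩ j j' hj hj'
      exact hFinj ((hmax _ (hFH j).1 (hFH j).2 G hG (hpos w j G hwG hj)).trans
        (hmax _ (hFH j').1 (hFH j').2 G hG (hpos w j' G hwG hj')).symm)
  exact hcell.nonempty_homotopyEquiv

/-! Alexander–Spanier cohomology modulo two. Cochains of all degrees are treated at once, as
functions on finite lists of points; the empty list accounts for the augmentation. -/

open Filter Topology

/-! ### Coboundary, pullback and prism operators on functions of lists. -/

section Coboundary

variable {E E' : Type*}

/-- The coboundary, modulo two: the sum over all ways to omit an entry of the list. -/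
def coboundaryFun : (List E → ZMod 2) → List E → ZMod 2
  | _, [] => 0
  | f, a :: l => f l + coboundaryFun (fun l' => f (a :: l')) l

theorem coboundaryFun_add (f g : List E → ZMod 2) (l : List E) :
    coboundaryFun (f + g) l = coboundaryFun f l + coboundaryFun g l := by
  induction l generalizing f g with
  | nil => simp [coboundaryFun]
  | cons a l ih =>
    have := ih (fun l' => f (a :: l')) (fun l' => g (a :: l'))
    simp only [coboundaryFun, Pi.add_apply]
    rw [show (fun l' => f (a :: l') + g (a :: l')) =
      (fun l' => f (a :: l')) + fun l' => g (a :: l') from rfl, this]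
    ring

/-- The coboundary as a homomorphism. -/
def coboundary : (List E → ZMod 2) →+ (List E → ZMod 2) :=
  AddMonoidHom.mk' coboundaryFun fun f g => funext (coboundaryFun_add f g)

@[simp]
theorem coboundary_nil (f : List E → ZMod 2) : coboundary f [] = 0 := rfl

theorem coboundary_cons (f : List E → ZMod 2) (a : E) (l : List E) :
    coboundary f (a :: l) = f l + coboundary (fun l' => f (a :: l')) l := rfl

theorem coboundary_cons_eq (f : List E → ZMod 2) (a : E) :
    (fun l => coboundary f (a :: l)) = f + coboundary fun l' => f (a :: l') := rfl

theorem coboundary_coboundary (f : List E → ZMod 2) : coboundary (coboundary f) = 0 := by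
  ext l
  induction l generalizing f with
  | nil => rfl
  | cons a l ih =>
    rw [coboundary_cons, coboundary_cons_eq, map_add, Pi.add_apply, ih, Pi.zero_apply, add_zero,
      Pi.zero_apply, CharTwo.add_self_eq_zero]

theorem coboundary_eq_zero_of_forall {f : List E → ZMod 2} {P : E → Prop}
    (hf : ∀ l, (∀ y ∈ l, P y) → f l = 0) (l : List E) (hl : ∀ y ∈ l, P y) :
    coboundary f l = 0 := by
  induction l generalizing f with
  | nil => rfl
  | cons a l ih =>
    rw [List.forall_mem_cons] at hl
    rw [coboundary_cons, hf l hl.2, zero_add]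
    exact ih (fun l' hl' => hf _ (List.forall_mem_cons.mpr ⟨hl.1, hl'⟩)) hl.2

/-- Pullback of cochains. -/
def pullback (φ : E → E') : (List E' → ZMod 2) →+ (List E → ZMod 2) :=
  AddMonoidHom.mk' (fun f l => f (l.map φ)) fun _ _ => rfl

theorem pullback_apply (φ : E → E') (f : List E' → ZMod 2) (l : List E) :
    pullback φ f l = f (l.map φ) := rfl

theorem coboundary_pullback (φ : E → E') (f : List E' → ZMod 2) :
    coboundary (pullback φ f) = pullback φ (coboundary f) := by
  ext l
  induction l generalizing f with
  | nil => rfl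
  | cons a l ih =>
    change pullback φ f l + coboundary (pullback φ fun l' => f (φ a :: l')) l =
      f (l.map φ) + coboundary (fun l' => f (φ a :: l')) (l.map φ)
    rw [ih]
    rfl

/-- The prism operator between two maps. -/
def prism (φ ψ : E → E') : (List E' → ZMod 2) → List E → ZMod 2
  | _, [] => 0
  | f, a :: l => f (φ a :: ψ a :: l.map ψ) + prism φ ψ (fun l' => f (φ a :: l')) l

theorem prism_add (φ ψ : E → E') (f g : List E' → ZMod 2) :
    prism φ ψ (f + g) = prism φ ψ f + prism φ ψ g := by
  ext l
  induction l generalizing f g with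
  | nil => simp [prism]
  | cons a l ih =>
    have := ih (fun l' => f (φ a :: l')) (fun l' => g (φ a :: l'))
    simp only [prism, Pi.add_apply] at this ⊢
    rw [show (fun l' => f (φ a :: l') + g (φ a :: l')) =
      (fun l' => f (φ a :: l')) + fun l' => g (φ a :: l') from rfl, this]
    ring

/-- Splitting off the first entry reduces this to a shorter list, and the additional terms occur in
pairs, which cancel modulo two. The prism operator is thus a cochain homotopy between the two
pullbacks. -/
theorem coboundary_prism (φ ψ : E → E') (f : List E' → ZMod 2) :
    coboundary (prism φ ψ f) + prism φ ψ (coboundary f) = pullback φ f + pullback ψ f := by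
  ext l
  induction l generalizing f with
  | nil => simp [prism, pullback_apply, CharTwo.add_self_eq_zero]
  | cons a l ih =>
    have h1 := ih fun l' => f (φ a :: l')
    have h2 : (fun l' => prism φ ψ f (a :: l')) =
        pullback ψ (fun l' => f (φ a :: ψ a :: l')) + prism φ ψ fun l' => f (φ a :: l') := rfl
    simp only [Pi.add_apply, pullback_apply] at h1
    simp only [Pi.add_apply, pullback_apply, List.map_cons]
    rw [coboundary_cons, h2, map_add, coboundary_pullback, prism, coboundary_cons_eq, prism_add,
      coboundary_cons, coboundary_cons]
    simp only [Pi.add_apply, pullback_apply]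
    have h3 : ∀ x : ZMod 2, x + x = 0 := CharTwo.add_self_eq_zero
    linear_combination h1 + h3 (prism φ ψ f l) + h3 (coboundary (fun l' => f (φ a :: ψ a :: l'))
      (l.map ψ)) + h3 (f (φ a :: l.map ψ))

theorem prism_eq_zero_of_forall {φ ψ : E → E'} {f : List E' → ZMod 2} {P : E' → Prop}
    (hf : ∀ l, (∀ y ∈ l, P y) → f l = 0) (l : List E) (hφ : ∀ y ∈ l, P (φ y))
    (hψ : ∀ y ∈ l, P (ψ y)) : prism φ ψ f l = 0 := by
  induction l generalizing f with
  | nil => rfl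
  | cons a l ih =>
    rw [List.forall_mem_cons] at hφ hψ
    rw [prism, ih (fun l' hl' => hf _ (List.forall_mem_cons.mpr ⟨hφ.1, hl'⟩)) hφ.2 hψ.2, add_zero]
    refine hf _ ?_
    simp only [List.forall_mem_cons, List.forall_mem_map]
    exact ⟨hφ.1, hψ.1, hψ.2⟩

/-- Omitting any of the n + 1 equal entries leaves the same list. -/
theorem coboundary_replicate (f : List E → ZMod 2) (x : E) (n : ℕ) :
    coboundary f (List.replicate (n + 1) x) = (n + 1) * f (List.replicate n x) := by
  induction n generalizing f with
  | zero => simp [coboundary_cons]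
  | succ n ih =>
    rw [List.replicate_succ, coboundary_cons, ih, ← List.replicate_succ]
    push_cast
    ring

end Coboundary

/-! ### Homotopy invariance and Mayer–Vietoris. -/

section Cohomology

variable {E E' : Type*} [TopologicalSpace E] [TopologicalSpace E']

/-- Cochains on `A` that vanish near the diagonal. -/
def locZero (A : Set E) : AddSubgroup (List E → ZMod 2) where
  carrier := {f | ∀ x ∈ A, ∃ U ∈ 𝓝[A] x, ∀ l : List E, (∀ y ∈ l, y ∈ U) → f l = 0}
  zero_mem' := fun _ _ => ⟨_, univ_mem, fun _ _ => rfl⟩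
  add_mem' := by
    intro f g hf hg x hx
    obtain ⟨U, hU, hfU⟩ := hf x hx
    obtain ⟨V, hV, hgV⟩ := hg x hx
    refine ⟨U ∩ V, inter_mem hU hV, fun l hl => ?_⟩
    rw [Pi.add_apply, hfU l fun y hy => (hl y hy).1, hgV l fun y hy => (hl y hy).2, add_zero]
  neg_mem' := by
    intro f hf x hx
    obtain ⟨U, hU, hfU⟩ := hf x hx
    exact ⟨U, hU, fun l hl => by rw [Pi.neg_apply, hfU l hl, neg_zero]⟩

theorem locZero_anti {A B : Set E} (h : A ⊆ B) : locZero B ≤ locZero A := fun f hf x hx => by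
  obtain ⟨U, hU, hfU⟩ := hf x (h hx)
  exact ⟨U, nhdsWithin_mono x h hU, hfU⟩

theorem coboundary_mem_locZero {A : Set E} {f : List E → ZMod 2} (hf : f ∈ locZero A) :
    coboundary f ∈ locZero A := fun x hx => by
  obtain ⟨U, hU, hfU⟩ := hf x hx
  exact ⟨U, hU, coboundary_eq_zero_of_forall hfU⟩

theorem pullback_mem_locZero {A : Set E} {A' : Set E'} {φ : E → E'} (hφ : ContinuousOn φ A)
    (hm : Set.MapsTo φ A A') {f : List E' → ZMod 2} (hf : f ∈ locZero A') :
    pullback φ f ∈ locZero A := fun x hx => by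
  obtain ⟨U, hU, hfU⟩ := hf (φ x) (hm hx)
  refine ⟨φ ⁻¹' U, (hφ x hx).tendsto_nhdsWithin hm hU, fun l hl => hfU _ ?_⟩
  simpa using hl

/-- Cochains whose coboundary vanishes near the diagonal. -/
def cocycles (A : Set E) : AddSubgroup (List E → ZMod 2) := (locZero A).comap coboundary

/-- Cochains that are coboundaries near the diagonal. -/
def coboundaries (A : Set E) : AddSubgroup (List E → ZMod 2) :=
  locZero A ⊔ coboundary.range

theorem mem_cocycles {A : Set E} {f : List E → ZMod 2} :
    f ∈ cocycles A ↔ coboundary f ∈ locZero A := Iff.rfl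

theorem mem_coboundaries {A : Set E} {f : List E → ZMod 2} :
    f ∈ coboundaries A ↔ ∃ g, f - coboundary g ∈ locZero A := by
  constructor
  · intro h
    obtain ⟨u, hu, _, ⟨g, rfl⟩, rfl⟩ := AddSubgroup.mem_sup.mp h
    exact ⟨g, by simpa using hu⟩
  · rintro ⟨g, hg⟩
    rw [← sub_add_cancel f (coboundary g)]
    exact add_mem (AddSubgroup.mem_sup_left hg) (AddSubgroup.mem_sup_right ⟨g, rfl⟩)

theorem cocycles_anti {A B : Set E} (h : A ⊆ B) : cocycles B ≤ cocycles A :=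
  fun _ hf => locZero_anti h hf

/-- The order of the total reduced cohomology group of `A`. -/
noncomputable def cohomologyCard (A : Set E) : ℕ :=
  Nat.card (cocycles A ⧸ (coboundaries A).addSubgroupOf (cocycles A))

/-- The hypotheses say that f induces a bijection of the subquotients. Compatibility with
coboundaries is not demanded, so the criterion also serves for connecting homomorphisms. -/
theorem card_quotient_eq {M M' : Type*} [AddCommGroup M] [AddCommGroup M'] {Z B : AddSubgroup M}
    {Z' B' : AddSubgroup M'} (f : M →+ M') (hZ : ∀ x ∈ Z, f x ∈ Z')
    (hinj : ∀ x ∈ Z, f x ∈ B' ↔ x ∈ B) (hsurj : ∀ y ∈ Z', ∃ x ∈ Z, f x - y ∈ B') :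
    Nat.card (Z ⧸ B.addSubgroupOf Z) = Nat.card (Z' ⧸ B'.addSubgroupOf Z') := by
  let g : Z →+ Z' ⧸ B'.addSubgroupOf Z' := (QuotientAddGroup.mk' _).comp
    ((f.comp Z.subtype).codRestrict Z' fun x => hZ x x.2)
  have hg : Function.Surjective g := by
    intro q
    obtain ⟨⟨y, hy⟩, rfl⟩ := QuotientAddGroup.mk'_surjective _ q
    obtain ⟨x, hx, hxy⟩ := hsurj y hy
    refine ⟨⟨x, hx⟩, ?_⟩
    refine (QuotientAddGroup.mk'_eq_mk' _).mpr ⟨⟨y - f x, sub_mem hy (hZ x hx)⟩, ?_, ?_⟩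
    · rw [AddSubgroup.mem_addSubgroupOf, ← neg_mem_iff]
      simpa using hxy
    · exact Subtype.ext (add_sub_cancel (f x) y)
  have hk : g.ker = B.addSubgroupOf Z := by
    ext x
    rw [AddMonoidHom.mem_ker, AddSubgroup.mem_addSubgroupOf, ← hinj x x.2]
    exact (QuotientAddGroup.eq_zero_iff _).trans AddSubgroup.mem_addSubgroupOf
  rw [← hk]
  exact Nat.card_congr (QuotientAddGroup.quotientKerEquivOfSurjective g hg).toEquiv

/-- Two maps that are close with respect to a cocycle have cohomologous pullbacks. -/
theorem pullback_add_pullback_mem {D : Type*} {A : Set E} {φ ψ : E → D} {f : List D → ZMod 2}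
    (h : ∀ x ∈ A, ∃ U ∈ 𝓝[A] x, ∃ V : Set D, (∀ l : List D, (∀ y ∈ l, y ∈ V) →
      coboundary f l = 0) ∧ Set.MapsTo φ U V ∧ Set.MapsTo ψ U V) :
    pullback φ f + pullback ψ f ∈ coboundaries A := by
  refine mem_coboundaries.mpr ⟨prism φ ψ f, fun x hx => ?_⟩
  obtain ⟨U, hU, V, hV, hφ, hψ⟩ := h x hx
  refine ⟨U, hU, fun l hl => ?_⟩
  rw [← coboundary_prism, add_sub_cancel_left]
  exact prism_eq_zero_of_forall hV l (fun y hy => hφ (hl y hy)) fun y hy => hψ (hl y hy)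

/-- Homotopic maps have cohomologous pullbacks. -/
theorem pullback_sub_pullback_mem {A : Set E} (hA : IsCompact A) {A' : Set E'}
    {H : unitInterval × E → E'} (hc : ContinuousOn H (Set.univ ×ˢ A))
    (hm : ∀ t, ∀ x ∈ A, H (t, x) ∈ A') {f : List E' → ZMod 2} (hf : f ∈ cocycles A')
    (s t : unitInterval) :
    pullback (fun x => H (s, x)) f - pullback (fun x => H (t, x)) f ∈ coboundaries A := by
  have hneg : ∀ g : List E → ZMod 2, -g = g := fun g => funext fun l => CharTwo.neg_eq _
  -- The class of the pullback is locally constant in t: for t near t₀ the two maps send a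
  -- neighbourhood of each point of A into a common set on which the coboundary of f vanishes, and
  -- the prism operator applies. Compactness of A supplies one neighbourhood of t₀ for all points.
  have key : ∀ t₀ : unitInterval, ∀ᶠ t in 𝓝 t₀,
      pullback (fun x => H (t₀, x)) f - pullback (fun x => H (t, x)) f ∈ coboundaries A := by
    intro t₀
    suffices hs : ∃ J ∈ 𝓝 t₀, ∀ t ∈ J, ∀ x ∈ A, ∃ U ∈ 𝓝[A] x, ∃ V : Set E',
        (∀ l : List E', (∀ y ∈ l, y ∈ V) → coboundary f l = 0) ∧
        Set.MapsTo (fun x => H (t₀, x)) U V ∧ Set.MapsTo (fun x => H (t, x)) U V by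
      obtain ⟨J, hJ, h⟩ := hs
      filter_upwards [hJ] with t ht
      rw [sub_eq_add_neg, hneg]
      exact pullback_add_pullback_mem (h t ht)
    refine hA.induction_on (p := fun S => ∃ J ∈ 𝓝 t₀, ∀ t ∈ J, ∀ x ∈ S, ∃ U ∈ 𝓝[A] x, ∃ V : Set E',
        (∀ l : List E', (∀ y ∈ l, y ∈ V) → coboundary f l = 0) ∧
        Set.MapsTo (fun x => H (t₀, x)) U V ∧ Set.MapsTo (fun x => H (t, x)) U V)
      ⟨_, univ_mem, by simp⟩ ?_ ?_ ?_
    · rintro S T hST ⟨J, hJ, h⟩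
      exact ⟨J, hJ, fun t ht x hx => h t ht x (hST hx)⟩
    · rintro S T ⟨J, hJ, h⟩ ⟨J', hJ', h'⟩
      exact ⟨J ∩ J', inter_mem hJ hJ', fun t ht x hx => hx.elim (h t ht.1 x) (h' t ht.2 x)⟩
    · intro x hx
      obtain ⟨V, hV, hfV⟩ := hf _ (hm t₀ x hx)
      have h1 : H ⁻¹' V ∈ 𝓝[Set.univ ×ˢ A] (t₀, x) :=
        (hc (t₀, x) ⟨trivial, hx⟩).tendsto_nhdsWithin (fun p hp => hm p.1 p.2 hp.2) hV
      rw [nhdsWithin_prod_eq, nhdsWithin_univ, mem_prod_iff] at h1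
      obtain ⟨J, hJ, U, hU, hJU⟩ := h1
      refine ⟨_, eventually_eventually_nhdsWithin.mpr hU, J, hJ, fun t ht y hy => ⟨U, hy, V, hfV,
        fun z hz => hJU ⟨mem_of_mem_nhds hJ, hz⟩, fun z hz => hJU ⟨ht, hz⟩⟩⟩
  have hopen : ∀ P : Set unitInterval, (∀ a b, pullback (fun x => H (a, x)) f -
      pullback (fun x => H (b, x)) f ∈ coboundaries A → a ∈ P → b ∈ P) → IsOpen P := by
    intro P hP
    rw [isOpen_iff_mem_nhds]
    intro a ha
    filter_upwards [key a] with b hb using hP a b hb ha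
  -- A locally constant class on the connected unit interval is constant.
  have hclopen : IsClopen {t | pullback (fun x => H (s, x)) f -
      pullback (fun x => H (t, x)) f ∈ coboundaries A} := by
    constructor
    · rw [← isOpen_compl_iff]
      refine hopen _ fun a b hab ha hb => ha ?_
      have h1 : pullback (fun x => H (s, x)) f - pullback (fun x => H (b, x)) f ∈
        coboundaries A := hb
      have := sub_mem h1 hab
      have h2 : pullback (fun x => H (s, x)) f - pullback (fun x => H (a, x)) f ∈
        coboundaries A := by
        rw [← sub_add_sub_cancel _ (pullback (fun x => H (b, x)) f)]
        refine add_mem h1 ?_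
        rw [← neg_mem_iff, neg_sub]
        exact hab
      exact h2
    · refine hopen _ fun a b hab ha => ?_
      have h1 : pullback (fun x => H (s, x)) f - pullback (fun x => H (a, x)) f ∈
        coboundaries A := ha
      have h2 := add_mem h1 hab
      rwa [sub_add_sub_cancel] at h2
  have huniv := hclopen.eq_univ ⟨s, by
    change pullback (fun x => H (s, x)) f - pullback (fun x => H (s, x)) f ∈ coboundaries A
    rw [sub_self]; exact zero_mem _⟩
  exact Set.eq_univ_iff_forall.mp huniv t

theorem pullback_mem_cocycles {A : Set E} {A' : Set E'} {φ : E → E'} (hφ : ContinuousOn φ A)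
    (hm : Set.MapsTo φ A A') {f : List E' → ZMod 2} (hf : f ∈ cocycles A') :
    pullback φ f ∈ cocycles A := by
  rw [mem_cocycles, coboundary_pullback]
  exact pullback_mem_locZero hφ hm hf

theorem pullback_mem_coboundaries {A : Set E} {A' : Set E'} {φ : E → E'} (hφ : ContinuousOn φ A)
    (hm : Set.MapsTo φ A A') {f : List E' → ZMod 2} (hf : f ∈ coboundaries A') :
    pullback φ f ∈ coboundaries A := by
  obtain ⟨g, hg⟩ := mem_coboundaries.mp hf
  refine mem_coboundaries.mpr ⟨pullback φ g, ?_⟩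
  rw [coboundary_pullback, ← map_sub]
  exact pullback_mem_locZero hφ hm hg

theorem pullback_sub_mem_of_eqOn {D : Type*} {A : Set E} {φ ψ : E → D} (h : ∀ x ∈ A, φ x = ψ x)
    (f : List D → ZMod 2) : pullback φ f - pullback ψ f ∈ coboundaries A := by
  refine AddSubgroup.mem_sup_left fun x _ => ⟨A, self_mem_nhdsWithin, fun l hl => ?_⟩
  rw [Pi.sub_apply, pullback_apply, pullback_apply, List.map_congr_left fun y hy =>
    h y (hl y hy), sub_self]

/-- The total cohomology of compact sets is a homotopy invariant. -/
theorem cohomologyCard_eq_of_homotopy {A : Set E} {A' : Set E'} (hA : IsCompact A)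
    (hA' : IsCompact A') {φ : E → E'} {ψ : E' → E} (hφ : ContinuousOn φ A)
    (hψ : ContinuousOn ψ A') (hφm : Set.MapsTo φ A A') (hψm : Set.MapsTo ψ A' A)
    {H : unitInterval × E → E} (hH : ContinuousOn H (Set.univ ×ˢ A))
    (hHm : ∀ t, ∀ x ∈ A, H (t, x) ∈ A) (hH0 : ∀ x ∈ A, H (0, x) = ψ (φ x))
    (hH1 : ∀ x ∈ A, H (1, x) = x)
    {K : unitInterval × E' → E'} (hK : ContinuousOn K (Set.univ ×ˢ A'))
    (hKm : ∀ t, ∀ x ∈ A', K (t, x) ∈ A') (hK0 : ∀ x ∈ A', K (0, x) = φ (ψ x))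
    (hK1 : ∀ x ∈ A', K (1, x) = x) : cohomologyCard A = cohomologyCard A' := by
  have hid : ∀ f ∈ cocycles A, pullback φ (pullback ψ f) - f ∈ coboundaries A := by
    intro f hf
    have h1 := pullback_sub_pullback_mem hA hH hHm hf 0 1
    have h2 := pullback_sub_mem_of_eqOn (φ := fun x => ψ (φ x)) (fun x hx => (hH0 x hx).symm) f
    have h3 := pullback_sub_mem_of_eqOn (ψ := id) hH1 f
    have h4 := add_mem (add_mem h2 h1) h3
    rw [sub_add_sub_cancel, sub_add_sub_cancel] at h4
    convert h4 using 2
    · ext l; simp [pullback_apply, Function.comp_def]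
    · ext l; simp [pullback_apply]
  have hid' : ∀ f ∈ cocycles A', pullback ψ (pullback φ f) - f ∈ coboundaries A' := by
    intro f hf
    have h1 := pullback_sub_pullback_mem hA' hK hKm hf 0 1
    have h2 := pullback_sub_mem_of_eqOn (φ := fun x => φ (ψ x)) (fun x hx => (hK0 x hx).symm) f
    have h3 := pullback_sub_mem_of_eqOn (ψ := id) hK1 f
    have h4 := add_mem (add_mem h2 h1) h3
    rw [sub_add_sub_cancel, sub_add_sub_cancel] at h4
    convert h4 using 2
    · ext l; simp [pullback_apply, Function.comp_def]
    · ext l; simp [pullback_apply]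
  refine card_quotient_eq (pullback ψ) (fun f hf => pullback_mem_cocycles hψ hψm hf)
    (fun f hf => ⟨fun h => ?_, fun h => pullback_mem_coboundaries hψ hψm h⟩)
    fun f hf => ⟨pullback φ f, pullback_mem_cocycles hφ hφm hf, hid' f hf⟩
  have := sub_mem (pullback_mem_coboundaries hφ hφm h) (hid f hf)
  rwa [sub_sub_cancel] at this

/-- A compact set that can be contracted has no cohomology. -/
theorem cocycles_le_coboundaries_of_contraction {A : Set E} (hA : IsCompact A) (p : E)
    {H : unitInterval × E → E} (hH : ContinuousOn H (Set.univ ×ˢ A))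
    (hHm : ∀ t, ∀ x ∈ A, H (t, x) ∈ A) (hH0 : ∀ x ∈ A, H (0, x) = x)
    (hH1 : ∀ x ∈ A, H (1, x) = p) : cocycles A ≤ coboundaries A := by
  intro f hf
  rcases A.eq_empty_or_nonempty with rfl | ⟨x₀, hx₀⟩
  · exact AddSubgroup.mem_sup_left fun x hx => hx.elim
  have h1 := pullback_sub_pullback_mem hA hH hHm hf 0 1
  have hp : p ∈ A := hH1 x₀ hx₀ ▸ hHm 1 x₀ hx₀
  have h2 : pullback (fun x => H (0, x)) f - f ∈ coboundaries A := by
    refine AddSubgroup.mem_sup_left fun x _ => ⟨A, self_mem_nhdsWithin, fun l hl => ?_⟩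
    rw [Pi.sub_apply, pullback_apply, List.map_congr_left fun y hy => hH0 y (hl y hy)]
    simp
  -- The cone with apex p gives the primitive: the coboundary of f at p :: l is f l plus the
  -- coboundary of l' ↦ f (p :: l') at l, and it vanishes on the constant lists that occur here.
  have h3 : pullback (fun x => H (1, x)) f ∈ coboundaries A := by
    refine mem_coboundaries.mpr ⟨pullback (fun _ => p) fun l => f (p :: l), fun x _ =>
      ⟨A, self_mem_nhdsWithin, fun l hl => ?_⟩⟩
    obtain ⟨U, hU, hfU⟩ := hf p hp
    have h4 : coboundary f (p :: l.map fun _ => p) = 0 := by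
      refine hfU _ ?_
      have := mem_of_mem_nhdsWithin hp hU
      simp [this]
    rw [coboundary_pullback, Pi.sub_apply, pullback_apply, pullback_apply,
      List.map_congr_left fun y hy => hH1 y (hl y hy)]
    rw [coboundary_cons] at h4
    rw [sub_eq_add_neg, CharTwo.neg_eq, h4]
  have := sub_mem (add_mem h1 h3) h2
  simpa using this

open Classical in
/-- The cochain that agrees with `p` on lists starting in `χ` and with `q` on the others. -/
noncomputable def glue (χ : Set E) (p q : List E → ZMod 2) : List E → ZMod 2
  | [] => p []
  | a :: l => if a ∈ χ then p (a :: l) else q (a :: l)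

/-- `A` and `B` form an excisive pair: `A` is a neighbourhood of its points in the closure of `χ`
and `B` is a neighbourhood of the other points, except where both are neighbourhoods. -/
structure Excisive (A B χ : Set E) : Prop where
  nonempty : (A ∩ B).Nonempty
  nhds : ∀ x ∈ A ∪ B, A ∩ B ∈ 𝓝[A ∪ B] x ∨ (A ∈ 𝓝[A ∪ B] x ∧ χ ∈ 𝓝[A ∪ B] x) ∨
    (B ∈ 𝓝[A ∪ B] x ∧ χᶜ ∈ 𝓝[A ∪ B] x)

namespace Excisive

variable {A B χ : Set E}

/-- Vanishing near the diagonal is a local condition, and every point of the union has A or B as a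
neighbourhood. -/
theorem mem_locZero_union (h : Excisive A B χ) {f : List E → ZMod 2} (hfA : f ∈ locZero A)
    (hfB : f ∈ locZero B) : f ∈ locZero (A ∪ B) := by
  have key : ∀ {C : Set E}, f ∈ locZero C → ∀ x ∈ A ∪ B, C ∈ 𝓝[A ∪ B] x →
      ∃ U ∈ 𝓝[A ∪ B] x, ∀ l : List E, (∀ y ∈ l, y ∈ U) → f l = 0 := by
    intro C hf x hx hC
    obtain ⟨U, hU, hfU⟩ := hf x (mem_of_mem_nhdsWithin hx hC)
    exact ⟨U, nhdsWithin_le_of_mem hC hU, hfU⟩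
  intro x hx
  rcases h.nhds x hx with h1 | ⟨h1, -⟩ | ⟨h1, -⟩
  · exact key hfA x hx (mem_of_superset h1 Set.inter_subset_left)
  · exact key hfA x hx h1
  · exact key hfB x hx h1

/-- A common point is needed to compare values on the empty list; this is the nonemptiness condition
of reduced Mayer–Vietoris. -/
theorem nil_eq (h : Excisive A B χ) {p q : List E → ZMod 2} (hpq : p - q ∈ locZero (A ∩ B)) :
    p [] = q [] := by
  obtain ⟨x, hx⟩ := h.nonempty
  obtain ⟨U, -, hU⟩ := hpq x hx
  exact sub_eq_zero.mp (hU [] (by simp))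

/-- Near a point of A either all entries lie in χ, where the glued cochain is p, or B is a
neighbourhood within A and p and q agree locally. -/
theorem glue_sub_left (h : Excisive A B χ) {p q : List E → ZMod 2}
    (hpq : p - q ∈ locZero (A ∩ B)) : glue χ p q - p ∈ locZero A := by
  intro x hx
  have hle : 𝓝[A] x ≤ 𝓝[A ∪ B] x := nhdsWithin_mono x Set.subset_union_left
  have key : B ∈ 𝓝[A] x → x ∈ B → ∃ U ∈ 𝓝[A] x, ∀ l : List E, (∀ y ∈ l, y ∈ U) →
      (glue χ p q - p) l = 0 := by
    intro hB hxB
    obtain ⟨U, hU, hpqU⟩ := hpq x ⟨hx, hxB⟩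
    refine ⟨U, nhdsWithin_le_of_mem (inter_mem self_mem_nhdsWithin hB) hU, fun l hl => ?_⟩
    have h2 := sub_eq_zero.mp (hpqU l hl)
    cases l with
    | nil => simp [glue]
    | cons a l =>
      simp only [Pi.sub_apply, glue]
      split_ifs
      · simp
      · rw [h2, sub_self]
  rcases h.nhds x (Or.inl hx) with h1 | ⟨-, h1⟩ | ⟨h1, -⟩
  · exact key (mem_of_superset (hle h1) Set.inter_subset_right)
      (mem_of_mem_nhdsWithin (Set.mem_union_left B hx) h1).2
  · refine ⟨χ, hle h1, fun l hl => ?_⟩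
    cases l with
    | nil => simp [glue]
    | cons a l => simp [glue, hl a (by simp)]
  · exact key (hle h1) (mem_of_mem_nhdsWithin (Set.mem_union_left B hx) h1)

theorem glue_sub_right (h : Excisive A B χ) {p q : List E → ZMod 2}
    (hpq : p - q ∈ locZero (A ∩ B)) : glue χ p q - q ∈ locZero B := by
  have hnil := h.nil_eq hpq
  intro x hx
  have hle : 𝓝[B] x ≤ 𝓝[A ∪ B] x := nhdsWithin_mono x Set.subset_union_right
  have key : A ∈ 𝓝[B] x → x ∈ A → ∃ U ∈ 𝓝[B] x, ∀ l : List E, (∀ y ∈ l, y ∈ U) →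
      (glue χ p q - q) l = 0 := by
    intro hA hxA
    obtain ⟨U, hU, hpqU⟩ := hpq x ⟨hxA, hx⟩
    refine ⟨U, nhdsWithin_le_of_mem (inter_mem hA self_mem_nhdsWithin) hU, fun l hl => ?_⟩
    have h2 := sub_eq_zero.mp (hpqU l hl)
    cases l with
    | nil => simp [glue, hnil]
    | cons a l =>
      simp only [Pi.sub_apply, glue]
      split_ifs
      · rw [h2, sub_self]
      · simp
  rcases h.nhds x (Or.inr hx) with h1 | ⟨h1, -⟩ | ⟨-, h1⟩
  · exact key (mem_of_superset (hle h1) Set.inter_subset_left)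
      (mem_of_mem_nhdsWithin (Set.mem_union_right A hx) h1).1
  · exact key (hle h1) (mem_of_mem_nhdsWithin (Set.mem_union_right A hx) h1)
  · refine ⟨χᶜ, hle h1, fun l hl => ?_⟩
    cases l with
    | nil => simp [glue, hnil]
    | cons a l =>
      have := hl a (by simp)
      simp only [Set.mem_compl_iff] at this
      simp [glue, this]

/-- The Mayer–Vietoris isomorphism for a pair of sets without cohomology. -/
theorem cohomologyCard_inter (h : Excisive A B χ) (hA : cocycles A ≤ coboundaries A)
    (hB : cocycles B ≤ coboundaries B) :
    cohomologyCard (A ∩ B) = cohomologyCard (A ∪ B) := by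
  have hlA : A ∩ B ⊆ A := Set.inter_subset_left
  have hlB : A ∩ B ⊆ B := Set.inter_subset_right
  have huA : A ⊆ A ∪ B := Set.subset_union_left
  have huB : B ⊆ A ∪ B := Set.subset_union_right
  -- The connecting homomorphism: the coboundary of f on the side of A, extended by 0 on the side of
  -- B. The two agree near the diagonal of A ∩ B because f is a cocycle there.
  let F : (List E → ZMod 2) →+ (List E → ZMod 2) :=
    AddMonoidHom.mk' (fun f => glue χ (coboundary f) 0) (by
      intro f g
      ext l
      cases l with
      | nil => simp [glue]
      | cons a l => by_cases ha : a ∈ χ <;> simp [glue, ha])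
  have hFA : ∀ f ∈ cocycles (A ∩ B), F f - coboundary f ∈ locZero A := fun f hf =>
    h.glue_sub_left (by rw [sub_zero]; exact hf)
  have hFB : ∀ f ∈ cocycles (A ∩ B), F f ∈ locZero B := fun f hf => by
    have := h.glue_sub_right (p := coboundary f) (q := 0) (by rw [sub_zero]; exact hf)
    rwa [sub_zero] at this
  refine card_quotient_eq F (fun f hf => ?_) (fun f hf => ⟨fun hFf => ?_, fun hfB => ?_⟩)
    fun f hf => ?_
  · refine h.mem_locZero_union ?_ (coboundary_mem_locZero (hFB f hf))
    have := coboundary_mem_locZero (hFA f hf)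
    rwa [map_sub, coboundary_coboundary, sub_zero] at this
  -- Injectivity: a primitive e of F f makes f - e a cocycle on A and e a cocycle on B. Both are
  -- coboundaries there, hence so is their sum f on A ∩ B.
  · obtain ⟨e, he⟩ := mem_coboundaries.mp hFf
    have h1 : f - e ∈ cocycles A := by
      rw [mem_cocycles, map_sub]
      have := sub_mem (locZero_anti huA he) (hFA f hf)
      rwa [sub_sub_sub_cancel_left] at this
    have h2 : e ∈ cocycles B := by
      have := sub_mem (hFB f hf) (locZero_anti huB he)
      rwa [sub_sub_cancel] at this
    obtain ⟨a, ha⟩ := mem_coboundaries.mp (hA h1)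
    obtain ⟨b, hb⟩ := mem_coboundaries.mp (hB h2)
    refine mem_coboundaries.mpr ⟨a + b, ?_⟩
    have := add_mem (locZero_anti hlA ha) (locZero_anti hlB hb)
    rw [map_add]
    convert this using 1
    abel
  -- Well-definedness: f - coboundary g vanishes near the diagonal of A ∩ B, so gluing it with 0
  -- gives a primitive of F f.
  · obtain ⟨g, hg⟩ := mem_coboundaries.mp hfB
    have hg' : f - coboundary g - 0 ∈ locZero (A ∩ B) := by rwa [sub_zero]
    refine mem_coboundaries.mpr ⟨glue χ (f - coboundary g) 0, h.mem_locZero_union ?_ ?_⟩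
    · have h1 := coboundary_mem_locZero (h.glue_sub_left hg')
      have h2 := sub_mem (hFA f hf) h1
      simp only [map_sub, coboundary_coboundary] at h2
      convert h2 using 1
      abel
    · have h1 := coboundary_mem_locZero (h.glue_sub_right hg')
      rw [sub_zero] at h1
      exact sub_mem (hFB f hf) h1
  -- Surjectivity: primitives a on A and b on B of a cocycle f differ by a cocycle on A ∩ B, whose
  -- image differs from f by the coboundary of -b.
  · obtain ⟨a, ha⟩ := mem_coboundaries.mp (hA (cocycles_anti huA hf))
    obtain ⟨b, hb⟩ := mem_coboundaries.mp (hB (cocycles_anti huB hf))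
    have hab : a - b ∈ cocycles (A ∩ B) := by
      have := sub_mem (locZero_anti hlB hb) (locZero_anti hlA ha)
      rw [mem_cocycles, map_sub]
      rwa [sub_sub_sub_cancel_left] at this
    refine ⟨a - b, hab, mem_coboundaries.mpr ⟨-b, h.mem_locZero_union ?_ ?_⟩⟩
    · have := sub_mem (hFA _ hab) ha
      convert this using 1
      rw [map_neg, map_sub coboundary]
      abel
    · have := sub_mem (hFB _ hab) hb
      convert this using 1
      rw [map_neg]
      abel

end Excisive

end Cohomology

/-! ### Cohomology of finite sets of points. -/

section FiniteSets

variable {E : Type*} [TopologicalSpace E] [T1Space E]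

/-- Points of a finite set are isolated, so only constant lists matter. -/
theorem mem_locZero_of_finite {A : Set E} (hA : A.Finite) {f : List E → ZMod 2} :
    f ∈ locZero A ↔ ∀ x ∈ A, ∀ n, f (List.replicate n x) = 0 := by
  constructor
  · intro h x hx n
    obtain ⟨U, hU, hfU⟩ := h x hx
    refine hfU _ fun y hy => ?_
    rw [List.eq_of_mem_replicate hy]
    exact mem_of_mem_nhdsWithin hx hU
  · intro h x hx
    refine ⟨{x}, ?_, fun l hl => ?_⟩
    · have hc : IsClosed (A \ {x}) := (hA.subset Set.sdiff_subset).isClosed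
      refine mem_nhdsWithin.mpr ⟨(A \ {x})ᶜ, hc.isOpen_compl, by simp, ?_⟩
      rintro y ⟨hy, hyA⟩
      by_contra hne
      exact hy ⟨hyA, hne⟩
    · rw [List.eq_replicate_of_mem (a := x) (l := l) fun y hy => by simpa using hl y hy]
      exact h x hx _

/-- A set of `m + 1` points has `2 ^ m` reduced cohomology classes modulo two. -/
theorem cohomologyCard_range {m : ℕ} {p : Fin (m + 1) → E} (hp : Function.Injective p) :
    cohomologyCard (Set.range p) = 2 ^ m := by
  classical
  have hfin := Set.finite_range p
  have h2 : ∀ x : ZMod 2, x + x = 0 := CharTwo.add_self_eq_zero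
  let F : (List E → ZMod 2) →+ (Fin m → ZMod 2) :=
    AddMonoidHom.mk' (fun f i => f [p i.succ] - f [p 0]) fun f g => by
      ext i
      simp only [Pi.add_apply]
      ring
  have hcard : cohomologyCard (Set.range p) = Nat.card ((⊤ : AddSubgroup (Fin m → ZMod 2)) ⧸
      (⊥ : AddSubgroup (Fin m → ZMod 2)).addSubgroupOf ⊤) := by
    refine card_quotient_eq F (fun _ _ => trivial) (fun f hf => ⟨fun h => ?_, fun h => ?_⟩)
      fun y _ => ?_
    · rw [mem_cocycles, mem_locZero_of_finite hfin] at hf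
      -- On constant lists the primitive doubles an entry. The cocycle condition for a list one
      -- longer supplies the parity needed, and the value of g on the empty list matches the common
      -- value of f on one-element lists.
      let g : List E → ZMod 2 := fun l => match l with
        | [] => f [p 0]
        | a :: l => f (a :: a :: l)
      refine mem_coboundaries.mpr ⟨g, (mem_locZero_of_finite hfin).mpr ?_⟩
      rintro x ⟨i, rfl⟩ n
      have hfi : f [p i] = f [p 0] := by
        refine Fin.cases rfl (fun j => ?_) i
        exact sub_eq_zero.mp (congrFun (AddSubgroup.mem_bot.mp h) j)
      rcases n with _ | _ | n
      · have := hf (p i) ⟨i, rfl⟩ 1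
        rw [coboundary_replicate] at this
        simpa using this
      · have h1 : coboundary g (List.replicate (0 + 1) (p i)) = g [] := by
          rw [coboundary_replicate]; simp
        rw [Pi.sub_apply, h1]
        simpa [g, sub_eq_zero] using hfi
      · have h1 := hf (p i) ⟨i, rfl⟩ (n + 2 + 1)
        rw [coboundary_replicate] at h1
        have h3 : g (List.replicate (n + 1) (p i)) = f (List.replicate (n + 2) (p i)) := rfl
        rw [Pi.sub_apply, coboundary_replicate, h3]
        push_cast at h1 ⊢
        linear_combination h2 (f (List.replicate (n + 2) (p i))) - h1
    · obtain ⟨g, hg⟩ := mem_coboundaries.mp h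
      rw [mem_locZero_of_finite hfin] at hg
      have h1 : ∀ i, f [p i] = g [] := fun i => by
        have := hg (p i) ⟨i, rfl⟩ (0 + 1)
        rw [Pi.sub_apply, coboundary_replicate] at this
        simpa [sub_eq_zero] using this
      rw [AddSubgroup.mem_bot]
      ext i
      change f [p i.succ] - f [p 0] = 0
      rw [h1, h1, sub_self]
    · let f : List E → ZMod 2 := fun l => match l with
        | [a] => ∑ i, if a = p i.succ then y i else 0
        | _ => 0
      refine ⟨f, ?_, ?_⟩
      · rw [mem_cocycles, mem_locZero_of_finite hfin]
        rintro x - n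
        rcases n with _ | _ | _ | n
        · rfl
        · rw [coboundary_replicate]; simp [f]
        · rw [coboundary_replicate]
          push_cast
          linear_combination h2 (f [x])
        · rw [coboundary_replicate]
          simp [f, List.replicate_succ]
      · rw [AddSubgroup.mem_bot, sub_eq_zero]
        ext i
        change f [p i.succ] - f [p 0] = y i
        have h0 : ∀ i : Fin m, p 0 ≠ p i.succ := fun i h => Fin.succ_ne_zero i (hp h).symm
        simp [f, h0, hp.eq_iff]
  rw [hcard, AddSubgroup.bot_addSubgroupOf,
    Nat.card_congr QuotientAddGroup.quotientBot.toEquiv,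
    Nat.card_congr AddSubgroup.topEquiv.toEquiv, Nat.card_fun]
  simp

end FiniteSets

/-! ### Suspensions: their shellings and cohomology. -/

section Suspension

theorem suspend_sum {α : Type*} [Fintype α] {w : α ⊕ Bool → ℝ} (hw : w ∈ stdSimplex ℝ (α ⊕ Bool)) :
    ∑ a, w (Sum.inl a) = 1 - w (Sum.inr true) - w (Sum.inr false) := by
  have := hw.2
  rw [Fintype.sum_sum_type, Fintype.sum_bool] at this
  linarith

variable {α : Type*} [DecidableEq α]

/-- The facets of the suspension of a simplicial complex. -/
def suspend (𝓕 : Finset (Finset α)) : Finset (Finset (α ⊕ Bool)) :=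
  (𝓕 ×ˢ Finset.univ).image fun p => p.1.disjSum {p.2}

theorem mem_suspend {𝓕 : Finset (Finset α)} {G : Finset (α ⊕ Bool)} :
    G ∈ suspend 𝓕 ↔ ∃ F ∈ 𝓕, ∃ b, F.disjSum {b} = G := by
  simp [suspend]

/-- The restriction map of the suspended shelling. -/
def suspendRestrict (R : Finset α → Finset α) (G : Finset (α ⊕ Bool)) : Finset (α ⊕ Bool) :=
  (R G.toLeft).disjSum (if Sum.inr false ∈ G then {false} else ∅)

theorem suspendRestrict_disjSum (R : Finset α → Finset α) (F : Finset α) (b : Bool) :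
    suspendRestrict R (F.disjSum {b}) = (R F).disjSum (if b = false then {false} else ∅) := by
  simp [suspendRestrict, eq_comm]

theorem Shelling.exists_suspend {𝓕 : Finset (Finset α)} {R : Finset α → Finset α}
    {ρ : Finset α → ℕ} (h : Shelling 𝓕 R ρ) :
    ∃ ρ', Shelling (suspend 𝓕) (suspendRestrict R) ρ' := by
  have hsub : ∀ {s : Finset α} {t : Finset Bool} {τ : Finset (α ⊕ Bool)},
      s.disjSum t ⊆ τ ↔ s ⊆ τ.toLeft ∧ t ⊆ τ.toRight := fun {s t τ} => by
    constructor
    · intro h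
      exact ⟨fun a ha => Finset.mem_toLeft.mpr (h (Finset.inl_mem_disjSum.mpr ha)),
        fun b hb => Finset.mem_toRight.mpr (h (Finset.inr_mem_disjSum.mpr hb))⟩
    · rintro ⟨h1, h2⟩ (a | b) hx
      · exact Finset.mem_toLeft.mp (h1 (Finset.inl_mem_disjSum.mp hx))
      · exact Finset.mem_toRight.mp (h2 (Finset.inr_mem_disjSum.mp hx))
  have hsub' : ∀ {s : Finset α} {t : Finset Bool} {τ : Finset (α ⊕ Bool)},
      τ ⊆ s.disjSum t ↔ τ.toLeft ⊆ s ∧ τ.toRight ⊆ t := fun {s t τ} => by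
    constructor
    · intro h
      exact ⟨fun a ha => Finset.inl_mem_disjSum.mp (h (Finset.mem_toLeft.mp ha)),
        fun b hb => Finset.inr_mem_disjSum.mp (h (Finset.mem_toRight.mp hb))⟩
    · rintro ⟨h1, h2⟩ (a | b) hx
      · exact Finset.inl_mem_disjSum.mpr (h1 (Finset.mem_toLeft.mpr hx))
      · exact Finset.inr_mem_disjSum.mpr (h2 (Finset.mem_toRight.mpr hx))
  -- All facets through the suspension point true precede those through false; the shift 𝓕.sup ρ + 1
  -- exceeds every value of ρ. A face belongs to the second half exactly if it contains false, which
  -- is why false enters the restriction.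
  refine ⟨fun G => ρ G.toLeft + if Sum.inr false ∈ G then 𝓕.sup ρ + 1 else 0, ?_, ?_, ?_⟩
  · intro G hG
    obtain ⟨F, hF, b, rfl⟩ := mem_suspend.mp hG
    rw [suspendRestrict_disjSum]
    refine Finset.disjSum_mono (h.restrict_subset F hF) ?_
    split_ifs with hb
    · rw [hb]
    · exact Finset.empty_subset _
  · intro G hG G' hG' τ h1 h2 h3 h4
    obtain ⟨F, hF, b, rfl⟩ := mem_suspend.mp hG
    obtain ⟨F', hF', b', rfl⟩ := mem_suspend.mp hG'
    rw [suspendRestrict_disjSum, hsub] at h1 h3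
    rw [hsub'] at h2 h4
    rw [h.unique F hF F' hF' τ.toLeft h1.1 h2.1 h3.1 h4.1]
    have h5 := h1.2.trans h4.2
    have h6 := h3.2.trans h2.2
    cases b <;> cases b' <;> simp at h5 h6 ⊢
  · intro G hG τ hτ
    obtain ⟨F, hF, b, rfl⟩ := mem_suspend.mp hG
    rw [hsub'] at hτ
    obtain ⟨F', hF', h1, h2, h3⟩ := h.exists_le F hF τ.toLeft hτ.1
    by_cases hfalse : false ∈ τ.toRight
    · have hb : false = b := by simpa using hτ.2 hfalse
      subst hb
      refine ⟨F'.disjSum {false}, mem_suspend.mpr ⟨F', hF', false, rfl⟩, ?_, ?_, ?_⟩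
      · rw [suspendRestrict_disjSum, hsub]
        exact ⟨h1, by simpa using hfalse⟩
      · exact hsub'.mpr ⟨h2, hτ.2⟩
      · rcases h3 with rfl | h3
        · exact Or.inl rfl
        · right
          simpa using h3
    · refine ⟨F'.disjSum {true}, mem_suspend.mpr ⟨F', hF', true, rfl⟩, ?_, ?_, ?_⟩
      · rw [suspendRestrict_disjSum, hsub]
        exact ⟨h1, by simp⟩
      · refine hsub'.mpr ⟨h2, fun c hc => ?_⟩
        cases c
        · exact absurd hc hfalse
        · simp
      · cases b
        · right
          have := Finset.le_sup (f := ρ) hF'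
          simp
          omega
        · rcases h3 with rfl | h3
          · exact Or.inl rfl
          · right
            simpa using h3

theorem card_suspend_filter (𝓕 : Finset (Finset α)) (R : Finset α → Finset α) :
    ((suspend 𝓕).filter fun G => suspendRestrict R G = G).card =
      (𝓕.filter fun F => R F = F).card := by
  have : (suspend 𝓕).filter (fun G => suspendRestrict R G = G) =
      (𝓕.filter fun F => R F = F).image fun F => F.disjSum {false} := by
    ext G
    simp only [Finset.mem_filter, mem_suspend, Finset.mem_image]
    constructor
    · rintro ⟨⟨F, hF, b, rfl⟩, hR⟩
      rw [suspendRestrict_disjSum] at hR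
      have h1 := congrArg Finset.toLeft hR
      have h2 := congrArg Finset.toRight hR
      simp only [Finset.toLeft_disjSum, Finset.toRight_disjSum] at h1 h2
      cases b
      · exact ⟨F, ⟨hF, h1⟩, rfl⟩
      · simp at h2
    · rintro ⟨F, ⟨hF, hR⟩, rfl⟩
      refine ⟨⟨F, hF, false, rfl⟩, ?_⟩
      rw [suspendRestrict_disjSum, hR]
      rfl
  rw [this, Finset.card_image_of_injective]
  intro F F' h
  simpa using congrArg Finset.toLeft h

/-- Projection away from the suspension point `b`. -/
noncomputable def dropPoint (b : Bool) (w : α ⊕ Bool → ℝ) : α ⊕ Bool → ℝ :=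
  fun x => if x = Sum.inr b then 0 else w x / (1 - w (Sum.inr b))

theorem continuousOn_dropPoint (b : Bool) :
    ContinuousOn (dropPoint b : (α ⊕ Bool → ℝ) → _) {w | w (Sum.inr b) ≤ 1 / 2} := by
  refine continuousOn_pi.mpr fun x => ?_
  unfold dropPoint
  split_ifs
  · exact continuousOn_const
  · refine ContinuousOn.div (by fun_prop) (by fun_prop) fun w hw => ?_
    have : w (Sum.inr b) ≤ 1 / 2 := hw
    exact (by linarith : (0 : ℝ) < 1 - w (Sum.inr b)).ne'

variable [Fintype α] {𝓕 : Finset (Finset α)}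

theorem mem_polyhedron_suspend {w : α ⊕ Bool → ℝ} : w ∈ polyhedron (suspend 𝓕) ↔
    w ∈ stdSimplex ℝ (α ⊕ Bool) ∧ ∃ F ∈ 𝓕, ∃ b : Bool, (∀ a, a ∉ F → w (Sum.inl a) = 0) ∧
      w (Sum.inr !b) = 0 := by
  refine and_congr_right fun _ => ⟨?_, ?_⟩
  · rintro ⟨G, hG, hw⟩
    obtain ⟨F, hF, b, rfl⟩ := mem_suspend.mp hG
    refine ⟨F, hF, b, fun a ha => hw _ (by simpa using ha), hw _ (by simp)⟩
  · rintro ⟨F, hF, b, h1, h2⟩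
    refine ⟨_, mem_suspend.mpr ⟨F, hF, b, rfl⟩, ?_⟩
    rintro (a | c) hc
    · exact h1 a (by simpa using hc)
    · have : c = !b := by
        rw [Finset.inr_mem_disjSum, Finset.mem_singleton] at hc
        cases c <;> cases b <;> simp_all
      rw [this, h2]

theorem combo_mem_suspend {w u : α ⊕ Bool → ℝ} (hw : w ∈ stdSimplex ℝ (α ⊕ Bool))
    (hu : u ∈ stdSimplex ℝ (α ⊕ Bool)) {F : Finset α} (hF : F ∈ 𝓕) {b : Bool}
    (hwF : ∀ a, a ∉ F → w (Sum.inl a) = 0) (hwb : w (Sum.inr !b) = 0)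
    (huF : ∀ a, a ∉ F → u (Sum.inl a) = 0) (hub : u (Sum.inr !b) = 0) (t : unitInterval) :
    (1 - (t : ℝ)) • w + (t : ℝ) • u ∈ polyhedron (suspend 𝓕) := by
  refine mem_polyhedron_suspend.mpr ⟨convex_stdSimplex ℝ _ hw hu (sub_nonneg.mpr t.2.2) t.2.1
    (by ring), F, hF, b, fun a ha => ?_, ?_⟩
  · simp [hwF a ha, huF a ha]
  · simp [hwb, hub]

theorem dropPoint_mem {b : Bool} {w : α ⊕ Bool → ℝ} (hw : w ∈ stdSimplex ℝ (α ⊕ Bool))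
    (hb : w (Sum.inr b) ≤ 1 / 2) : dropPoint b w ∈ stdSimplex ℝ (α ⊕ Bool) := by
  constructor
  · intro x
    unfold dropPoint
    split_ifs
    · exact le_rfl
    · exact div_nonneg (hw.1 x) (by linarith)
  · have h1 : ∀ x, dropPoint b w x =
        (w x - if x = Sum.inr b then w (Sum.inr b) else 0) / (1 - w (Sum.inr b)) := by
      intro x
      unfold dropPoint
      split_ifs with hx
      · rw [hx, sub_self, zero_div]
      · rw [sub_zero]
    simp only [h1]
    rw [← Finset.sum_div, Finset.sum_sub_distrib, hw.2]
    simp only [Finset.sum_ite_eq', Finset.mem_univ, if_true]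
    exact div_self (by linarith)

theorem isCompact_half (𝓕 : Finset (Finset α)) (b : Bool) :
    IsCompact (polyhedron (suspend 𝓕) ∩ {w | w (Sum.inr b) ≤ 1 / 2}) :=
  (isCompact_polyhedron _).inter_right (isClosed_le (by fun_prop) continuous_const)

/-- The half of a suspension opposite to a suspension point has no cohomology. -/
theorem cocycles_half_le (𝓕 : Finset (Finset α)) (b : Bool) :
    cocycles (polyhedron (suspend 𝓕) ∩ {w | w (Sum.inr b) ≤ 1 / 2}) ≤
      coboundaries (polyhedron (suspend 𝓕) ∩ {w | w (Sum.inr b) ≤ 1 / 2}) := by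
  set A : Set (α ⊕ Bool → ℝ) := polyhedron (suspend 𝓕) ∩ {w | w (Sum.inr b) ≤ 1 / 2} with hA
  set A₀ : Set (α ⊕ Bool → ℝ) := polyhedron (suspend 𝓕) ∩ {w | w (Sum.inr b) = 0} with hA₀
  have hAc : IsCompact A := isCompact_half 𝓕 b
  have hA₀c : IsCompact A₀ :=
    (isCompact_polyhedron _).inter_right (isClosed_eq (by fun_prop) continuous_const)
  have hA₀A : A₀ ⊆ A := fun w hw => ⟨hw.1, by
    have : w (Sum.inr b) = 0 := hw.2
    change w (Sum.inr b) ≤ 1 / 2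
    rw [this]; norm_num⟩
  have hdc : ContinuousOn (dropPoint b) A := (continuousOn_dropPoint b).mono Set.inter_subset_right
  have hfacet : ∀ w ∈ A, ∃ F ∈ 𝓕, ∃ c : Bool, (∀ a, a ∉ F → w (Sum.inl a) = 0) ∧
      w (Sum.inr !c) = 0 ∧ (∀ a, a ∉ F → dropPoint b w (Sum.inl a) = 0) ∧
      dropPoint b w (Sum.inr !c) = 0 := by
    rintro w ⟨hw, -⟩
    obtain ⟨-, F, hF, c, h1, h2⟩ := mem_polyhedron_suspend.mp hw
    refine ⟨F, hF, c, h1, h2, fun a ha => by simp [dropPoint, h1 a ha], by simp [dropPoint, h2]⟩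
  have hdm : Set.MapsTo (dropPoint b) A A₀ := by
    intro w hw
    obtain ⟨F, hF, c, -, -, h1, h2⟩ := hfacet w hw
    refine ⟨mem_polyhedron_suspend.mpr ⟨dropPoint_mem hw.1.1 hw.2, F, hF, c, h1, h2⟩, ?_⟩
    simp [dropPoint]
  -- The part without the point b is a cone with the other suspension point as apex, so straight
  -- lines contract it.
  have h0 : cocycles A₀ ≤ coboundaries A₀ := by
    refine cocycles_le_coboundaries_of_contraction hA₀c (Pi.single (Sum.inr !b) 1)
      (H := fun q => (1 - (q.1 : ℝ)) • q.2 + (q.1 : ℝ) • Pi.single (Sum.inr !b) (1 : ℝ))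
      (by fun_prop) ?_ (by simp) (by simp)
    rintro t w ⟨hw, hwb⟩
    obtain ⟨hs, F, hF, c, h1, h2⟩ := mem_polyhedron_suspend.mp hw
    have h3 : w (Sum.inr b) = 0 := hwb
    refine ⟨combo_mem_suspend hs (single_mem_stdSimplex ℝ (Sum.inr !b)) hF (b := !b) h1
      (by simpa using h3) (by simp) (by simp) t, ?_⟩
    simp [h3]
  intro f hf
  have h1 : pullback (dropPoint b) f ∈ coboundaries A :=
    pullback_mem_coboundaries hdc hdm (h0 (cocycles_anti hA₀A hf))
  -- The straight-line homotopy from the identity to `dropPoint b` stays in the half, so a cocycle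
  -- is cohomologous to its pullback from the cone A₀.
  have h2 := pullback_sub_pullback_mem hAc (A' := A)
    (H := fun q => (1 - (q.1 : ℝ)) • q.2 + (q.1 : ℝ) • dropPoint b q.2) ?_ ?_ hf 0 1
  · have e0 : pullback (fun x : α ⊕ Bool → ℝ => (1 - ((0 : unitInterval) : ℝ)) • x +
        ((0 : unitInterval) : ℝ) • dropPoint b x) f = f := by
      ext l
      simp [pullback_apply]
    have e1 : pullback (fun x : α ⊕ Bool → ℝ => (1 - ((1 : unitInterval) : ℝ)) • x +
        ((1 : unitInterval) : ℝ) • dropPoint b x) f = pullback (dropPoint b) f := by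
      simp
    have h3 := add_mem h2 h1
    rw [e0, e1, sub_add_cancel] at h3
    exact h3
  · have : ContinuousOn (fun q : unitInterval × (α ⊕ Bool → ℝ) => dropPoint b q.2)
        (Set.univ ×ˢ A) := hdc.comp (by fun_prop) fun q hq => hq.2
    fun_prop
  · intro t w hw
    obtain ⟨F, hF, c, h1, h2, h3, h4⟩ := hfacet w hw
    refine ⟨combo_mem_suspend hw.1.1 (dropPoint_mem hw.1.1 hw.2) hF h1 h2 h3 h4 t, ?_⟩
    have hwb : w (Sum.inr b) ≤ 1 / 2 := hw.2
    have hwn : 0 ≤ w (Sum.inr b) := hw.1.1.1 _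
    have : (1 - (t : ℝ)) * w (Sum.inr b) ≤ 1 / 2 :=
      (mul_le_of_le_one_left hwn (by linarith [t.2.1])).trans hwb
    simpa [dropPoint] using this

/-- The suspension isomorphism. -/
theorem cohomologyCard_suspend (𝓕 : Finset (Finset α)) (hne : (polyhedron 𝓕).Nonempty) :
    cohomologyCard (polyhedron (suspend 𝓕)) = cohomologyCard (polyhedron 𝓕) := by
  set X : Set (α ⊕ Bool → ℝ) := polyhedron (suspend 𝓕) with hX
  set A : Set (α ⊕ Bool → ℝ) := X ∩ {w | w (Sum.inr false) ≤ 1 / 2} with hA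
  set B : Set (α ⊕ Bool → ℝ) := X ∩ {w | w (Sum.inr true) ≤ 1 / 2} with hB
  have hzero : ∀ w ∈ X, w (Sum.inr true) = 0 ∨ w (Sum.inr false) = 0 := by
    intro w hw
    obtain ⟨-, F, hF, b, -, h⟩ := mem_polyhedron_suspend.mp hw
    cases b
    · exact Or.inl h
    · exact Or.inr h
  have hAB : A ∪ B = X := by
    rw [hA, hB, ← Set.inter_union_distrib_left, Set.inter_eq_left]
    intro w hw
    rcases hzero w hw with h | h
    · right; change w (Sum.inr true) ≤ 1 / 2; rw [h]; norm_num
    · left; change w (Sum.inr false) ≤ 1 / 2; rw [h]; norm_num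
  let ψ : (α → ℝ) → (α ⊕ Bool → ℝ) := fun u => Sum.elim u fun _ => 0
  let φ : (α ⊕ Bool → ℝ) → (α → ℝ) := fun w a =>
    w (Sum.inl a) / (1 - w (Sum.inr true) - w (Sum.inr false))
  have hψs : ∀ u ∈ stdSimplex ℝ α, ψ u ∈ stdSimplex ℝ (α ⊕ Bool) := fun u hu => by
    constructor
    · rintro (a | b)
      · exact hu.1 a
      · exact le_rfl
    · simpa [ψ, Fintype.sum_sum_type] using hu.2
  have hψm : Set.MapsTo ψ (polyhedron 𝓕) (A ∩ B) := by
    rintro u ⟨hu, F, hF, huF⟩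
    have : ψ u ∈ X := mem_polyhedron_suspend.mpr ⟨hψs u hu, F, hF, true, huF, rfl⟩
    refine ⟨⟨this, ?_⟩, this, ?_⟩
    · change (0 : ℝ) ≤ 1 / 2; norm_num
    · change (0 : ℝ) ≤ 1 / 2; norm_num
  have hden : ∀ w ∈ A ∩ B, 1 / 2 ≤ 1 - w (Sum.inr true) - w (Sum.inr false) := by
    rintro w ⟨⟨hw, h1⟩, -, h2⟩
    have h1 : w (Sum.inr false) ≤ 1 / 2 := h1
    have h2 : w (Sum.inr true) ≤ 1 / 2 := h2
    rcases hzero w hw with h | h <;> linarith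
  have hφs : ∀ w ∈ A ∩ B, φ w ∈ stdSimplex ℝ α := by
    intro w hw
    have hd := hden w hw
    refine ⟨fun a => div_nonneg (hw.1.1.1.1 _) (by linarith), ?_⟩
    simp only [φ]
    rw [← Finset.sum_div, suspend_sum hw.1.1.1]
    exact div_self (by linarith)
  have hφm : Set.MapsTo φ (A ∩ B) (polyhedron 𝓕) := by
    intro w hw
    obtain ⟨-, F, hF, b, h1, -⟩ := mem_polyhedron_suspend.mp hw.1.1
    exact ⟨hφs w hw, F, hF, fun a ha => by simp [φ, h1 a ha]⟩
  have hφc : ContinuousOn φ (A ∩ B) := by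
    refine continuousOn_pi.mpr fun a => ContinuousOn.div (by fun_prop) (by fun_prop) fun w hw => ?_
    have := hden w hw
    exact (by linarith : (0 : ℝ) < _).ne'
  have hψc : Continuous ψ := by
    refine continuous_pi ?_
    rintro (a | b)
    · exact continuous_apply a
    · exact continuous_const
  have hABc : IsCompact (A ∩ B) :=
    (isCompact_half 𝓕 false).inter (isCompact_half 𝓕 true)
  have hφψ : ∀ u, φ (ψ u) = u := fun u => by
    ext a
    simp [φ, ψ]
  -- The intersection of the two halves deforms to the equator: forget the suspension coordinates
  -- and rescale. They add up to at most 1 / 2, since one of them is always 0.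
  have h1 : cohomologyCard (A ∩ B) = cohomologyCard (polyhedron 𝓕) := by
    refine cohomologyCard_eq_of_homotopy hABc (isCompact_polyhedron 𝓕) hφc hψc.continuousOn hφm hψm
      (H := fun q => (1 - (q.1 : ℝ)) • ψ (φ q.2) + (q.1 : ℝ) • q.2) ?_ ?_ (by simp) (by simp)
      (K := Prod.snd) (by fun_prop) (fun t x hx => hx) (fun x _ => (hφψ x).symm) (fun x _ => rfl)
    · have : ContinuousOn (fun q : unitInterval × (α ⊕ Bool → ℝ) => ψ (φ q.2))
          (Set.univ ×ˢ (A ∩ B)) :=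
        hψc.comp_continuousOn (hφc.comp (by fun_prop) fun q hq => hq.2)
      fun_prop
    · intro t w hw
      obtain ⟨hs, F, hF, b, h1, h2⟩ := mem_polyhedron_suspend.mp hw.1.1
      have hX' := combo_mem_suspend (hψs _ (hφs w hw)) hs hF (b := b)
        (fun a ha => by simp [ψ, φ, h1 a ha]) rfl h1 h2 t
      have key : ∀ c, w (Sum.inr c) ≤ 1 / 2 →
          ((1 - (t : ℝ)) • ψ (φ w) + (t : ℝ) • w) (Sum.inr c) ≤ 1 / 2 := by
        intro c hc
        have : (t : ℝ) * w (Sum.inr c) ≤ 1 / 2 :=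
          (mul_le_of_le_one_left (hs.1 _) t.2.2).trans hc
        simpa [ψ] using this
      exact ⟨⟨hX', key _ hw.1.2⟩, hX', key _ hw.2.2⟩
  -- Where both suspension coordinates are below 1 / 2, A ∩ B is a neighbourhood. Otherwise one is
  -- at least 1 / 2, stays positive nearby, and forces the other to be 0.
  have hex : Excisive A B {w | 0 < w (Sum.inr true)} := by
    constructor
    · obtain ⟨u, hu⟩ := hne
      exact ⟨_, hψm hu⟩
    · rw [hAB]
      intro w hw
      have hopen : ∀ (c : Bool) (r : ℝ), {v : α ⊕ Bool → ℝ | v (Sum.inr c) < r} ∈ 𝓝[X] w ∨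
          r ≤ w (Sum.inr c) := fun c r => by
        rcases lt_or_ge (w (Sum.inr c)) r with h | h
        · exact Or.inl (mem_nhdsWithin_of_mem_nhds
            ((isOpen_lt (by fun_prop) continuous_const).mem_nhds h))
        · exact Or.inr h
      have hopen' : ∀ (c : Bool), 1 / 2 ≤ w (Sum.inr c) →
          {v : α ⊕ Bool → ℝ | 0 < v (Sum.inr c)} ∈ 𝓝[X] w := fun c hc =>
        mem_nhdsWithin_of_mem_nhds ((isOpen_lt continuous_const (by fun_prop)).mem_nhds
          (show (0 : ℝ) < w (Sum.inr c) by linarith))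
      rcases hopen true (1 / 2) with ht | ht
      · rcases hopen false (1 / 2) with hf | hf
        · left
          filter_upwards [ht, hf, self_mem_nhdsWithin] with v h1 h2 hv
          exact ⟨⟨hv, le_of_lt h2⟩, hv, le_of_lt h1⟩
        · right; right
          constructor
          · filter_upwards [ht, self_mem_nhdsWithin] with v h1 hv using ⟨hv, le_of_lt h1⟩
          · filter_upwards [hopen' false hf, self_mem_nhdsWithin] with v h1 hv
            have h1 : 0 < v (Sum.inr false) := h1
            rcases hzero v hv with h | h
            · change ¬ 0 < v (Sum.inr true)
              rw [h]; exact lt_irrefl _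
            · exact absurd h h1.ne'
      · right; left
        refine ⟨?_, hopen' true ht⟩
        filter_upwards [hopen' true ht, self_mem_nhdsWithin] with v h1 hv
        have h1 : 0 < v (Sum.inr true) := h1
        refine ⟨hv, ?_⟩
        change v (Sum.inr false) ≤ 1 / 2
        rcases hzero v hv with h | h
        · exact absurd h h1.ne'
        · rw [h]; norm_num
  have h2 := hex.cohomologyCard_inter (cocycles_half_le 𝓕 false) (cocycles_half_le 𝓕 true)
  rw [hAB] at h2
  rw [← h2, h1]

end Suspension

/-! ### Invariance under homotopy equivalence and the number of spheres. -/

open Classical in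
/-- Extension of a function on a subset by arbitrary values. -/
noncomputable def extendFrom' {E E' : Type*} [Nonempty E'] {A : Set E} (f : A → E') (x : E) : E' :=
  if h : x ∈ A then f ⟨x, h⟩ else Classical.arbitrary E'

theorem extendFrom'_of_mem {E E' : Type*} [Nonempty E'] {A : Set E} (f : A → E') {x : E}
    (h : x ∈ A) : extendFrom' f x = f ⟨x, h⟩ := dif_pos h

theorem continuousOn_extendFrom' {E E' : Type*} [TopologicalSpace E] [TopologicalSpace E']
    [Nonempty E'] {A : Set E} {f : A → E'} (hf : Continuous f) :
    ContinuousOn (extendFrom' f) A := by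
  rw [continuousOn_iff_continuous_domRestrict]
  have : A.domRestrict (extendFrom' f) = f := funext fun x => extendFrom'_of_mem f x.2
  rwa [this]

theorem exists_extend_homotopy {E : Type*} [TopologicalSpace E] [Nonempty E] {A : Set E}
    (F : C(unitInterval × A, A)) : ∃ G : unitInterval × E → E,
      ContinuousOn G (Set.univ ×ˢ A) ∧ ∀ t x (hx : x ∈ A), G (t, x) = F (t, ⟨x, hx⟩) := by
  refine ⟨extendFrom' (A := Set.univ ×ˢ A) fun q => (F (q.1.1, ⟨q.1.2, q.2.2⟩) : E),
    continuousOn_extendFrom' (by fun_prop), fun t x hx => ?_⟩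
  rw [extendFrom'_of_mem _ (show (t, x) ∈ Set.univ ×ˢ A from ⟨trivial, hx⟩)]

theorem cohomologyCard_eq_of_homotopyEquiv {E E' : Type*} [TopologicalSpace E]
    [TopologicalSpace E'] [Nonempty E] [Nonempty E'] {A : Set E} {A' : Set E'} (hA : IsCompact A)
    (hA' : IsCompact A') (e : ContinuousMap.HomotopyEquiv A A') :
    cohomologyCard A = cohomologyCard A' := by
  obtain ⟨H⟩ := e.left_inv
  obtain ⟨K⟩ := e.right_inv
  obtain ⟨H', hH', hHe⟩ := exists_extend_homotopy H.toContinuousMap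
  obtain ⟨K', hK', hKe⟩ := exists_extend_homotopy K.toContinuousMap
  have hm : ∀ x ∈ A, extendFrom' (fun x => (e x : E')) x ∈ A' := fun x hx => by
    rw [extendFrom'_of_mem _ hx]; exact (e ⟨x, hx⟩).2
  have hm' : ∀ x ∈ A', extendFrom' (fun x => (e.symm x : E)) x ∈ A := fun x hx => by
    rw [extendFrom'_of_mem _ hx]; exact (e.symm ⟨x, hx⟩).2
  refine cohomologyCard_eq_of_homotopy hA hA'
    (φ := extendFrom' fun x => (e x : E')) (ψ := extendFrom' fun x => (e.symm x : E))
    (continuousOn_extendFrom' (by have := e.continuous; fun_prop))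
    (continuousOn_extendFrom' (by have := e.symm.continuous; fun_prop)) hm hm'
    hH' (fun t x hx => ?_) (fun x hx => ?_) (fun x hx => ?_)
    hK' (fun t x hx => ?_) (fun x hx => ?_) (fun x hx => ?_)
  · rw [hHe t x hx]; exact Subtype.coe_prop _
  · rw [hHe 0 x hx, extendFrom'_of_mem _ (hm x hx)]
    simp only [extendFrom'_of_mem _ hx]
    exact congrArg Subtype.val (H.apply_zero ⟨x, hx⟩)
  · rw [hHe 1 x hx]
    exact congrArg Subtype.val (H.apply_one ⟨x, hx⟩)
  · rw [hKe t x hx]; exact Subtype.coe_prop _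
  · rw [hKe 0 x hx, extendFrom'_of_mem _ (hm' x hx)]
    simp only [extendFrom'_of_mem _ hx]
    exact congrArg Subtype.val (K.apply_zero ⟨x, hx⟩)
  · rw [hKe 1 x hx]
    exact congrArg Subtype.val (K.apply_one ⟨x, hx⟩)

/-- The iterated suspension of `m + 1` points is a shellable model of the wedge of `m` spheres
whose cohomology is known. -/
theorem exists_shelling_cohomologyCard (m d : ℕ) : ∃ (α : Type) (_ : Fintype α) (_ : DecidableEq α)
    (𝓕 : Finset (Finset α)) (R : Finset α → Finset α) (ρ : Finset α → ℕ), Shelling 𝓕 R ρ ∧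
      (∀ F ∈ 𝓕, F.card = d + 1) ∧ 𝓕.Nonempty ∧ (𝓕.filter fun F => R F = F).card = m ∧
      cohomologyCard (polyhedron 𝓕) = 2 ^ m := by
  induction d with
  | zero =>
    -- The point 0 comes first and has empty restriction; each of the m other points is its own
    -- restriction.
    refine ⟨Fin (m + 1), inferInstance, inferInstance, Finset.univ.image fun i => {i},
      fun F => F.erase 0, fun F => if 0 ∈ F then 0 else 1, ⟨?_, ?_, ?_⟩, ?_, ?_, ?_, ?_⟩
    · exact fun F _ => Finset.erase_subset _ _
    · simp only [Finset.mem_image, Finset.mem_univ, true_and]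
      rintro _ ⟨i, rfl⟩ _ ⟨j, rfl⟩ τ h1 h2 h3 h4
      rcases Finset.subset_singleton_iff.mp h2 with rfl | rfl
      · have h5 : ∀ i : Fin (m + 1), ({i} : Finset (Fin (m + 1))).erase 0 ⊆ ∅ → i = 0 := by
          intro i hi
          by_contra hne
          have := hi (Finset.mem_erase.mpr ⟨hne, Finset.mem_singleton_self i⟩)
          simp at this
        rw [h5 i h1, h5 j h3]
      · exact congrArg _ (Finset.singleton_subset_singleton.mp h4)
    · simp only [Finset.mem_image, Finset.mem_univ, true_and]
      rintro _ ⟨i, rfl⟩ τ h2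
      rcases Finset.subset_singleton_iff.mp h2 with rfl | rfl
      · refine ⟨_, ⟨0, rfl⟩, by simp, by simp, ?_⟩
        by_cases hi : i = 0
        · exact Or.inl (by rw [hi])
        · right
          simp [Ne.symm hi]
      · exact ⟨_, ⟨i, rfl⟩, Finset.erase_subset _ _, le_rfl, Or.inl rfl⟩
    · simp
    · exact ⟨_, Finset.mem_image_of_mem _ (Finset.mem_univ 0)⟩
    · have : (Finset.univ.image fun i : Fin (m + 1) => ({i} : Finset (Fin (m + 1)))).filter
          (fun F => F.erase 0 = F) = (Finset.univ.erase 0).image fun i => {i} := by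
        ext F
        simp only [Finset.mem_filter, Finset.mem_image, Finset.mem_univ, true_and,
          Finset.mem_erase, and_true, Finset.erase_eq_self]
        constructor
        · rintro ⟨⟨i, rfl⟩, hi⟩
          exact ⟨i, fun h => hi (by simp [h]), rfl⟩
        · rintro ⟨i, hi, rfl⟩
          exact ⟨⟨i, rfl⟩, by simpa using Ne.symm hi⟩
      rw [this, Finset.card_image_of_injective _ Finset.singleton_injective]
      simp
    · have : polyhedron (Finset.univ.image fun i : Fin (m + 1) => ({i} : Finset (Fin (m + 1)))) =
          Set.range fun i => (Pi.single i 1 : Fin (m + 1) → ℝ) := by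
        ext w
        constructor
        · rintro ⟨hw, F, hF, hwF⟩
          obtain ⟨i, -, rfl⟩ := Finset.mem_image.mp hF
          have h0 : ∀ a, a ≠ i → w a = 0 := fun a ha => hwF a (by simpa using ha)
          have h1 : w i = 1 := by
            rw [← hw.2, Finset.sum_eq_single i (fun a _ ha => h0 a ha) (by simp)]
          refine ⟨i, funext fun a => ?_⟩
          by_cases ha : a = i
          · subst ha; simp [h1]
          · simp [ha, h0 a ha]
        · rintro ⟨i, rfl⟩
          exact single_mem_polyhedron (Finset.mem_image_of_mem _ (Finset.mem_univ i))
            (Finset.mem_singleton_self i)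
      rw [this]
      refine cohomologyCard_range fun i j hij => ?_
      by_contra hne
      have := congrFun hij i
      simp [hne] at this
  | succ d ih =>
    obtain ⟨α, _, _, 𝓕, R, ρ, hS, hcard, hne, hm, hH⟩ := ih
    obtain ⟨ρ', hS'⟩ := hS.exists_suspend
    refine ⟨α ⊕ Bool, inferInstance, inferInstance, suspend 𝓕, suspendRestrict R, ρ', hS', ?_, ?_,
      ?_, ?_⟩
    · intro G hG
      obtain ⟨F, hF, b, rfl⟩ := mem_suspend.mp hG
      simp [hcard F hF]
    · obtain ⟨F, hF⟩ := hne
      exact ⟨_, mem_suspend.mpr ⟨F, hF, true, rfl⟩⟩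
    · rw [card_suspend_filter, hm]
    · obtain ⟨F, hF⟩ := hne
      obtain ⟨v, hv⟩ : F.Nonempty := Finset.card_pos.mp (by rw [hcard F hF]; omega)
      rw [cohomologyCard_suspend 𝓕 ⟨_, single_mem_polyhedron hF hv⟩, hH]

/-- The number of spheres in a wedge is determined by its homotopy type. -/
theorem SphereWedge.card_eq_of_homotopyEquiv {m m' d : ℕ}
    (e : ContinuousMap.HomotopyEquiv (SphereWedge m d) (SphereWedge m' d)) : m = m' := by
  obtain ⟨α, _, _, 𝓕, R, ρ, hS, hcard, hne, hm, hH⟩ := exists_shelling_cohomologyCard m d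
  obtain ⟨α', _, _, 𝓕', R', ρ', hS', hcard', hne', hm', hH'⟩ := exists_shelling_cohomologyCard m' d
  obtain ⟨f⟩ := hS.nonempty_homotopyEquiv hcard hne
  obtain ⟨f'⟩ := hS'.nonempty_homotopyEquiv hcard' hne'
  rw [hm] at f
  rw [hm'] at f'
  have := cohomologyCard_eq_of_homotopyEquiv (isCompact_polyhedron 𝓕) (isCompact_polyhedron 𝓕')
    ((f.trans e).trans f'.symm)
  rw [hH, hH'] at this
  exact Nat.pow_right_injective le_rfl this

/-! Components of restricted building sets and the first atoms of intervals of even sets. -/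

/-- The component of `x` in the restriction of `B` to `I`. -/
def comp (B : Finset (Finset ℕ)) (I : Finset ℕ) (x : ℕ) : Finset ℕ :=
  (B.filter fun K => K ⊆ I ∧ x ∈ K).sup id

/-- The largest element of the component of `x` in the restriction of `B` to `I`. -/
def maxComp (B : Finset (Finset ℕ)) (I : Finset ℕ) (x : ℕ) : ℕ := (comp B I x).sup id

/-- The largest element of the components of the restriction of `B` to `I` not contained
in `J`. -/
def topMax (B : Finset (Finset ℕ)) (J I : Finset ℕ) : ℕ := (I \ J).sup (maxComp B I)

/-- `I` is a subset of `S` such that all components of the restriction of `B` to `I` have even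
order. -/
structure EvenSet (S : Finset ℕ) (B : Finset (Finset ℕ)) (I : Finset ℕ) : Prop where
  subset : I ⊆ S
  even : ∀ x ∈ I, Even (comp B I x).card

/-- `A` arises from `J` by adding the two largest new elements of the component of `I` that has
the largest maximum among those with new elements. -/
structure IsFirst (B : Finset (Finset ℕ)) (J A I : Finset ℕ) : Prop where
  left : J ⊆ A
  right : A ⊆ I
  card : (A \ J).card = 2
  subset : A \ J ⊆ comp B I (topMax B J I)
  lt : ∀ x ∈ A \ J, ∀ y ∈ comp B I (topMax B J I) \ A, y < x

/-- The labelling of the covering relations between even sets. -/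
def label (S : Finset ℕ) (B : Finset (Finset ℕ)) (J A : Finset ℕ) : ℕ :=
  topMax B J A * (S.sum id + 1) + A.sum id

/-! ### Components and parity. -/

section Comp

variable {S : Finset ℕ} {B : Finset (Finset ℕ)} {I J A : Finset ℕ} {x y : ℕ}

theorem mem_comp : y ∈ comp B I x ↔ ∃ K ∈ B, K ⊆ I ∧ x ∈ K ∧ y ∈ K := by
  simp [comp, Finset.mem_sup, and_assoc]

theorem comp_subset : comp B I x ⊆ I := fun y hy => by
  obtain ⟨K, -, hK, -, hyK⟩ := mem_comp.mp hy
  exact hK hyK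

theorem comp_mono (h : J ⊆ I) : comp B J x ⊆ comp B I x := fun y hy => by
  obtain ⟨K, hK, hKJ, hx, hyK⟩ := mem_comp.mp hy
  exact mem_comp.mpr ⟨K, hK, hKJ.trans h, hx, hyK⟩

theorem subset_comp {K : Finset ℕ} (hK : K ∈ B) (hKI : K ⊆ I) (hx : x ∈ K) : K ⊆ comp B I x :=
  fun _ hy => mem_comp.mpr ⟨K, hK, hKI, hx, hy⟩

theorem mem_comp_comm : y ∈ comp B I x ↔ x ∈ comp B I y := by
  simp only [mem_comp, and_comm]

theorem IsBuildingSet.self_mem_comp (hB : IsBuildingSet S B) (hI : I ⊆ S) (hx : x ∈ I) :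
    x ∈ comp B I x :=
  mem_comp.mpr ⟨{x}, hB.singleton x (hI hx), by simpa using hx, by simp, by simp⟩

/-- All members in the union contain x, so the union axiom keeps it in B. -/
theorem IsBuildingSet.comp_mem (hB : IsBuildingSet S B) (hI : I ⊆ S) (hx : x ∈ I) :
    comp B I x ∈ B := by
  have h : comp B I x = ∅ ∨ (comp B I x ∈ B ∧ x ∈ comp B I x) := by
    refine Finset.sup_induction (p := fun K => K = ∅ ∨ (K ∈ B ∧ x ∈ K)) (Or.inl rfl) ?_ ?_
    · rintro K (rfl | ⟨hK, hxK⟩) L (rfl | ⟨hL, hxL⟩)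
      · simp
      · simp [hL, hxL]
      · simp [hK, hxK]
      · exact Or.inr ⟨hB.union K hK L hL ⟨x, Finset.mem_inter.mpr ⟨hxK, hxL⟩⟩,
          Finset.mem_union_left _ hxK⟩
    · intro K hK
      rw [Finset.mem_filter] at hK
      exact Or.inr ⟨hK.1, hK.2.2⟩
  rcases h with h | h
  · have := hB.self_mem_comp hI hx
    rw [h] at this
    simp at this
  · exact h.1

theorem IsBuildingSet.comp_eq (hB : IsBuildingSet S B) (hI : I ⊆ S) (hy : y ∈ comp B I x) :
    comp B I y = comp B I x := by
  have key : ∀ {u v}, u ∈ comp B I v → comp B I v ⊆ comp B I u := fun {u v} h =>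
    subset_comp (hB.comp_mem hI (comp_subset (mem_comp_comm.mp h))) comp_subset h
  exact (key (mem_comp_comm.mp hy)).antisymm (key hy)

theorem IsBuildingSet.isComponent_iff (hB : IsBuildingSet S B) (hI : I ⊆ S) {C : Finset ℕ} :
    IsComponent (restrictTo B I) C ↔ ∃ x ∈ I, C = comp B I x := by
  have hr : ∀ K, K ∈ restrictTo B I ↔ K ∈ B ∧ K ⊆ I := fun K => by simp [restrictTo]
  constructor
  · rintro ⟨h1, h2⟩
    have h1 := (hr C).mp h1
    obtain ⟨x, hx⟩ := hB.nonempty C h1.1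
    have hxI := h1.2 hx
    have hsub := subset_comp h1.1 h1.2 hx
    exact ⟨x, hxI, hsub.antisymm (h2 ((hr _).mpr ⟨hB.comp_mem hI hxI, comp_subset⟩) hsub)⟩
  · rintro ⟨x, hx, rfl⟩
    refine ⟨(hr _).mpr ⟨hB.comp_mem hI hx, comp_subset⟩, fun K hK hle => ?_⟩
    have hK := (hr K).mp hK
    exact subset_comp hK.1 hK.2 (hle (hB.self_mem_comp hI hx))

theorem IsBuildingSet.noOddComponent_iff (hB : IsBuildingSet S B) (hI : I ⊆ S) :
    NoOddComponent (restrictTo B I) ↔ ∀ x ∈ I, Even (comp B I x).card := by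
  simp only [NoOddComponent, hB.isComponent_iff hI, Nat.not_odd_iff_even]
  constructor
  · exact fun h x hx => h _ ⟨x, hx, rfl⟩
  · rintro h _ ⟨x, hx, rfl⟩
    exact h x hx

/-- U is a disjoint union of components of J; they are removed one at a time. -/
theorem EvenSet.even_card_of_closed (hB : IsBuildingSet S B) (hJ : EvenSet S B J) {U : Finset ℕ}
    (hU : U ⊆ J) (hcl : ∀ y ∈ U, comp B J y ⊆ U) : Even U.card := by
  induction U using Finset.strongInduction with
  | H U ih =>
    rcases U.eq_empty_or_nonempty with rfl | ⟨x, hx⟩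
    · simp
    · have hxc := hB.self_mem_comp hJ.subset (hU hx)
      have h1 := ih (U \ comp B J x) (Finset.sdiff_ssubset (hcl x hx) ⟨x, hxc⟩)
        (Finset.sdiff_subset.trans hU) (by
          intro y hy z hz
          rw [Finset.mem_sdiff] at hy ⊢
          refine ⟨hcl y hy.1 hz, fun hzx => hy.2 ?_⟩
          rw [← hB.comp_eq hJ.subset hzx, hB.comp_eq hJ.subset hz]
          exact hB.self_mem_comp hJ.subset (hU hy.1))
      rw [← Finset.card_sdiff_add_card_eq_card (hcl x hx)]
      exact h1.add (hJ.even x (hU hx))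

theorem EvenSet.even_card (hB : IsBuildingSet S B) (hJ : EvenSet S B J) : Even J.card :=
  hJ.even_card_of_closed hB le_rfl fun _ _ => comp_subset

/-- A component of J that meets a component of I lies inside it, so the intersection is a union of
components of J. -/
theorem EvenSet.even_comp_inter (hB : IsBuildingSet S B) (hJ : EvenSet S B J) (hI : I ⊆ S)
    (hJI : J ⊆ I) : Even (comp B I x ∩ J).card := by
  refine hJ.even_card_of_closed hB Finset.inter_subset_right fun y hy => ?_
  rw [Finset.mem_inter] at hy
  refine Finset.subset_inter ?_ comp_subset
  rw [← hB.comp_eq hI hy.1]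
  exact comp_mono hJI

theorem EvenSet.even_comp_sdiff (hB : IsBuildingSet S B) (hJ : EvenSet S B J) (hI : EvenSet S B I)
    (hJI : J ⊆ I) (hx : x ∈ I) : Even (comp B I x \ J).card := by
  have h1 := hI.even x hx
  rw [← Finset.card_sdiff_add_card_inter (comp B I x) J, Nat.even_add] at h1
  exact h1.mpr (hJ.even_comp_inter hB hI.subset hJI)

/-- If two even sets differ by two elements, then these lie in the same component. -/
theorem EvenSet.sdiff_subset_comp (hB : IsBuildingSet S B) (hJ : EvenSet S B J)
    (hA : EvenSet S B A) (hJA : J ⊆ A) (hcard : (A \ J).card = 2) (hx : x ∈ A \ J) :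
    A \ J ⊆ comp B A x := by
  rw [Finset.mem_sdiff] at hx
  have h1 := hJ.even_comp_sdiff hB hA hJA hx.1
  have h2 : comp B A x \ J ⊆ A \ J := Finset.sdiff_subset_sdiff comp_subset le_rfl
  have h3 : 0 < (comp B A x \ J).card := Finset.card_pos.mpr
    ⟨x, Finset.mem_sdiff.mpr ⟨hB.self_mem_comp hA.subset hx.1, hx.2⟩⟩
  have h4 := Finset.eq_of_subset_of_card_le h2 (by
    obtain ⟨n, hn⟩ := h1
    omega)
  rw [← h4]
  exact Finset.sdiff_subset

theorem le_maxComp (hy : y ∈ comp B I x) : y ≤ maxComp B I x := Finset.le_sup (f := id) hy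

theorem maxComp_mono (h : J ⊆ I) : maxComp B J x ≤ maxComp B I x :=
  Finset.sup_mono (comp_mono h)

theorem IsBuildingSet.maxComp_mem (hB : IsBuildingSet S B) (hI : I ⊆ S) (hx : x ∈ I) :
    maxComp B I x ∈ comp B I x := by
  obtain ⟨y, hy, h⟩ := Finset.exists_mem_eq_sup _ ⟨x, hB.self_mem_comp hI hx⟩ id
  rw [maxComp, h]
  exact hy

theorem maxComp_le_topMax (hx : x ∈ I \ J) : maxComp B I x ≤ topMax B J I := Finset.le_sup hx

theorem exists_maxComp_eq_topMax (h : (I \ J).Nonempty) :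
    ∃ x ∈ I \ J, maxComp B I x = topMax B J I := by
  obtain ⟨x, hx, h⟩ := Finset.exists_mem_eq_sup _ h (maxComp B I)
  exact ⟨x, hx, h.symm⟩

theorem topMax_mono {K L : Finset ℕ} (hAI : A ⊆ I) (h : A \ K ⊆ I \ L) :
    topMax B K A ≤ topMax B L I :=
  Finset.sup_le fun _ hx => (maxComp_mono hAI).trans (maxComp_le_topMax (h hx))

/-- The component that contains `topMax B J I`. -/
theorem IsBuildingSet.exists_comp_topMax (hB : IsBuildingSet S B) (hI : I ⊆ S)
    (h : (I \ J).Nonempty) : ∃ x ∈ I \ J, comp B I x = comp B I (topMax B J I) ∧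
      topMax B J I ∈ comp B I x := by
  obtain ⟨x, hx, hxt⟩ := exists_maxComp_eq_topMax (B := B) h
  have := hB.maxComp_mem hI (Finset.mem_sdiff.mp hx).1
  rw [hxt] at this
  exact ⟨x, hx, (hB.comp_eq hI this).symm, this⟩

theorem IsBuildingSet.le_topMax (hB : IsBuildingSet S B) (hI : I ⊆ S) (h : (I \ J).Nonempty)
    (hy : y ∈ comp B I (topMax B J I)) : y ≤ topMax B J I := by
  obtain ⟨x, hx, h1, -⟩ := hB.exists_comp_topMax hI h
  rw [← h1] at hy
  exact (le_maxComp hy).trans (maxComp_le_topMax hx)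

theorem IsBuildingSet.maxComp_eq_topMax (hB : IsBuildingSet S B) (hI : I ⊆ S)
    (h : (I \ J).Nonempty) (hx : x ∈ comp B I (topMax B J I)) : maxComp B I x = topMax B J I := by
  refine le_antisymm (hB.le_topMax hI h ?_) (le_maxComp (mem_comp_comm.mp hx))
  rw [← hB.comp_eq hI hx]
  exact hB.maxComp_mem hI (comp_subset hx)

end Comp

theorem exists_top_two {U : Finset ℕ} (h : 2 ≤ U.card) :
    ∃ T ⊆ U, T.card = 2 ∧ ∀ x ∈ T, ∀ y ∈ U \ T, y < x := by
  have hU : U.Nonempty := Finset.card_pos.mp (by omega)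
  set b := U.max' hU with hb
  have hbU : b ∈ U := U.max'_mem hU
  have hU' : (U.erase b).Nonempty := Finset.card_pos.mp (by
    rw [Finset.card_erase_of_mem hbU]; omega)
  set a := (U.erase b).max' hU' with ha
  have haU : a ∈ U.erase b := Finset.max'_mem _ hU'
  refine ⟨{a, b}, ?_, Finset.card_pair (Finset.ne_of_mem_erase haU), ?_⟩
  · intro x hx
    rcases Finset.mem_insert.mp hx with rfl | hx
    · exact Finset.mem_of_mem_erase haU
    · rwa [Finset.mem_singleton.mp hx]
  · intro x hx y hy
    rw [Finset.mem_sdiff, Finset.mem_insert, Finset.mem_singleton, not_or] at hy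
    have h1 : y ≤ a := Finset.le_max' _ _ (Finset.mem_erase.mpr ⟨hy.2.2, hy.1⟩)
    have h2 : y ≤ b := Finset.le_max' _ _ hy.1
    rcases Finset.mem_insert.mp hx with rfl | hx
    · exact lt_of_le_of_ne h1 hy.2.1
    · rw [Finset.mem_singleton.mp hx]
      exact lt_of_le_of_ne h2 hy.2.2

theorem sum_lt_sum_of_top_two {T T' : Finset ℕ} (hT : T.card = 2) (hT' : T'.card = 2)
    (hne : T' ≠ T) (h : ∀ x ∈ T, ∀ y ∈ T' \ T, y < x) : T'.sum id < T.sum id := by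
  obtain ⟨a, b, hab, rfl⟩ := Finset.card_eq_two.mp hT
  obtain ⟨c, d, hcd, rfl⟩ := Finset.card_eq_two.mp hT'
  rw [Finset.sum_pair hab, Finset.sum_pair hcd]
  simp only [Finset.mem_sdiff, Finset.mem_insert, Finset.mem_singleton, not_or, id] at h ⊢
  have h1 := h a (Or.inl rfl) c
  have h2 := h a (Or.inl rfl) d
  have h3 := h b (Or.inr rfl) c
  have h4 := h b (Or.inr rfl) d
  have h5 : ¬ (c = a ∧ d = b) := by rintro ⟨rfl, rfl⟩; exact hne rfl
  have h6 : ¬ (c = b ∧ d = a) := by rintro ⟨rfl, rfl⟩; exact hne (Finset.pair_comm _ _)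
  by_cases hca : c = a <;> by_cases hcb : c = b <;> by_cases hda : d = a <;> by_cases hdb : d = b <;>
    simp_all <;> omega

/-! ### First atoms: existence, uniqueness, labels and locality. -/

section IsFirst

variable {S : Finset ℕ} {B : Finset (Finset ℕ)} {I J A : Finset ℕ} {x y : ℕ}

theorem IsFirst.nonempty (h : IsFirst B J A I) : (A \ J).Nonempty :=
  Finset.card_pos.mp (by rw [h.card]; omega)

theorem IsFirst.nonempty' (h : IsFirst B J A I) : (I \ J).Nonempty :=
  h.nonempty.mono (Finset.sdiff_subset_sdiff h.right le_rfl)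

/-- The new elements of a first atom are connected to the maximum of their component. -/
theorem IsFirst.topMax_mem_comp (hB : IsBuildingSet S B) (hc : IsChordal B) (hI : I ⊆ S)
    (h : IsFirst B J A I) (hx : x ∈ A \ J) : topMax B J I ∈ comp B A x := by
  have hxE := h.subset hx
  have hxI : x ∈ I := comp_subset hxE
  have hE : comp B I (topMax B J I) ∈ B := by
    obtain ⟨z, hz, h1, -⟩ := hB.exists_comp_topMax hI h.nonempty'
    rw [← h1]
    exact hB.comp_mem hI (Finset.mem_sdiff.mp hz).1
  -- Chordality puts the upper segment of the top component starting at x into B. It lies inside A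
  -- because elements of that component outside A are smaller than x.
  refine mem_comp.mpr ⟨_, hc _ hE x hxE, fun y hy => ?_, by simpa using hxE, ?_⟩
  · rw [Finset.mem_filter] at hy
    by_contra hyA
    exact absurd (h.lt x hx y (Finset.mem_sdiff.mpr ⟨hy.1, hyA⟩)) (not_lt.mpr hy.2)
  · rw [Finset.mem_filter]
    refine ⟨?_, hB.le_topMax hI h.nonempty' hxE⟩
    rw [← hB.comp_eq hI hxE]
    exact mem_comp_comm.mp hxE

theorem IsFirst.topMax_eq (hB : IsBuildingSet S B) (hc : IsChordal B) (hI : I ⊆ S)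
    (h : IsFirst B J A I) : topMax B J A = topMax B J I := by
  refine le_antisymm (topMax_mono h.right (Finset.sdiff_subset_sdiff h.right le_rfl)) ?_
  obtain ⟨x, hx⟩ := h.nonempty
  exact (le_maxComp (h.topMax_mem_comp hB hc hI hx)).trans (maxComp_le_topMax hx)

/-- Both new elements lie in the component of y, which thus consists of components of J and two
further elements. Every other component of A is already a component of J. -/
theorem EvenSet.of_sdiff_subset_comp (hB : IsBuildingSet S B) (hJ : EvenSet S B J) (hJA : J ⊆ A)
    (hAS : A ⊆ S) (hcard : (A \ J).card = 2) (ht : ∀ x ∈ A \ J, y ∈ comp B A x) :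
    EvenSet S B A := by
  refine ⟨hAS, fun x hx => ?_⟩
  by_cases hd : ∃ z ∈ comp B A x, z ∉ J
  · obtain ⟨z, hz, hzJ⟩ := hd
    have hzA : z ∈ A \ J := Finset.mem_sdiff.mpr ⟨comp_subset hz, hzJ⟩
    have hsub : A \ J ⊆ comp B A x := by
      intro w hw
      rw [← hB.comp_eq hAS hz, ← hB.comp_eq hAS (ht z hzA), hB.comp_eq hAS (ht w hw)]
      exact hB.self_mem_comp hAS (Finset.mem_sdiff.mp hw).1
    have heq : comp B A x \ J = A \ J :=
      (Finset.sdiff_subset_sdiff comp_subset le_rfl).antisymm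
        fun w hw => Finset.mem_sdiff.mpr ⟨hsub hw, (Finset.mem_sdiff.mp hw).2⟩
    rw [← Finset.card_sdiff_add_card_inter (comp B A x) J, heq, hcard]
    exact even_two.add (hJ.even_comp_inter hB hAS hJA)
  · push Not at hd
    have hxJ : x ∈ J := hd x (hB.self_mem_comp hAS hx)
    have : comp B A x = comp B J x :=
      (subset_comp (hB.comp_mem hAS hx) hd (hB.self_mem_comp hAS hx)).antisymm (comp_mono hJA)
    rw [this]
    exact hJ.even x hxJ

theorem IsFirst.evenSet (hB : IsBuildingSet S B) (hc : IsChordal B) (hI : I ⊆ S)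
    (hJ : EvenSet S B J) (h : IsFirst B J A I) : EvenSet S B A :=
  hJ.of_sdiff_subset_comp hB h.left (h.right.trans hI) h.card
    fun _ hx => h.topMax_mem_comp hB hc hI hx

/-- By parity the top component has an even, positive number of new elements, hence at least two to
choose from. -/
theorem exists_isFirst (hB : IsBuildingSet S B) (hJ : EvenSet S B J) (hI : EvenSet S B I)
    (hJI : J ⊂ I) : ∃ A, IsFirst B J A I := by
  have hne : (I \ J).Nonempty := Finset.sdiff_nonempty.mpr hJI.2
  obtain ⟨x, hx, h1, -⟩ := hB.exists_comp_topMax hI.subset hne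
  rw [Finset.mem_sdiff] at hx
  have h2 := hJ.even_comp_sdiff hB hI hJI.1 hx.1
  have h3 : 0 < (comp B I x \ J).card := Finset.card_pos.mpr
    ⟨x, Finset.mem_sdiff.mpr ⟨hB.self_mem_comp hI.subset hx.1, hx.2⟩⟩
  obtain ⟨T, hTU, hT, hlt⟩ := exists_top_two (U := comp B I x \ J) (by
    obtain ⟨n, hn⟩ := h2
    omega)
  have hAJ : (J ∪ T) \ J = T := by
    rw [Finset.union_sdiff_left, Finset.sdiff_eq_self_iff_disjoint]
    exact Finset.disjoint_left.mpr fun y hy => (Finset.mem_sdiff.mp (hTU hy)).2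
  refine ⟨J ∪ T, Finset.subset_union_left, Finset.union_subset hJI.1
    ((hTU.trans Finset.sdiff_subset).trans comp_subset), by rw [hAJ, hT], ?_, ?_⟩
  · rw [hAJ, ← h1]
    exact hTU.trans Finset.sdiff_subset
  · rw [hAJ, ← h1]
    intro y hy z hz
    rw [Finset.mem_sdiff, Finset.mem_union, not_or] at hz
    exact hlt y hy z (Finset.mem_sdiff.mpr ⟨Finset.mem_sdiff.mpr ⟨hz.1, hz.2.1⟩, hz.2.2⟩)

/-- The label encodes the pair (top maximum, element sum) lexicographically, as sums never exceed
`S.sum id`. A first atom reaches the top maximum of the whole interval; a competitor that also does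
so adds two elements of the same component, and these have a smaller sum. -/
theorem IsFirst.label_lt (hB : IsBuildingSet S B) (hc : IsChordal B) (hI : I ⊆ S)
    (hJ : EvenSet S B J) (h : IsFirst B J A I) {A' : Finset ℕ} (hA' : EvenSet S B A')
    (hJA' : J ⊆ A') (hA'I : A' ⊆ I) (hcard : (A' \ J).card = 2) (hne : A' ≠ A) :
    label S B J A' < label S B J A := by
  have hle : topMax B J A' ≤ topMax B J I :=
    topMax_mono hA'I (Finset.sdiff_subset_sdiff hA'I le_rfl)
  have hsum : A'.sum id ≤ S.sum id :=
    Finset.sum_le_sum_of_subset hA'.subset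
  rw [label, label, h.topMax_eq hB hc hI]
  rcases hle.lt_or_eq with hlt | heq
  · have : (topMax B J A' + 1) * (S.sum id + 1) ≤ topMax B J I * (S.sum id + 1) :=
      Nat.mul_le_mul_right _ hlt
    rw [add_mul, one_mul] at this
    omega
  · rw [heq]
    refine Nat.add_lt_add_left ?_ _
    have hne' : (A' \ J).Nonempty := Finset.card_pos.mp (by omega)
    have hsub : A' \ J ⊆ comp B I (topMax B J I) := by
      obtain ⟨x, hx, h1, h2⟩ := hB.exists_comp_topMax hA'.subset hne'
      rw [heq] at h2
      refine (hJ.sdiff_subset_comp hB hA' hJA' hcard hx).trans ((comp_mono hA'I).trans ?_)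
      rw [hB.comp_eq hI (comp_mono hA'I h2)]
    have hlt := sum_lt_sum_of_top_two (T := A \ J) (T' := A' \ J) h.card hcard (fun he => hne (by
      rw [← Finset.sdiff_union_of_subset hJA', he, Finset.sdiff_union_of_subset h.left]))
      fun x hx y hy => h.lt x hx y (by
        rw [Finset.mem_sdiff] at hy ⊢
        refine ⟨hsub hy.1, fun hyA => hy.2 (Finset.mem_sdiff.mpr ⟨hyA, ?_⟩)⟩
        exact (Finset.mem_sdiff.mp hy.1).2)
    rw [← Finset.sum_sdiff hJA', ← Finset.sum_sdiff h.left]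
    exact Nat.add_lt_add_right hlt _

theorem IsFirst.unique (hB : IsBuildingSet S B) (hc : IsChordal B) (hI : I ⊆ S)
    (hJ : EvenSet S B J) (h : IsFirst B J A I) {A' : Finset ℕ} (h' : IsFirst B J A' I) :
    A' = A := by
  by_contra hne
  have h1 := h.label_lt hB hc hI hJ (h'.evenSet hB hc hI hJ) h'.left h'.right h'.card hne
  have h2 := h'.label_lt hB hc hI hJ (h.evenSet hB hc hI hJ) h.left h.right h.card (Ne.symm hne)
  omega

/-- The top maximum is already attained in A, so it is the same for every set between A and I, while
the component containing it only shrinks. -/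
theorem IsFirst.mono (hB : IsBuildingSet S B) (hc : IsChordal B) (hI : I ⊆ S)
    (h : IsFirst B J A I) {I' : Finset ℕ} (hA : A ⊆ I') (hI' : I' ⊆ I) : IsFirst B J A I' := by
  have ht : topMax B J I' = topMax B J I := by
    refine le_antisymm (topMax_mono hI' (Finset.sdiff_subset_sdiff hI' le_rfl)) ?_
    rw [← h.topMax_eq hB hc hI]
    exact topMax_mono hA (Finset.sdiff_subset_sdiff hA le_rfl)
  refine ⟨h.left, hA, h.card, fun x hx => ?_, fun x hx y hy => h.lt x hx y ?_⟩
  · rw [ht]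
    exact mem_comp_comm.mp (comp_mono hA (h.topMax_mem_comp hB hc hI hx))
  · rw [ht] at hy
    exact Finset.sdiff_subset_sdiff (comp_mono hI') le_rfl hy

/-- A chain which is locally first is first. -/
theorem IsFirst.trans (hB : IsBuildingSet S B) (hc : IsChordal B) {I₀ I₁ I₂ I₃ : Finset ℕ}
    (h₀ : EvenSet S B I₀) (h₃ : EvenSet S B I₃) (h : IsFirst B I₀ I₁ I₂)
    (h' : IsFirst B I₁ I₂ I₃) : IsFirst B I₀ I₁ I₃ := by
  have h13 := h.right.trans h'.right
  have h03 := h.left.trans h13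
  have h2S := h'.right.trans h₃.subset
  have hne3 : (I₃ \ I₀).Nonempty := h.nonempty.mono (Finset.sdiff_subset_sdiff h13 le_rfl)
  set E := comp B I₃ (topMax B I₀ I₃) with hE
  by_cases hsub : E ⊆ I₁
  -- By parity E contains exactly two new elements, both added in the first step, so nothing remains
  -- to compare.
  · have h1 : E \ I₀ ⊆ I₁ \ I₀ := Finset.sdiff_subset_sdiff hsub le_rfl
    obtain ⟨x, hx, hxE, -⟩ := hB.exists_comp_topMax h₃.subset hne3
    rw [Finset.mem_sdiff] at hx
    have h2 := h₀.even_comp_sdiff hB h₃ h03 hx.1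
    rw [hxE, ← hE] at h2
    have h3 : 0 < (E \ I₀).card := Finset.card_pos.mpr ⟨x, Finset.mem_sdiff.mpr
      ⟨by rw [hE, ← hxE]; exact hB.self_mem_comp h₃.subset hx.1, hx.2⟩⟩
    have h4 := Finset.eq_of_subset_of_card_le h1 (by
      rw [h.card]
      obtain ⟨n, hn⟩ := h2
      omega)
    refine ⟨h.left, h13, h.card, ?_, fun x _ y hy => ?_⟩
    · rw [← h4]
      exact Finset.sdiff_subset
    · rw [Finset.mem_sdiff] at hy
      exact absurd (hsub hy.1) hy.2
  -- Here E still has new elements after the first step, so both steps draw from E. Elements of the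
  -- first step exceed those of the second, which exceed the rest of E.
  · obtain ⟨x, hxE, hx1⟩ := Finset.not_subset.mp hsub
    have ht : topMax B I₁ I₃ = topMax B I₀ I₃ := by
      refine le_antisymm (topMax_mono le_rfl (Finset.sdiff_subset_sdiff le_rfl h.left)) ?_
      rw [← hB.maxComp_eq_topMax h₃.subset hne3 hxE]
      exact maxComp_le_topMax (Finset.mem_sdiff.mpr ⟨comp_subset hxE, hx1⟩)
    have hmem : ∀ y ∈ I₂ \ I₁, topMax B I₀ I₃ ∈ comp B I₂ y := fun y hy => by
      rw [← ht]
      exact h'.topMax_mem_comp hB hc h₃.subset hy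
    have ht2 : topMax B I₀ I₂ = topMax B I₀ I₃ := by
      refine le_antisymm (topMax_mono h'.right (Finset.sdiff_subset_sdiff h'.right le_rfl)) ?_
      obtain ⟨y, hy⟩ := h'.nonempty
      exact (le_maxComp (hmem y hy)).trans
        (maxComp_le_topMax (Finset.sdiff_subset_sdiff le_rfl h.left hy))
    have key : ∀ x ∈ I₁ \ I₀, ∀ y ∈ I₂ \ I₁, y < x := fun x hx y hy => by
      refine h.lt x hx y (Finset.mem_sdiff.mpr ⟨?_, (Finset.mem_sdiff.mp hy).2⟩)
      rw [ht2]
      exact mem_comp_comm.mp (hmem y hy)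
    refine ⟨h.left, h13, h.card, ?_, fun x hx y hy => ?_⟩
    · refine h.subset.trans ?_
      rw [ht2]
      exact comp_mono h'.right
    · rw [Finset.mem_sdiff] at hy
      by_cases hy2 : y ∈ I₂
      · exact key x hx y (Finset.mem_sdiff.mpr ⟨hy2, hy.2⟩)
      · obtain ⟨z, hz⟩ := h'.nonempty
        refine (h'.lt z hz y ?_).trans (key x hx z hz)
        rw [ht]
        exact Finset.mem_sdiff.mpr ⟨hy.1, hy2⟩

end IsFirst

/-! Flags of even sets and the shelling of their order complex. -/

/-- A maximal chain `∅ = c 0 ⊂ c 1 ⊂ ⋯ ⊂ c k = S` of even sets, constant from `k` on. -/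
structure IsFlag (S : Finset ℕ) (B : Finset (Finset ℕ)) (k : ℕ) (c : ℕ → Finset ℕ) : Prop where
  zero : c 0 = ∅
  top : ∀ i, k ≤ i → c i = S
  even : ∀ i, EvenSet S B (c i)
  subset : ∀ i < k, c i ⊆ c (i + 1)
  card_sdiff : ∀ i < k, (c (i + 1) \ c i).card = 2

/-- The smallest member of `T` that properly contains `J`, or `S` if there is none, provided
that `T` is a chain. -/
def nxt (S : Finset ℕ) (T : Finset (Finset ℕ)) (J : Finset ℕ) : Finset ℕ :=
  S.filter fun x => ∀ I ∈ T, J ⊂ I → x ∈ I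

/-! ### Flags that are first between the members of a chain. -/

section Flag

variable {S : Finset ℕ} {B : Finset (Finset ℕ)} {k : ℕ} {c c' : ℕ → Finset ℕ}
  {T : Finset (Finset ℕ)} {I J : Finset ℕ}

theorem IsFlag.monotone (h : IsFlag S B k c) : Monotone c := by
  refine monotone_nat_of_le_succ fun i => ?_
  rcases lt_or_ge i k with hi | hi
  · exact h.subset i hi
  · rw [h.top i hi, h.top (i + 1) (by omega)]

theorem IsFlag.card (h : IsFlag S B k c) {i : ℕ} (hi : i ≤ k) : (c i).card = 2 * i := by
  induction i with
  | zero => simp [h.zero]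
  | succ i ih =>
    rw [← Finset.card_sdiff_add_card_eq_card (h.subset i hi), h.card_sdiff i hi, ih (by omega)]
    ring

theorem IsFlag.lt_of_ssubset (h : IsFlag S B k c) {i j : ℕ} (hij : c i ⊂ c j) : i < j := by
  by_contra hle
  exact hij.2 (h.monotone (not_lt.mp hle))

theorem IsFlag.ssubset (h : IsFlag S B k c) {i j : ℕ} (hij : i < j) (hi : i < k) : c i ⊂ c j := by
  refine ssubset_of_ssubset_of_subset ?_ (h.monotone hij)
  refine Finset.ssubset_iff_subset_ne.mpr ⟨h.subset i hi, fun he => ?_⟩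
  have := h.card_sdiff i hi
  rw [← he] at this
  simp at this

theorem nxt_subset_left : nxt S T J ⊆ S := Finset.filter_subset _ _

theorem nxt_subset (hI : I ∈ T) (hJI : J ⊂ I) : nxt S T J ⊆ I :=
  fun _ hx => (Finset.mem_filter.mp hx).2 I hI hJI

theorem nxt_spec (hT : ∀ I ∈ T, I ⊆ S) (hchain : ∀ I ∈ T, ∀ I' ∈ T, I ⊆ I' ∨ I' ⊆ I)
    (hJ : J ⊂ S) : J ⊂ nxt S T J ∧ (nxt S T J = S ∨ nxt S T J ∈ T) := by
  rcases (T.filter fun I => J ⊂ I).eq_empty_or_nonempty with he | hne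
  · have h : nxt S T J = S := by
      refine nxt_subset_left.antisymm fun x hx => Finset.mem_filter.mpr ⟨hx, fun I hI hJI => ?_⟩
      exact absurd hJI (Finset.filter_eq_empty_iff.mp he hI)
    rw [h]
    exact ⟨hJ, Or.inl rfl⟩
  · obtain ⟨M, hM⟩ := Finset.exists_minimal hne
    have hM1 := Finset.mem_filter.mp hM.1
    have h : nxt S T J = M := by
      refine (nxt_subset hM1.1 hM1.2).antisymm fun x hx =>
        Finset.mem_filter.mpr ⟨hT M hM1.1 hx, fun I hI hJI => ?_⟩
      rcases hchain M hM1.1 I hI with h | h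
      · exact h hx
      · exact hM.2 (Finset.mem_filter.mpr ⟨hI, hJI⟩) h hx
    rw [h]
    exact ⟨hM1.2, Or.inr hM1.1⟩

/-- Every chain of even sets is contained in a flag that is first between its members. -/
theorem exists_isFlag_first (hB : IsBuildingSet S B) (hc : IsChordal B) (hS : EvenSet S B S)
    (hk : S.card = 2 * k) (hT : ∀ I ∈ T, EvenSet S B I)
    (hchain : ∀ I ∈ T, ∀ I' ∈ T, I ⊆ I' ∨ I' ⊆ I) :
    ∃ c, IsFlag S B k c ∧ (∀ i < k, IsFirst B (c i) (c (i + 1)) (nxt S T (c i))) ∧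
      ∀ I ∈ T, ∃ i, c i = I := by
  classical
  -- The default value J takes effect at S, where no first atom exists, and makes the sequence
  -- constant from there on.
  let next : Finset ℕ → Finset ℕ := fun J =>
    if h : ∃ A, IsFirst B J A (nxt S T J) then h.choose else J
  let c : ℕ → Finset ℕ := fun n => next^[n] ∅
  have hcs : ∀ n, c (n + 1) = next (c n) := fun n => Function.iterate_succ_apply' _ _ _
  have hstep : ∀ J, EvenSet S B J → J ⊂ S → IsFirst B J (next J) (nxt S T J) ∧
      EvenSet S B (nxt S T J) := by
    intro J hJ hJS
    obtain ⟨h1, h2⟩ := nxt_spec (fun I hI => (hT I hI).subset) hchain hJS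
    have h3 : EvenSet S B (nxt S T J) := by
      rcases h2 with h2 | h2
      · rwa [h2]
      · exact hT _ h2
    have h4 := exists_isFirst hB hJ h3 h1
    refine ⟨?_, h3⟩
    simp only [next, dif_pos h4]
    exact h4.choose_spec
  have hssub : ∀ i, i < k → (c i).card = 2 * i → EvenSet S B (c i) → c i ⊂ S := by
    intro i hi hci he
    refine Finset.ssubset_iff_subset_ne.mpr ⟨he.subset, fun h => ?_⟩
    rw [h, hk] at hci
    omega
  -- Each step goes no further than the next member of T, so the sequence remains comparable with T.
  have hinv : ∀ i ≤ k, EvenSet S B (c i) ∧ (c i).card = 2 * i ∧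
      ∀ I ∈ T, I ⊆ c i ∨ c i ⊆ I := by
    intro i
    induction i with
    | zero => exact fun _ => ⟨⟨by simp [c], by simp [c]⟩, by simp [c], by simp [c]⟩
    | succ i ih =>
      intro hi
      obtain ⟨h1, h2, h3⟩ := ih (by omega)
      obtain ⟨h4, h5⟩ := hstep (c i) h1 (hssub i hi h2 h1)
      rw [hcs]
      refine ⟨h4.evenSet hB hc h5.subset h1, ?_, fun I hI => ?_⟩
      · rw [← Finset.card_sdiff_add_card_eq_card h4.left, h4.card, h2]
        ring
      · rcases h3 I hI with h | h
        · exact Or.inl (h.trans h4.left)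
        · by_cases h' : I ⊆ c i
          · exact Or.inl (h'.trans h4.left)
          · exact Or.inr (h4.right.trans (nxt_subset hI ⟨h, h'⟩))
  have hfirst : ∀ i < k, IsFirst B (c i) (c (i + 1)) (nxt S T (c i)) := by
    intro i hi
    obtain ⟨h1, h2, -⟩ := hinv i hi.le
    rw [hcs]
    exact (hstep (c i) h1 (hssub i hi h2 h1)).1
  have htop : ∀ i, k ≤ i → c i = S := by
    refine Nat.le_induction ?_ fun i _ ih => ?_
    · obtain ⟨h1, h2, -⟩ := hinv k le_rfl
      exact Finset.eq_of_subset_of_card_le h1.subset (by rw [h2, hk])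
    · have : ¬ ∃ A, IsFirst B S A (nxt S T S) := by
        rintro ⟨A, hA⟩
        have := hA.card
        rw [Finset.sdiff_eq_empty_iff_subset.mpr (hA.right.trans nxt_subset_left)] at this
        simp at this
      rw [hcs, ih]
      simp only [next, dif_neg this]
  refine ⟨c, ⟨rfl, htop, fun i => ?_, fun i hi => (hfirst i hi).left,
    fun i hi => (hfirst i hi).card⟩, hfirst, fun I hI => ?_⟩
  · rcases le_total i k with hi | hi
    · exact (hinv i hi).1
    · rwa [htop i hi]
  -- A member of T with 2 n elements is comparable with c n, which has the same cardinality.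
  · obtain ⟨n, hn⟩ := (hT I hI).even_card hB
    have hle := Finset.card_le_card (hT I hI).subset
    obtain ⟨-, h2, h3⟩ := hinv n (by omega)
    refine ⟨n, ?_⟩
    rcases h3 I hI with h | h
    · exact (Finset.eq_of_subset_of_card_le h (by omega)).symm
    · exact Finset.eq_of_subset_of_card_le h (by omega)

theorem IsFlag.subset_nxt (h : IsFlag S B k c) (hT : ∀ I ∈ T, ∃ i, c i = I) (i : ℕ) :
    c (i + 1) ⊆ nxt S T (c i) := by
  refine fun x hx => Finset.mem_filter.mpr ⟨(h.even _).subset hx, fun I hI hI' => ?_⟩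
  obtain ⟨j, rfl⟩ := hT I hI
  exact h.monotone (h.lt_of_ssubset hI') hx

/-- Where a flag that is first between the members of `T` is not locally first, it has a member
of `T`. -/
theorem IsFlag.mem_of_not_isFirst (hB : IsBuildingSet S B) (hc : IsChordal B)
    (h : IsFlag S B k c) (hT : ∀ I ∈ T, ∃ i, c i = I)
    (hf : ∀ i < k, IsFirst B (c i) (c (i + 1)) (nxt S T (c i))) {j : ℕ} (hj : j < k)
    (hn : ¬ IsFirst B (c j) (c (j + 1)) (c (j + 2))) : c (j + 1) ∈ T := by
  by_contra hmem
  refine hn ((hf j hj).mono hB hc nxt_subset_left (h.monotone (Nat.le_succ _)) ?_)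
  refine fun x hx => Finset.mem_filter.mpr ⟨(h.even _).subset hx, fun I hI hI' => ?_⟩
  obtain ⟨m, rfl⟩ := hT I hI
  have hm := h.lt_of_ssubset hI'
  have : m ≠ j + 1 := by
    rintro rfl
    exact hmem hI
  exact h.monotone (show j + 2 ≤ m by omega) hx

/-- The converse of `IsFlag.mem_of_not_isFirst`. -/
theorem IsFlag.isFirst_nxt (hB : IsBuildingSet S B) (hc : IsChordal B)
    (h : IsFlag S B k c) (hT : ∀ I ∈ T, ∃ i, c i = I)
    (hf : ∀ j, j + 1 < k → ¬ IsFirst B (c j) (c (j + 1)) (c (j + 2)) → c (j + 1) ∈ T) :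
    ∀ i < k, IsFirst B (c i) (c (i + 1)) (nxt S T (c i)) := by
  intro i hi
  have hchain : ∀ I ∈ T, ∀ I' ∈ T, I ⊆ I' ∨ I' ⊆ I := by
    intro I hI I' hI'
    obtain ⟨a, rfl⟩ := hT I hI
    obtain ⟨b, rfl⟩ := hT I' hI'
    exact (le_total a b).imp (fun h' => h.monotone h') fun h' => h.monotone h'
  have hsub : ∀ I ∈ T, I ⊆ S := by
    intro I hI
    obtain ⟨a, rfl⟩ := hT I hI
    exact (h.even a).subset
  have hiS : c i ⊂ S := by
    have := h.ssubset (j := k) hi hi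
    rwa [h.top k le_rfl] at this
  obtain ⟨h1, h2⟩ := nxt_spec hsub hchain hiS
  obtain ⟨m, hmk, hm⟩ : ∃ m ≤ k, c m = nxt S T (c i) := by
    rcases h2 with h2 | h2
    · exact ⟨k, le_rfl, by rw [h2, h.top k le_rfl]⟩
    · obtain ⟨m, hm⟩ := hT _ h2
      rcases le_total m k with hmk | hmk
      · exact ⟨m, hmk, hm⟩
      · exact ⟨k, le_rfl, by rw [← hm, h.top m hmk, h.top k le_rfl]⟩
  rw [← hm] at h1
  have him := h.lt_of_ssubset h1
  rw [← hm]
  -- Going down from the next member c m of T, local firstness is extended by `IsFirst.trans`; no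
  -- member of T lies strictly between, so every intermediate step is locally first.
  have key : ∀ d j, j + d + 1 = m → i ≤ j → IsFirst B (c j) (c (j + 1)) (c m) := by
    intro d
    induction d with
    | zero =>
      intro j hj _
      have hcard := h.card_sdiff j (by omega)
      have hjm : j + 1 = m := by omega
      subst hjm
      have hne : (c (j + 1) \ c j).Nonempty := Finset.card_pos.mp (by omega)
      refine ⟨h.monotone (Nat.le_succ _), le_rfl, hcard, ?_, fun x _ y hy => ?_⟩
      · obtain ⟨x, hx, h3, -⟩ := hB.exists_comp_topMax (h.even (j + 1)).subset hne
        rw [← h3]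
        exact (h.even j).sdiff_subset_comp hB (h.even (j + 1)) (h.monotone (Nat.le_succ _)) hcard hx
      · rw [Finset.mem_sdiff] at hy
        exact absurd (comp_subset hy.1) hy.2
    | succ d ih =>
      intro j hj hij
      have h3 : IsFirst B (c j) (c (j + 1)) (c (j + 2)) := by
        by_contra hn
        have h4 := hf j (by omega) hn
        have h5 := nxt_subset (S := S) h4 (h.ssubset (show i < j + 1 by omega) hi)
        rw [← hm] at h5
        exact (h.ssubset (show j + 1 < m by omega) (by omega)).2 h5
      exact h3.trans hB hc (h.even _) (h.even _) (ih (j + 1) (by omega) (by omega))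
  exact key (m - i - 1) i (by omega) le_rfl

theorem IsFlag.eq_of_isFirst (hB : IsBuildingSet S B) (hc : IsChordal B)
    (h : IsFlag S B k c) (h' : IsFlag S B k c')
    (hf : ∀ i < k, IsFirst B (c i) (c (i + 1)) (nxt S T (c i)))
    (hf' : ∀ i < k, IsFirst B (c' i) (c' (i + 1)) (nxt S T (c' i))) : c = c' := by
  funext i
  induction i with
  | zero => rw [h.zero, h'.zero]
  | succ i ih =>
    rcases lt_or_ge i k with hi | hi
    · have h1 := hf' i hi
      rw [← ih] at h1
      exact h1.unique hB hc nxt_subset_left (h.even i) (hf i hi)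
    · rw [h.top _ (by omega), h'.top _ (by omega)]

/-- The flag that is first between the members of `T` has the largest sequence of labels. -/
theorem IsFlag.eq_or_label_lt (hB : IsBuildingSet S B) (hc : IsChordal B)
    (h : IsFlag S B k c) (hT : ∀ I ∈ T, ∃ i, c i = I) (h' : IsFlag S B k c')
    (hf' : ∀ i < k, IsFirst B (c' i) (c' (i + 1)) (nxt S T (c' i))) :
    c' = c ∨ ∃ i < k, (∀ j ≤ i, c j = c' j) ∧
      label S B (c i) (c (i + 1)) < label S B (c' i) (c' (i + 1)) := by
  classical
  by_cases hne : ∃ i, c i ≠ c' i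
  · right
    have hmin : ∀ j < Nat.find hne, c j = c' j := fun j hj => not_not.mp (Nat.find_min hne hj)
    have hspec := Nat.find_spec hne
    obtain ⟨n, hn⟩ : ∃ n, Nat.find hne = n + 1 := by
      refine Nat.exists_eq_succ_of_ne_zero fun h0 => ?_
      rw [h0, h.zero, h'.zero] at hspec
      exact hspec rfl
    rw [hn] at hmin hspec
    have hnk : n < k := by
      by_contra hle
      rw [h.top _ (by omega), h'.top _ (by omega)] at hspec
      exact hspec rfl
    refine ⟨n, hnk, fun j hj => hmin j (by omega), ?_⟩
    have h1 := hf' n hnk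
    rw [← hmin n (by omega)] at h1 ⊢
    exact h1.label_lt hB hc nxt_subset_left (h.even n) (h.even (n + 1)) (h.subset n hnk)
      (h.subset_nxt hT n) (h.card_sdiff n hnk) hspec
  · push Not at hne
    exact Or.inl (funext fun i => (hne i).symm)

end Flag

theorem IsBuildingSet.evenSet_iff {S : Finset ℕ} {B : Finset (Finset ℕ)} (hB : IsBuildingSet S B)
    {I : Finset ℕ} : EvenSet S B I ↔ I ⊆ S ∧ NoOddComponent (restrictTo B I) :=
  ⟨fun h => ⟨h.subset, (hB.noOddComponent_iff h.subset).mpr h.even⟩,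
    fun h => ⟨h.1, (hB.noOddComponent_iff h.1).mp h.2⟩⟩

theorem IsBuildingSet.mem_evenPoset {S : Finset ℕ} {B : Finset (Finset ℕ)} (hB : IsBuildingSet S B)
    {I : Finset ℕ} : I ∈ evenPoset S B ↔ EvenSet S B I ∧ I ≠ ∅ ∧ I ≠ S := by
  simp [evenPoset, evenPosetHat, hB.evenSet_iff]

theorem IsBuildingSet.evenSet_self {S : Finset ℕ} {B : Finset (Finset ℕ)} (hB : IsBuildingSet S B)
    (h : NoOddComponent B) : EvenSet S B S := by
  rw [hB.evenSet_iff, restrictTo, Finset.filter_true_of_mem hB.subset]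
  exact ⟨le_rfl, h⟩

/-! ### The shelling of the order complex. -/

section Facet

variable {S : Finset ℕ} {B : Finset (Finset ℕ)} {k : ℕ} {c c' : ℕ → Finset ℕ}

open Classical in
/-- The proper members of a flag. -/
noncomputable def facet (S : Finset ℕ) (B : Finset (Finset ℕ)) (c : ℕ → Finset ℕ) :
    Finset (evenPoset S B) :=
  Finset.univ.filter fun I => ∃ i, c i = I

open Classical in
/-- The facets of the order complex of the poset of even sets. -/
noncomputable def facets (S : Finset ℕ) (B : Finset (Finset ℕ)) (k : ℕ) :
    Finset (Finset (evenPoset S B)) :=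
  Finset.univ.filter fun F => ∃ c, IsFlag S B k c ∧ facet S B c = F

open Classical in
/-- The flag of a facet. -/
noncomputable def flag (S : Finset ℕ) (B : Finset (Finset ℕ)) (k : ℕ)
    (F : Finset (evenPoset S B)) : ℕ → Finset ℕ :=
  if h : ∃ c, IsFlag S B k c ∧ facet S B c = F then h.choose else fun _ => ∅

open Classical in
/-- The members of a facet where its flag is not locally first. -/
noncomputable def restriction (S : Finset ℕ) (B : Finset (Finset ℕ)) (k : ℕ)
    (F : Finset (evenPoset S B)) : Finset (evenPoset S B) :=
  Finset.univ.filter fun I => ∃ j, j + 1 < k ∧ flag S B k F (j + 1) = I ∧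
    ¬ IsFirst B (flag S B k F j) (flag S B k F (j + 1)) (flag S B k F (j + 2))

/-- The sequence of labels of a flag. -/
noncomputable def labels (S : Finset ℕ) (B : Finset (Finset ℕ)) (k : ℕ)
    (F : Finset (evenPoset S B)) : Lex (Fin k → ℕ) :=
  toLex fun i => label S B (flag S B k F i) (flag S B k F (i + 1))

open Classical in
/-- The position of a facet when the facets are listed with decreasing sequences of labels. -/
noncomputable def position (S : Finset ℕ) (B : Finset (Finset ℕ)) (k : ℕ)
    (F : Finset (evenPoset S B)) : ℕ :=
  ((facets S B k).filter fun G => labels S B k F < labels S B k G).card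

theorem mem_facet {I : evenPoset S B} : I ∈ facet S B c ↔ ∃ i, c i = I := by
  simp [facet]

theorem mem_facets {F : Finset (evenPoset S B)} :
    F ∈ facets S B k ↔ ∃ c, IsFlag S B k c ∧ facet S B c = F := by
  simp [facets]

theorem mem_restriction {F : Finset (evenPoset S B)} {I : evenPoset S B} :
    I ∈ restriction S B k F ↔ ∃ j, j + 1 < k ∧ flag S B k F (j + 1) = I ∧
      ¬ IsFirst B (flag S B k F j) (flag S B k F (j + 1)) (flag S B k F (j + 2)) := by
  simp [restriction]

theorem IsFlag.mem_evenPoset (hB : IsBuildingSet S B) (h : IsFlag S B k c) {i : ℕ} (hi : 0 < i)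
    (hik : i < k) : c i ∈ evenPoset S B := by
  refine hB.mem_evenPoset.mpr ⟨h.even i, ?_, ?_⟩
  · rw [← h.zero]
    exact (h.ssubset hi (by omega)).ne'
  · rw [← h.top k le_rfl]
    exact (h.ssubset hik hik).ne

theorem IsFlag.eq_of_apply_eq (h : IsFlag S B k c) (h' : IsFlag S B k c') {i j : ℕ}
    (hi : i < k) (hij : c i = c' j) : i = j := by
  have h1 := h.card hi.le
  rw [hij] at h1
  rcases le_total j k with hj | hj
  · rw [h'.card hj] at h1
    omega
  · rw [h'.top j hj, ← h'.top k le_rfl, h'.card le_rfl] at h1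
    omega

theorem IsFlag.eq_of_facet_eq (hB : IsBuildingSet S B) (h : IsFlag S B k c)
    (h' : IsFlag S B k c') (he : facet S B c = facet S B c') : c = c' := by
  funext i
  rcases Nat.eq_zero_or_pos i with rfl | hi
  · rw [h.zero, h'.zero]
  rcases lt_or_ge i k with hik | hik
  · have h1 : (⟨c i, h.mem_evenPoset hB hi hik⟩ : evenPoset S B) ∈ facet S B c :=
      mem_facet.mpr ⟨i, rfl⟩
    rw [he, mem_facet] at h1
    obtain ⟨j, hj⟩ := h1
    have hj : c i = c' j := hj.symm
    rw [hj, h.eq_of_apply_eq h' hik hj]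
  · rw [h.top i hik, h'.top i hik]

theorem IsFlag.flag_facet (hB : IsBuildingSet S B) (h : IsFlag S B k c) :
    flag S B k (facet S B c) = c := by
  have hex : ∃ c', IsFlag S B k c' ∧ facet S B c' = facet S B c := ⟨c, h, rfl⟩
  rw [flag, dif_pos hex]
  exact hex.choose_spec.1.eq_of_facet_eq hB h hex.choose_spec.2

theorem IsFlag.facet_mem (h : IsFlag S B k c) : facet S B c ∈ facets S B k :=
  mem_facets.mpr ⟨c, h, rfl⟩

theorem IsFlag.card_facet (hB : IsBuildingSet S B) (h : IsFlag S B k c) :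
    (facet S B c).card = k - 1 := by
  rw [← Nat.card_Ioo 0 k |>.trans (by omega : k - 0 - 1 = k - 1)]
  symm
  refine Finset.card_bij (fun i hi => ⟨c i, h.mem_evenPoset hB (Finset.mem_Ioo.mp hi).1
    (Finset.mem_Ioo.mp hi).2⟩) (fun i hi => mem_facet.mpr ⟨i, rfl⟩) ?_ ?_
  · intro i hi j hj hij
    exact h.eq_of_apply_eq h (Finset.mem_Ioo.mp hi).2 (congrArg Subtype.val hij)
  · intro I hI
    obtain ⟨i, hi⟩ := mem_facet.mp hI
    have hI' := (hB.mem_evenPoset.mp I.2).2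
    have h0 : i ≠ 0 := by
      rintro rfl
      exact hI'.1 (by rw [← hi, h.zero])
    have hk : i < k := by
      by_contra hle
      exact hI'.2 (by rw [← hi, h.top i (by omega)])
    exact ⟨i, Finset.mem_Ioo.mpr ⟨by omega, hk⟩, Subtype.ext hi⟩

theorem restriction_eq_iff (hB : IsBuildingSet S B) (h : IsFlag S B k c) :
    restriction S B k (facet S B c) = facet S B c ↔
      ∀ j, j + 1 < k → ¬ IsFirst B (c j) (c (j + 1)) (c (j + 2)) := by
  constructor
  · intro he j hj
    have h1 : (⟨c (j + 1), h.mem_evenPoset hB (by omega) hj⟩ : evenPoset S B) ∈ facet S B c :=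
      mem_facet.mpr ⟨j + 1, rfl⟩
    rw [← he, mem_restriction, h.flag_facet hB] at h1
    obtain ⟨i, hi, hij, hn⟩ := h1
    have := h.eq_of_apply_eq h hi hij
    rwa [show i = j by omega] at hn
  · intro hn
    ext I
    rw [mem_restriction, h.flag_facet hB, mem_facet]
    constructor
    · rintro ⟨j, -, hj, -⟩
      exact ⟨j + 1, hj⟩
    · rintro ⟨i, hi⟩
      have hI' := (hB.mem_evenPoset.mp I.2).2
      have hk : i < k := by
        by_contra hle
        exact hI'.2 (by rw [← hi, h.top i (by omega)])
      obtain ⟨j, rfl⟩ : ∃ j, i = j + 1 := by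
        refine Nat.exists_eq_succ_of_ne_zero ?_
        rintro rfl
        exact hI'.1 (by rw [← hi, h.zero])
      exact ⟨j, hk, hi, hn j hk⟩

theorem exists_isFlag_of_isChain (hB : IsBuildingSet S B) (hc : IsChordal B) (hS : EvenSet S B S)
    (hk : S.card = 2 * k) {τ : Finset (evenPoset S B)}
    (hτ : IsChain (· ≤ ·) (τ : Set (evenPoset S B))) :
    ∃ c, IsFlag S B k c ∧
      (∀ i < k, IsFirst B (c i) (c (i + 1)) (nxt S (τ.image Subtype.val) (c i))) ∧
      ∀ I ∈ τ.image Subtype.val, ∃ i, c i = I := by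
  refine exists_isFlag_first hB hc hS hk ?_ ?_
  · intro I hI
    obtain ⟨x, -, rfl⟩ := Finset.mem_image.mp hI
    exact (hB.mem_evenPoset.mp x.2).1
  · intro I hI I' hI'
    obtain ⟨x, hx, rfl⟩ := Finset.mem_image.mp hI
    obtain ⟨y, hy, rfl⟩ := Finset.mem_image.mp hI'
    rcases hτ.total hx hy with h | h
    · exact Or.inl h
    · exact Or.inr h

theorem image_mem_iff {τ : Finset (evenPoset S B)} :
    (∀ I ∈ τ.image Subtype.val, ∃ i, c i = I) ↔ τ ⊆ facet S B c := by
  constructor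
  · exact fun h I hI => mem_facet.mpr (h _ (Finset.mem_image_of_mem _ hI))
  · intro h I hI
    obtain ⟨x, hx, rfl⟩ := Finset.mem_image.mp hI
    exact mem_facet.mp (h hx)

theorem IsFlag.isChain_facet (h : IsFlag S B k c) {τ : Finset (evenPoset S B)}
    (hτ : τ ⊆ facet S B c) : IsChain (· ≤ ·) (τ : Set (evenPoset S B)) := by
  intro I hI J hJ _
  obtain ⟨i, hi⟩ := mem_facet.mp (hτ hI)
  obtain ⟨j, hj⟩ := mem_facet.mp (hτ hJ)
  rcases le_total i j with hij | hij
  · exact Or.inl (show I.1 ⊆ J.1 by rw [← hi, ← hj]; exact h.monotone hij)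
  · exact Or.inr (show J.1 ⊆ I.1 by rw [← hi, ← hj]; exact h.monotone hij)

theorem IsFlag.isFirst_of_restriction_subset (hB : IsBuildingSet S B) (hc : IsChordal B)
    (h : IsFlag S B k c) {τ : Finset (evenPoset S B)} (hτ : τ ⊆ facet S B c)
    (hR : restriction S B k (facet S B c) ⊆ τ) :
    ∀ i < k, IsFirst B (c i) (c (i + 1)) (nxt S (τ.image Subtype.val) (c i)) := by
  refine h.isFirst_nxt hB hc (image_mem_iff.mpr hτ) fun j hj hn => ?_
  have hmem := h.mem_evenPoset hB (i := j + 1) (by omega) hj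
  refine Finset.mem_image.mpr ⟨⟨_, hmem⟩, hR (mem_restriction.mpr ⟨j, hj, ?_⟩), rfl⟩
  rw [h.flag_facet hB]
  exact ⟨rfl, hn⟩

/-- The label sequences agree before i, as the flags agree up to i, and differ at i. Larger
sequences come earlier, so every facet ahead of the second flag is also ahead of the first. -/
theorem position_lt (hB : IsBuildingSet S B) (h : IsFlag S B k c) (h' : IsFlag S B k c') {i : ℕ}
    (hi : i < k) (heq : ∀ j ≤ i, c j = c' j)
    (hlt : label S B (c i) (c (i + 1)) < label S B (c' i) (c' (i + 1))) :
    position S B k (facet S B c') < position S B k (facet S B c) := by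
  classical
  have key : labels S B k (facet S B c) < labels S B k (facet S B c') := by
    rw [labels, labels, h.flag_facet hB, h'.flag_facet hB]
    refine ⟨⟨i, hi⟩, fun j hj => ?_, hlt⟩
    have hj' : (j : ℕ) < i := hj
    change label S B (c j) (c (j + 1)) = label S B (c' j) (c' (j + 1))
    rw [heq j (by omega), heq (j + 1) (by omega)]
  refine Finset.card_lt_card (Finset.ssubset_iff_of_subset ?_ |>.mpr ⟨facet S B c', ?_, ?_⟩)
  · intro G hG
    rw [Finset.mem_filter] at hG ⊢
    exact ⟨hG.1, key.trans hG.2⟩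
  · exact Finset.mem_filter.mpr ⟨h'.facet_mem, key⟩
  · exact fun hG => lt_irrefl _ (Finset.mem_filter.mp hG).2

/-- A face belongs to the flag that is first between its members. Its non-first places must lie in
the face, which gives the lower end of the interval; the greedy choice of first atoms makes the flag
unique and its labels largest. -/
theorem shelling_facets (hB : IsBuildingSet S B) (hc : IsChordal B) (hS : EvenSet S B S)
    (hk : S.card = 2 * k) :
    Shelling (facets S B k) (restriction S B k) (position S B k) where
  restrict_subset := by
    intro F hF I hI
    obtain ⟨c, h, rfl⟩ := mem_facets.mp hF
    obtain ⟨j, -, hj, -⟩ := mem_restriction.mp hI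
    rw [h.flag_facet hB] at hj
    exact mem_facet.mpr ⟨_, hj⟩
  unique := by
    intro F hF G hG τ hRF hτF hRG hτG
    obtain ⟨c, h, rfl⟩ := mem_facets.mp hF
    obtain ⟨c', h', rfl⟩ := mem_facets.mp hG
    rw [h.eq_of_isFirst hB hc h' (h.isFirst_of_restriction_subset hB hc hτF hRF)
      (h'.isFirst_of_restriction_subset hB hc hτG hRG)]
  exists_le := by
    intro F hF τ hτ
    obtain ⟨c, h, rfl⟩ := mem_facets.mp hF
    obtain ⟨c', h', hf, hT⟩ := exists_isFlag_of_isChain hB hc hS hk (h.isChain_facet hτ)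
    refine ⟨facet S B c', h'.facet_mem, fun I hI => ?_, image_mem_iff.mp hT, ?_⟩
    · obtain ⟨j, hjk, hj, hn⟩ := mem_restriction.mp hI
      rw [h'.flag_facet hB] at hj hn
      have := h'.mem_of_not_isFirst hB hc hT hf (by omega) hn
      rw [hj] at this
      obtain ⟨x, hx, hxI⟩ := Finset.mem_image.mp this
      rwa [← Subtype.ext hxI]
    · rcases h.eq_or_label_lt hB hc (image_mem_iff.mpr hτ) h' hf with heq | ⟨i, hi, heq, hlt⟩
      · exact Or.inl (by rw [heq])
      · exact Or.inr (position_lt hB h h' hi heq hlt)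

theorem nonempty_facets (hB : IsBuildingSet S B) (hc : IsChordal B) (hS : EvenSet S B S)
    (hk : S.card = 2 * k) : (facets S B k).Nonempty := by
  obtain ⟨c, h, -⟩ := exists_isFlag_of_isChain hB hc hS hk (τ := ∅) (by simp)
  exact ⟨_, h.facet_mem⟩

theorem realization_eq_polyhedron (hB : IsBuildingSet S B) (hc : IsChordal B) (hS : EvenSet S B S)
    (hk : S.card = 2 * k) :
    {w : evenPoset S B → ℝ | w ∈ stdSimplex ℝ (evenPoset S B) ∧
      Finset.univ.filter (fun a => w a ≠ 0) ∈ (orderComplex (evenPoset S B)).faces} =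
      polyhedron (facets S B k) := by
  ext w
  constructor
  · rintro ⟨hw, -, hchain⟩
    obtain ⟨c, h, -, hT⟩ := exists_isFlag_of_isChain hB hc hS hk hchain
    refine ⟨hw, facet S B c, h.facet_mem, fun a ha => ?_⟩
    by_contra hne
    exact ha (image_mem_iff.mp hT (by simpa using hne))
  · rintro ⟨hw, F, hF, hF0⟩
    obtain ⟨c, h, rfl⟩ := mem_facets.mp hF
    refine ⟨hw, ?_, h.isChain_facet fun a ha => ?_⟩
    · by_contra hne
      rw [Finset.not_nonempty_iff_eq_empty, Finset.filter_eq_empty_iff] at hne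
      have h1 := hw.2
      rw [Finset.sum_eq_zero fun a _ => not_not.mp (hne (Finset.mem_univ a))] at h1
      exact zero_ne_one h1
    · by_contra hne
      exact (Finset.mem_filter.mp ha).2 (hF0 a hne)

end Facet

/-! Alternating `B`-permutations and the facets equal to their restrictions. -/

/-! ### Flags that are nowhere locally first. -/

section Falling

variable {S : Finset ℕ} {B : Finset (Finset ℕ)} {I J A : Finset ℕ} {k : ℕ} {c : ℕ → Finset ℕ}

/-- The new elements of a cover relation are connected to its top maximum. -/
theorem EvenSet.topMax_mem_comp (hB : IsBuildingSet S B) (hJ : EvenSet S B J)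
    (hA : EvenSet S B A) (hJA : J ⊆ A) (hcard : (A \ J).card = 2) {y : ℕ} (hy : y ∈ A \ J) :
    topMax B J A ∈ comp B A y := by
  obtain ⟨x, hx, -, h2⟩ := hB.exists_comp_topMax (B := B) hA.subset
    (Finset.card_pos.mp (by rw [hcard]; omega))
  rwa [← hB.comp_eq hA.subset (hJ.sdiff_subset_comp hB hA hJA hcard hy hx)]

/-- If the top maximum does not grow from one step to the next, A already attains that of the whole
interval. Then A can only fail to be first because the second step adds, in the same component, an
element larger than one of A \ J. -/
theorem EvenSet.not_isFirst_iff (hB : IsBuildingSet S B) (hc : IsChordal B) (hJ : EvenSet S B J)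
    (hA : EvenSet S B A) (hI : EvenSet S B I) (hJA : J ⊆ A) (hAI : A ⊆ I)
    (hcard : (A \ J).card = 2) (hcard' : (I \ A).card = 2) :
    ¬ IsFirst B J A I ↔ topMax B J A < topMax B A I ∨
      (topMax B J A = topMax B A I ∧ ∃ x ∈ A \ J, ∃ y ∈ I \ A, x < y) := by
  have hIJ : topMax B A I ≤ topMax B J I :=
    topMax_mono le_rfl (Finset.sdiff_subset_sdiff le_rfl hJA)
  constructor
  · intro hn
    rw [or_iff_not_imp_left]
    intro hle
    have hle := not_lt.mp hle
    -- Components of I inside A are dominated by components of A; the others contain elements of I \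
    -- A and are bounded by the top maximum of the second step.
    have hΛ : topMax B J I = topMax B J A := by
      refine le_antisymm (Finset.sup_le fun x hx => ?_)
        (topMax_mono hAI (Finset.sdiff_subset_sdiff hAI le_rfl))
      rw [Finset.mem_sdiff] at hx
      by_cases hsub : comp B I x ⊆ A
      · have hxA := hsub (hB.self_mem_comp hI.subset hx.1)
        refine le_trans (Finset.sup_mono ?_) (maxComp_le_topMax (Finset.mem_sdiff.mpr ⟨hxA, hx.2⟩))
        exact subset_comp (hB.comp_mem hI.subset hx.1) hsub (hB.self_mem_comp hI.subset hx.1)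
      · obtain ⟨y, hy, hyA⟩ := Finset.not_subset.mp hsub
        refine le_trans ?_ hle
        rw [maxComp, ← hB.comp_eq hI.subset hy]
        exact maxComp_le_topMax (Finset.mem_sdiff.mpr ⟨comp_subset hy, hyA⟩)
    have hsub : A \ J ⊆ comp B I (topMax B J I) := fun x hx => by
      rw [hΛ]
      exact mem_comp_comm.mp (comp_mono hAI (hJ.topMax_mem_comp hB hA hJA hcard hx))
    have hex : ∃ x ∈ A \ J, ∃ y ∈ comp B I (topMax B J I) \ A, ¬ y < x := by
      by_contra hcon
      push Not at hcon
      exact hn ⟨hJA, hAI, hcard, hsub, hcon⟩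
    obtain ⟨x, hx, y, hy, hxy⟩ := hex
    rw [Finset.mem_sdiff] at hy
    have hyI : y ∈ I \ A := Finset.mem_sdiff.mpr ⟨comp_subset hy.1, hy.2⟩
    refine ⟨?_, x, hx, y, hyI, lt_of_le_of_ne (not_lt.mp hxy) ?_⟩
    · refine le_antisymm ?_ hle
      rw [← hΛ, ← hB.maxComp_eq_topMax hI.subset
        ⟨y, Finset.sdiff_subset_sdiff le_rfl hJA hyI⟩ hy.1]
      exact maxComp_le_topMax hyI
    · rintro rfl
      exact hy.2 (Finset.mem_sdiff.mp hx).1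
  · rintro h hf
    have h1 := hf.topMax_eq hB hc hI.subset
    rcases h with h | ⟨h, x, hx, y, hy, hxy⟩
    · omega
    · refine lt_asymm hxy (hf.lt x hx y (Finset.mem_sdiff.mpr ⟨?_, (Finset.mem_sdiff.mp hy).2⟩))
      rw [← h1, h]
      exact mem_comp_comm.mp (hA.topMax_mem_comp hB hI hAI hcard' hy)

theorem IsFlag.not_isFirst_iff (hB : IsBuildingSet S B) (hc : IsChordal B) (h : IsFlag S B k c)
    {j : ℕ} (hj : j + 1 < k) : ¬ IsFirst B (c j) (c (j + 1)) (c (j + 2)) ↔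
      topMax B (c j) (c (j + 1)) < topMax B (c (j + 1)) (c (j + 2)) ∨
      (topMax B (c j) (c (j + 1)) = topMax B (c (j + 1)) (c (j + 2)) ∧
        ∃ x ∈ c (j + 1) \ c j, ∃ y ∈ c (j + 2) \ c (j + 1), x < y) :=
  (h.even j).not_isFirst_iff hB hc (h.even _) (h.even _) (h.subset j (by omega))
    (h.subset _ (by omega)) (h.card_sdiff j (by omega)) (h.card_sdiff _ (by omega))

/-- Along weakly growing top maxima, old elements are bounded by the previous top maximum and new
ones by their own component. This links top maxima with the prefix maxima in the definition of
`B`-permutations. -/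
theorem IsFlag.sup_eq_topMax (hB : IsBuildingSet S B) (h : IsFlag S B k c)
    (hmono : ∀ j, j + 1 < k →
      topMax B (c j) (c (j + 1)) ≤ topMax B (c (j + 1)) (c (j + 2)))
    {j : ℕ} (hj : j < k) : (c (j + 1)).sup id = topMax B (c j) (c (j + 1)) := by
  have hmem : ∀ y ∈ c (j + 1) \ c j, topMax B (c j) (c (j + 1)) ∈ comp B (c (j + 1)) y :=
    fun y hy => (h.even j).topMax_mem_comp hB (h.even _) (h.subset j hj) (h.card_sdiff j hj) hy
  have hne : (c (j + 1) \ c j).Nonempty := Finset.card_pos.mp (by rw [h.card_sdiff j hj]; omega)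
  refine le_antisymm ?_ (Finset.le_sup (f := id) (comp_subset (hmem _ hne.choose_spec)))
  refine Finset.sup_le fun y hy => ?_
  by_cases hyj : y ∈ c j
  · cases j with
    | zero => simp [h.zero] at hyj
    | succ j =>
      refine le_trans ?_ (hmono j hj)
      rw [← h.sup_eq_topMax hB hmono (j := j) (by omega)]
      exact Finset.le_sup (f := id) hyj
  · have hy' := Finset.mem_sdiff.mpr ⟨hy, hyj⟩
    exact hB.le_topMax (h.even _).subset hne (mem_comp_comm.mp (hmem y hy'))

end Falling

/-- The set of the first `n` members of a sequence. -/
def initial (e : ℕ → ℕ) (n : ℕ) : Finset ℕ := (Finset.range n).image e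

/-- The first `2 * k` members of the sequence `e` form an alternating `B`-permutation of `S`. -/
structure IsAlternatingWord (S : Finset ℕ) (B : Finset (Finset ℕ)) (k : ℕ) (e : ℕ → ℕ) : Prop where
  injOn : Set.InjOn e (Set.Iio (2 * k))
  initial_eq : initial e (2 * k) = S
  descent : ∀ j < k, e (2 * j + 1) < e (2 * j)
  ascent : ∀ j, j + 1 < k → e (2 * j + 1) < e (2 * j + 2)
  sup_mem : ∀ i < 2 * k, (initial e (i + 1)).sup id ∈ comp B (initial e (i + 1)) (e i)

/-! ### Alternating words and flags. -/

section Word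

variable {S : Finset ℕ} {B : Finset (Finset ℕ)} {k : ℕ} {c : ℕ → Finset ℕ} {e e' : ℕ → ℕ}

theorem initial_succ (n : ℕ) : initial e (n + 1) = insert (e n) (initial e n) := by
  rw [initial, initial, Finset.range_add_one, Finset.image_insert]

theorem initial_mono : Monotone (initial e) := fun _ _ h =>
  Finset.image_subset_image (Finset.range_mono h)

theorem notMem_initial (he : Set.InjOn e (Set.Iio (2 * k))) {m n : ℕ} (hn : n ≤ m)
    (hm : m < 2 * k) : e m ∉ initial e n := by
  intro hmem
  obtain ⟨i, hi, him⟩ := Finset.mem_image.mp hmem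
  rw [Finset.mem_range] at hi
  have := he (show i ∈ Set.Iio (2 * k) from lt_trans (lt_of_lt_of_le hi hn) hm) hm him
  omega

theorem initial_sdiff (he : Set.InjOn e (Set.Iio (2 * k))) {j : ℕ} (hj : j < k) :
    initial e (2 * j + 2) \ initial e (2 * j) = {e (2 * j), e (2 * j + 1)} := by
  have h1 := notMem_initial he (le_refl (2 * j)) (by omega)
  have h2 := notMem_initial he (Nat.le_succ (2 * j)) (by omega)
  rw [initial_succ, initial_succ]
  ext x
  simp only [Finset.mem_sdiff, Finset.mem_insert, Finset.mem_singleton]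
  constructor
  · tauto
  · rintro (rfl | rfl)
    · exact ⟨Or.inr (Or.inl rfl), h1⟩
    · exact ⟨Or.inl rfl, h2⟩

theorem IsAlternatingWord.card_sdiff (h : IsAlternatingWord S B k e) {j : ℕ} (hj : j < k) :
    (initial e (2 * j + 2) \ initial e (2 * j)).card = 2 := by
  rw [initial_sdiff h.injOn hj, Finset.card_pair (h.descent j hj).ne']

/-- The larger element of each pair is written first, so the maximum does not change when the
smaller one is appended; the condition at position 2 * j carries over to the set with both. -/
theorem IsAlternatingWord.sup_mem_comp (h : IsAlternatingWord S B k e) {j : ℕ} (hj : j < k) {y : ℕ}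
    (hy : y ∈ initial e (2 * j + 2) \ initial e (2 * j)) :
    (initial e (2 * j + 2)).sup id ∈ comp B (initial e (2 * j + 2)) y := by
  rw [initial_sdiff h.injOn hj, Finset.mem_insert, Finset.mem_singleton] at hy
  rcases hy with rfl | rfl
  · have h1 := h.sup_mem (2 * j) (by omega)
    have h2 : (initial e (2 * j + 2)).sup id = (initial e (2 * j + 1)).sup id := by
      have h3 : e (2 * j) ≤ (initial e (2 * j + 1)).sup id :=
        Finset.le_sup (f := id) (by rw [initial_succ]; exact Finset.mem_insert_self _ _)
      rw [initial_succ (2 * j + 1), Finset.sup_insert]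
      exact sup_eq_right.mpr ((h.descent j hj).le.trans h3)
    rw [h2]
    exact comp_mono (initial_mono (Nat.le_succ _)) h1
  · exact h.sup_mem (2 * j + 1) (by omega)

theorem IsAlternatingWord.isFlag (hB : IsBuildingSet S B) (h : IsAlternatingWord S B k e) :
    IsFlag S B k fun j => initial e (2 * min j k) where
  zero := by simp [initial]
  top := fun i hi => by
    rw [min_eq_right hi]
    exact h.initial_eq
  even := fun i => by
    have key : ∀ j ≤ k, EvenSet S B (initial e (2 * j)) := by
      intro j
      induction j with
      | zero => exact fun _ => ⟨by simp [initial], by simp [initial]⟩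
      | succ j ih =>
        intro hj
        refine (ih (by omega)).of_sdiff_subset_comp hB (initial_mono (by omega)) ?_
          (h.card_sdiff hj) fun y hy => h.sup_mem_comp hj hy
        rw [← h.initial_eq]
        exact initial_mono (by omega)
    exact key _ (min_le_right _ _)
  subset := fun i _ => initial_mono (by omega)
  card_sdiff := fun i hi => by
    rw [min_eq_left hi.le, min_eq_left (Nat.succ_le_of_lt hi)]
    exact h.card_sdiff hi

/-- Top maxima are prefix maxima and hence weakly grow. When they are equal, the ascent e (2 * j +
1) < e (2 * j + 2) is the required witness. -/
theorem IsAlternatingWord.not_isFirst (hB : IsBuildingSet S B) (hc : IsChordal B)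
    (h : IsAlternatingWord S B k e) {j : ℕ} (hj : j + 1 < k) :
    ¬ IsFirst B (initial e (2 * min j k)) (initial e (2 * min (j + 1) k))
      (initial e (2 * min (j + 2) k)) := by
  refine ((h.isFlag hB).not_isFirst_iff hB hc hj).mpr ?_
  have htop : ∀ i, i < k → topMax B (initial e (2 * i)) (initial e (2 * i + 2)) =
      (initial e (2 * i + 2)).sup id := by
    intro i hi
    obtain ⟨y, hy⟩ : (initial e (2 * i + 2) \ initial e (2 * i)).Nonempty :=
      Finset.card_pos.mp (by rw [h.card_sdiff hi]; omega)
    refine le_antisymm (Finset.sup_le fun x _ => Finset.sup_mono comp_subset) ?_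
    exact (le_maxComp (h.sup_mem_comp hi hy)).trans (maxComp_le_topMax hy)
  rw [min_eq_left (by omega : j ≤ k), min_eq_left (by omega : j + 1 ≤ k),
    min_eq_left (by omega : j + 2 ≤ k)]
  change topMax B (initial e (2 * j)) (initial e (2 * j + 2)) <
    topMax B (initial e (2 * (j + 1))) (initial e (2 * (j + 1) + 2)) ∨ _ = topMax B
      (initial e (2 * (j + 1))) (initial e (2 * (j + 1) + 2)) ∧ _
  rw [htop (j + 1) hj, show 2 * (j + 1) = 2 * j + 2 by ring, htop j (by omega)]
  rcases (Finset.sup_mono (f := id) (initial_mono (e := e)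
    (show 2 * j + 2 ≤ 2 * j + 2 + 2 by omega))).lt_or_eq with hlt | heq
  · exact Or.inl hlt
  · refine Or.inr ⟨heq, e (2 * j + 1), ?_, e (2 * j + 2), ?_, h.ascent j hj⟩
    · rw [initial_sdiff h.injOn (by omega)]
      simp
    · change _ ∈ initial e (2 * (j + 1) + 2) \ initial e (2 * (j + 1))
      rw [initial_sdiff h.injOn hj]
      simp [mul_add]

/-- The even prefixes determine the consecutive pairs, and the descents determine the order within
each pair. -/
theorem IsAlternatingWord.eqOn (h : IsAlternatingWord S B k e) (h' : IsAlternatingWord S B k e')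
    (heq : ∀ j ≤ k, initial e (2 * j) = initial e' (2 * j)) : Set.EqOn e e' (Set.Iio (2 * k)) := by
  have key : ∀ j < k, e (2 * j) = e' (2 * j) ∧ e (2 * j + 1) = e' (2 * j + 1) := by
    intro j hj
    have h1 := initial_sdiff h.injOn hj
    have h2 := heq (j + 1) hj
    rw [heq j hj.le, show 2 * j + 2 = 2 * (j + 1) by ring, h2, mul_add, mul_one,
      initial_sdiff h'.injOn hj] at h1
    have h3 := h.descent j hj
    have h4 := h'.descent j hj
    have h5 : e' (2 * j) ∈ ({e (2 * j), e (2 * j + 1)} : Finset ℕ) := by rw [← h1]; simp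
    have h6 : e' (2 * j + 1) ∈ ({e (2 * j), e (2 * j + 1)} : Finset ℕ) := by rw [← h1]; simp
    have h7 : e (2 * j) ∈ ({e' (2 * j), e' (2 * j + 1)} : Finset ℕ) := by rw [h1]; simp
    simp only [Finset.mem_insert, Finset.mem_singleton] at h5 h6 h7
    omega
  intro i hi
  have hi : i < 2 * k := hi
  rcases Nat.even_or_odd' i with ⟨j, rfl | rfl⟩
  · exact (key j (by omega)).1
  · exact (key j (by omega)).2

theorem IsFlag.exists_pairs (h : IsFlag S B k c) :
    ∃ a b : ℕ → ℕ, ∀ j < k, a j < b j ∧ c (j + 1) \ c j = {a j, b j} := by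
  have : ∀ j, ∃ p : ℕ × ℕ, j < k → p.1 < p.2 ∧ c (j + 1) \ c j = {p.1, p.2} := by
    intro j
    by_cases hj : j < k
    · obtain ⟨x, y, hxy, he⟩ := Finset.card_eq_two.mp (h.card_sdiff j hj)
      rcases lt_or_gt_of_ne hxy with hlt | hlt
      · exact ⟨(x, y), fun _ => ⟨hlt, he⟩⟩
      · exact ⟨(y, x), fun _ => ⟨hlt, by rw [he, Finset.pair_comm]⟩⟩
    · exact ⟨(0, 0), fun h => absurd h hj⟩
  choose p hp using this
  exact ⟨fun j => (p j).1, fun j => (p j).2, hp⟩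

/-- A flag that is nowhere locally first comes from an alternating word. -/
theorem IsFlag.exists_isAlternatingWord (hB : IsBuildingSet S B) (hc : IsChordal B)
    (h : IsFlag S B k c)
    (hn : ∀ j, j + 1 < k → ¬ IsFirst B (c j) (c (j + 1)) (c (j + 2))) :
    ∃ e, IsAlternatingWord S B k e ∧ ∀ j ≤ k, initial e (2 * j) = c j := by
  obtain ⟨a, b, hab⟩ := h.exists_pairs
  -- Each pair is written with its larger element b j before its smaller element a j.
  let e : ℕ → ℕ := fun i => if i % 2 = 0 then b (i / 2) else a (i / 2)
  have hee : ∀ j, e (2 * j) = b j := fun j => by simp [e]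
  have heo : ∀ j, e (2 * j + 1) = a j := fun j => by
    have h1 : (2 * j + 1) % 2 ≠ 0 := by omega
    have h2 : (2 * j + 1) / 2 = j := by omega
    simp only [e, if_neg h1, h2]
  have hcs : ∀ j < k, c (j + 1) = insert (a j) (insert (b j) (c j)) := by
    intro j hj
    rw [← Finset.sdiff_union_of_subset (h.subset j hj), (hab j hj).2]
    simp [Finset.insert_union]
  have hinit : ∀ j ≤ k, initial e (2 * j) = c j := by
    intro j
    induction j with
    | zero => simp [initial, h.zero]
    | succ j ih =>
      intro hj
      rw [mul_add, mul_one, initial_succ, initial_succ, hee, heo, ih (by omega), hcs j hj]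
  have hmono : ∀ j, j + 1 < k →
      topMax B (c j) (c (j + 1)) ≤ topMax B (c (j + 1)) (c (j + 2)) := by
    intro j hj
    rcases (h.not_isFirst_iff hB hc hj).mp (hn j hj) with h1 | h1
    · exact h1.le
    · exact h1.1.le
  have hsup : ∀ j < k, (c (j + 1)).sup id = topMax B (c j) (c (j + 1)) :=
    fun j hj => h.sup_eq_topMax hB hmono hj
  have hmem : ∀ j < k, ∀ y ∈ c (j + 1) \ c j, (c (j + 1)).sup id ∈ comp B (c (j + 1)) y := by
    intro j hj y hy
    rw [hsup j hj]
    exact (h.even j).topMax_mem_comp hB (h.even _) (h.subset j hj) (h.card_sdiff j hj) hy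
  have hcard : Set.InjOn e (Set.Iio (2 * k)) := by
    have : Set.InjOn e (Finset.range (2 * k)) := by
      rw [← Finset.card_image_iff]
      change (initial e (2 * k)).card = _
      rw [hinit k le_rfl, h.card le_rfl, Finset.card_range]
    simpa using this
  refine ⟨e, ⟨hcard, by rw [hinit k le_rfl, h.top k le_rfl], ?_, ?_, ?_⟩, hinit⟩
  · intro j hj
    rw [hee, heo]
    exact (hab j hj).1
  · intro j hj
    rw [heo, show 2 * j + 2 = 2 * (j + 1) by ring, hee]
    have h0 := hab j (by omega)
    have h1 := hab (j + 1) hj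
    rcases (h.not_isFirst_iff hB hc hj).mp (hn j hj) with h2 | ⟨-, x, hx, y, hy, hxy⟩
    -- If the maximum grows, the new maximum is b (j + 1), which exceeds the old maximum and hence a
    -- j. In the other case a j ≤ x < y ≤ b (j + 1).
    · rw [← hsup j (by omega), ← hsup (j + 1) hj] at h2
      have h3 : a j ≤ (c (j + 1)).sup id := by
        refine Finset.le_sup (f := id) ?_
        rw [hcs j (by omega)]
        exact Finset.mem_insert_self _ _
      have h4 : (c (j + 2)).sup id ≤ max (b (j + 1)) ((c (j + 1)).sup id) := by
        rw [hcs (j + 1) hj, Finset.sup_insert, Finset.sup_insert]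
        exact sup_le (h1.1.le.trans (le_max_left _ _)) le_rfl
      rw [show j + 1 + 1 = j + 2 from rfl] at h2
      omega
    · rw [h0.2, Finset.mem_insert, Finset.mem_singleton] at hx
      rw [h1.2, Finset.mem_insert, Finset.mem_singleton] at hy
      omega
  · intro i hi
    rcases Nat.even_or_odd' i with ⟨j, rfl | rfl⟩
    · have hj : j < k := by omega
      have hb : b j ∈ c (j + 1) \ c j := by rw [(hab j hj).2]; simp
      have ha : a j ∉ c j := by
        have : a j ∈ c (j + 1) \ c j := by rw [(hab j hj).2]; simp
        exact (Finset.mem_sdiff.mp this).2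
      have hM := hmem j hj _ hb
      have hbS : b j ∈ c (j + 1) := (Finset.mem_sdiff.mp hb).1
      rw [hee, initial_succ, hee, hinit j hj.le]
      have hsupeq : (insert (b j) (c j)).sup id = (c (j + 1)).sup id := by
        rw [hcs j hj, Finset.sup_insert (b := a j)]
        refine (sup_eq_right.mpr ?_).symm
        exact (hab j hj).1.le.trans (Finset.le_sup (f := id) (Finset.mem_insert_self _ _))
      rw [hsupeq]
      have hbc := hB.self_mem_comp (h.even _).subset hbS
      -- The segment from b j upwards of its component lies in B by chordality. It avoids a j < b j,
      -- so it already connects b j to the maximum before a j is added.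
      refine mem_comp.mpr ⟨_, hc _ (hB.comp_mem (h.even _).subset hbS) _ hbc, ?_,
        Finset.mem_filter.mpr ⟨hbc, le_rfl⟩,
        Finset.mem_filter.mpr ⟨hM, Finset.le_sup (f := id) hbS⟩⟩
      intro y hy
      rw [Finset.mem_filter] at hy
      have hyc := comp_subset hy.1
      rw [hcs j hj, Finset.mem_insert] at hyc
      rcases hyc with rfl | hyc
      · exact absurd (hab j hj).1 (not_lt.mpr hy.2)
      · exact hyc
    · have hj : j < k := by omega
      rw [heo, show 2 * j + 1 + 1 = 2 * (j + 1) by ring, hinit (j + 1) hj]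
      exact hmem j hj _ (by rw [(hab j hj).2]; simp)

end Word

/-! ### Permutations as words, and the count. -/

section Count

variable {S : Finset ℕ} {B : Finset (Finset ℕ)} {k : ℕ}

/-- The entries of a permutation as a sequence. -/
def entry (x : Fin S.card ≃ S) (i : ℕ) : ℕ := if h : i < S.card then x ⟨i, h⟩ else 0

theorem entry_coe (x : Fin S.card ≃ S) (i : Fin S.card) : entry x i = x i := by
  simp [entry]

theorem initialEntries_eq (x : Fin S.card ≃ S) (i : Fin S.card) :
    initialEntries x i = initial (entry x) (i + 1) := by
  ext y
  simp only [initialEntries, initial, Finset.mem_image, Finset.mem_Iic, Finset.mem_range]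
  constructor
  · rintro ⟨j, hj, rfl⟩
    exact ⟨j, Nat.lt_succ_of_le hj, entry_coe x j⟩
  · rintro ⟨j, hj, rfl⟩
    have hj' : j < S.card := by omega
    exact ⟨⟨j, hj'⟩, Nat.le_of_lt_succ hj, (entry_coe x ⟨j, hj'⟩).symm⟩

theorem initial_entry_subset (x : Fin S.card ≃ S) {n : ℕ} (hn : n ≤ S.card) :
    initial (entry x) n ⊆ S := by
  intro y hy
  obtain ⟨j, hj, rfl⟩ := Finset.mem_image.mp hy
  have hj' : j < S.card := by
    have := Finset.mem_range.mp hj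
    omega
  rw [show entry x j = x ⟨j, hj'⟩ from entry_coe x ⟨j, hj'⟩]
  exact (x _).2

theorem injOn_entry (x : Fin S.card ≃ S) : Set.InjOn (entry x) (Set.Iio S.card) := by
  intro i hi j hj hij
  have hij : (x ⟨i, hi⟩ : ℕ) = x ⟨j, hj⟩ := by
    rwa [← entry_coe x ⟨i, hi⟩, ← entry_coe x ⟨j, hj⟩]
  exact congrArg Fin.val (x.injective (Subtype.ext hij))

theorem isBPermutation_iff (hB : IsBuildingSet S B) (x : Fin S.card ≃ S) :
    IsBPermutation B x ↔ ∀ i < S.card, (initial (entry x) (i + 1)).sup id ∈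
      comp B (initial (entry x) (i + 1)) (entry x i) := by
  have key : ∀ i : Fin S.card, (∃ C, IsComponent (restrictTo B (initialEntries x i)) C ∧
      (x i : ℕ) ∈ C ∧ (initialEntries x i).sup id ∈ C) ↔ (initial (entry x) (i + 1)).sup id ∈
      comp B (initial (entry x) (i + 1)) (entry x i) := by
    intro i
    have hsub := initial_entry_subset x (n := i + 1) i.2
    have hmem : entry x i ∈ initial (entry x) (i + 1) := by
      rw [initial_succ]
      exact Finset.mem_insert_self _ _
    rw [initialEntries_eq, ← entry_coe]
    simp only [hB.isComponent_iff hsub]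
    constructor
    · rintro ⟨_, ⟨y, -, rfl⟩, h1, h2⟩
      rwa [hB.comp_eq hsub h1]
    · exact fun h => ⟨_, ⟨_, hmem, rfl⟩, hB.self_mem_comp hsub hmem, h⟩
  exact ⟨fun h i hi => (key ⟨i, hi⟩).mp (h _), fun h i => (key i).mpr (h i i.2)⟩

theorem isAlternating_iff (hk : S.card = 2 * k) (x : Fin S.card ≃ S) :
    IsAlternating x ↔ (∀ j < k, entry x (2 * j + 1) < entry x (2 * j)) ∧
      ∀ j, j + 1 < k → entry x (2 * j + 1) < entry x (2 * j + 2) := by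
  constructor
  · intro h
    constructor
    · intro j hj
      have := (h ⟨2 * j, by omega⟩ ⟨2 * j + 1, by omega⟩ rfl).1 (even_two_mul j)
      rwa [← entry_coe, ← entry_coe] at this
    · intro j hj
      have := (h ⟨2 * j + 1, by omega⟩ ⟨2 * j + 2, by omega⟩ rfl).2 ⟨j, rfl⟩
      rwa [← entry_coe, ← entry_coe] at this
  · rintro ⟨h1, h2⟩ i j hij
    rw [← entry_coe, ← entry_coe, hij]
    have hi := i.2
    have hj := j.2
    constructor
    · intro he
      obtain ⟨n, hn⟩ := he.two_dvd
      rw [hn]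
      exact h1 n (by omega)
    · rintro ⟨n, hn⟩
      rw [hn]
      exact h2 n (by omega)

theorem isAlternatingWord_entry_iff (hB : IsBuildingSet S B) (hk : S.card = 2 * k)
    (x : Fin S.card ≃ S) :
    IsBPermutation B x ∧ IsAlternating x ↔ IsAlternatingWord S B k (entry x) := by
  rw [isBPermutation_iff hB, isAlternating_iff hk]
  have hinj := injOn_entry x
  rw [hk] at hinj
  have hinit : initial (entry x) (2 * k) = S := by
    refine Finset.eq_of_subset_of_card_le (initial_entry_subset x hk.ge) ?_
    rw [initial, Finset.card_image_of_injOn (by simpa using hinj), Finset.card_range, hk]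
  rw [hk]
  exact ⟨fun ⟨h1, h2, h3⟩ => ⟨hinj, hinit, h2, h3, h1⟩, fun h => ⟨h.sup_mem, h.descent, h.ascent⟩⟩

theorem IsAlternatingWord.exists_entry_eqOn (hk : S.card = 2 * k) {e : ℕ → ℕ}
    (h : IsAlternatingWord S B k e) :
    ∃ x : Fin S.card ≃ S, Set.EqOn (entry x) e (Set.Iio (2 * k)) := by
  have hmem : ∀ i : Fin S.card, e i ∈ S := fun i =>
    h.initial_eq.subset (Finset.mem_image_of_mem _ (Finset.mem_range.mpr (by have := i.2; omega)))
  let f : Fin S.card → S := fun i => ⟨e i, hmem i⟩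
  have hf : Function.Bijective f := by
    rw [Fintype.bijective_iff_injective_and_card]
    refine ⟨fun i j hij => Fin.ext ?_, by simp⟩
    exact h.injOn (show (i : ℕ) < 2 * k by have := i.2; omega)
      (show (j : ℕ) < 2 * k by have := j.2; omega) (congrArg Subtype.val hij)
  refine ⟨Equiv.ofBijective f hf, fun i hi => ?_⟩
  have hi' : i < S.card := by
    rw [hk]
    exact hi
  exact entry_coe _ ⟨i, hi'⟩

theorem initial_congr {e e' : ℕ → ℕ} {m n : ℕ} (h : Set.EqOn e e' (Set.Iio m)) (hn : n ≤ m) :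
    initial e n = initial e' n :=
  Finset.image_congr fun i hi => h (lt_of_lt_of_le (by simpa using hi) hn)

theorem IsAlternatingWord.congr {e e' : ℕ → ℕ} (h : IsAlternatingWord S B k e)
    (heq : Set.EqOn e' e (Set.Iio (2 * k))) : IsAlternatingWord S B k e' where
  injOn := heq.injOn_iff.mpr h.injOn
  initial_eq := by rw [initial_congr heq le_rfl, h.initial_eq]
  descent := fun j hj => by
    rw [heq (show 2 * j < 2 * k by omega), heq (show 2 * j + 1 < 2 * k by omega)]
    exact h.descent j hj
  ascent := fun j hj => by
    rw [heq (show 2 * j + 2 < 2 * k by omega), heq (show 2 * j + 1 < 2 * k by omega)]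
    exact h.ascent j hj
  sup_mem := fun i hi => by
    rw [heq hi, initial_congr heq hi]
    exact h.sup_mem i hi

/-- The facet of a permutation consists of its proper nonempty prefixes of even length. It equals
its restriction by `IsAlternatingWord.not_isFirst`, it determines the word, and every such facet
arises. -/
theorem numAlternatingBPermutations_eq (hB : IsBuildingSet S B) (hc : IsChordal B)
    (hk : S.card = 2 * k) : numAlternatingBPermutations S B =
      ((facets S B k).filter fun F => restriction S B k F = F).card := by
  classical
  rw [numAlternatingBPermutations, ← Set.ncard_coe_finset (Finset.filter _ _)]
  simp only [isAlternatingWord_entry_iff hB hk]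
  refine Set.ncard_congr (fun x _ => facet S B fun j => initial (entry x) (2 * min j k)) ?_ ?_ ?_
  · intro x hx
    have hx : IsAlternatingWord S B k (entry x) := hx
    have hfl := hx.isFlag hB
    rw [Finset.mem_coe, Finset.mem_filter]
    exact ⟨hfl.facet_mem, (restriction_eq_iff hB hfl).mpr fun j hj => hx.not_isFirst hB hc hj⟩
  · intro x y hx hy hxy
    have hx : IsAlternatingWord S B k (entry x) := hx
    have hy : IsAlternatingWord S B k (entry y) := hy
    have h1 := (hx.isFlag hB).eq_of_facet_eq hB (hy.isFlag hB) hxy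
    have h2 := hx.eqOn hy fun j hj => by simpa [min_eq_left hj] using congrFun h1 j
    ext i
    rw [← entry_coe, ← entry_coe]
    exact h2 (show (i : ℕ) < 2 * k by have := i.2; omega)
  · intro F hF
    rw [Finset.mem_coe, Finset.mem_filter] at hF
    obtain ⟨c, h, rfl⟩ := mem_facets.mp hF.1
    obtain ⟨e, he, hec⟩ :=
      h.exists_isAlternatingWord hB hc ((restriction_eq_iff hB h).mp hF.2)
    obtain ⟨x, hx⟩ := he.exists_entry_eqOn hk
    refine ⟨x, he.congr hx, ?_⟩
    congr 1
    funext j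
    rw [initial_congr hx (by omega), hec _ (min_le_right _ _)]
    rcases le_total j k with hj | hj
    · rw [min_eq_left hj]
    · rw [min_eq_right hj, h.top j hj, h.top k le_rfl]

end Count

/-! ### The main theorem. -/

theorem theorem4p3 (S : Finset ℕ) (k : ℕ) (hk : 1 ≤ k) (hS : S.card = 2 * k)
    (B : Finset (Finset ℕ)) (hB : IsBuildingSet S B) (hchordal : IsChordal B)
    (heven : NoOddComponent B) :
    IsSphereBouquet (orderComplex (evenPoset S B)).Realization (k - 1)
        (numAlternatingBPermutations S B) ∧
      ∀ m : ℕ, IsSphereBouquet (orderComplex (evenPoset S B)).Realization (k - 1) m →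
        m = numAlternatingBPermutations S B := by
  have hS' := hB.evenSet_self heven
  have hsh := shelling_facets hB hchordal hS' hS
  have hne := nonempty_facets hB hchordal hS' hS
  have hcount := numAlternatingBPermutations_eq hB hchordal hS
  have hcard : ∀ F ∈ facets S B k, F.card = k - 1 := by
    intro F hF
    obtain ⟨c, h, rfl⟩ := mem_facets.mp hF
    exact h.card_facet hB
  have hX : (orderComplex (evenPoset S B)).Realization ≃ₜ polyhedron (facets S B k) :=
    Homeomorph.setCongr (realization_eq_polyhedron hB hchordal hS' hS)
  rcases hd : k - 1 with _ | d
  -- For k = 1 the empty set is the only facet and its own restriction, so the count is 1. The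
  -- realization is empty, since a point without support cannot have coordinate sum 1.
  · have hempty : ∀ F ∈ facets S B k, F = ∅ := fun F hF =>
      Finset.card_eq_zero.mp (by rw [hcard F hF, hd])
    have hone : numAlternatingBPermutations S B = 1 := by
      obtain ⟨F, hF⟩ := hne
      rw [hcount, Finset.card_eq_one]
      refine ⟨F, Finset.eq_singleton_iff_unique_mem.mpr ⟨Finset.mem_filter.mpr ⟨hF, ?_⟩, ?_⟩⟩
      · rw [hempty F hF, ← Finset.subset_empty, ← hempty F hF]
        exact hsh.restrict_subset F hF
      · intro G hG
        rw [hempty F hF, hempty G (Finset.mem_filter.mp hG).1]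
    refine ⟨⟨hone, ⟨fun w => ?_⟩⟩, fun m hm => hm.1.trans hone.symm⟩
    obtain ⟨a, -⟩ := w.2.2.1
    obtain ⟨hw, F, hF, hF0⟩ := (hX w).2
    have h1 := hw.2
    rw [Finset.sum_eq_zero fun a _ => hF0 a (by rw [hempty F hF]; simp)] at h1
    exact zero_ne_one h1
  · have hsphere : Nonempty (ContinuousMap.HomotopyEquiv
        (orderComplex (evenPoset S B)).Realization
        (SphereWedge (numAlternatingBPermutations S B) d)) := by
      classical
      obtain ⟨e⟩ := hsh.nonempty_homotopyEquiv (fun F hF => (hcard F hF).trans hd) hne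
      rw [hcount]
      convert Nonempty.intro (hX.toHomotopyEquiv.trans e)
    refine ⟨hsphere, fun m ⟨e⟩ => ?_⟩
    obtain ⟨e'⟩ := hsphere
    exact SphereWedge.card_eq_of_homotopyEquiv (e.symm.trans e')
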